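/- In the 3SUM-Indexing problem one preprocesses, without any restriction on the preprocessing time, two lists $A=(a_1,\dots,a_n)$ and $B=(b_1,\dots,b_n)$ of elements of a universe $U$ that is closed under addition, so that later, given any $c\in U$, one can decide whether there is a pair $(a,b)\in A\times B$ with $a+b=c$. The model is the word RAM with words of $w=\Omega(\log n)$ bits; an element of $U$ fits into one word, and two elements of $U$ are added in constant time. Space is the number of words of memory available to the queries (stored data and working space), and query time is the number of instructions executed in the worst case. Theorem. For every $0<\delta<1$, 3SUM-Indexing can be solved with space $O(n^{2-\delta/3})$ and query time $O(n^{\delta})$, up to a factor polylogarithmic in $n$ that may be put on either one of the two bounds. That is, there is a solution with $O(n^{2-\delta/3})$ words of space and $n^{\delta}(\log n)^{O(1)}$ query time, and there is a solution with $n^{2-\delta/3}(\log n)^{O(1)}$ words of space and $O(n^{\delta})$ query time. (For example, $\delta=3/4$ gives space $n^{1.75}$ and query time $n^{0.75}$, up to a polylogarithmic factor in one of them.) Consequently the Strong 3SUM-Indexing Conjecture, that no solution has both $n^{2-\Omega(1)}$ words of space and $n^{1-\Omega(1)}$ query time, is false: there are $\varepsilon>0$ and a solution with $O(n^{2-\varepsilon})$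 words of space and $O(n^{1-\varepsilon})$ query time. -/

import Mathlib

open Filter Asymptotics

/-- Binary operations of the word RAM: the usual operations on `w`-bit words, and `plus`, the
addition of the universe `U` from which the input elements are taken. -/
inductive RamOp where
  | add | sub | mul | div | mod | and | or | xor | shl | shr | plus

/-- Value of a binary operation on two `w`-bit words. Arithmetic is modulo `2 ^ w`; `div` and `mod`
are those of unsigned integers. The argument `plus` is the addition of `U` on encoded elements. -/
def RamOp.eval {w : ℕ} (plus : BitVec w → BitVec w → BitVec w) :
    RamOp → BitVec w → BitVec w → BitVec w
  | .add, x, y => x + y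
  | .sub, x, y => x - y
  | .mul, x, y => x * y
  | .div, x, y => x / y
  | .mod, x, y => x % y
  | .and, x, y => x &&& y
  | .or, x, y => x ||| y
  | .xor, x, y => x ^^^ y
  | .shl, x, y => x <<< y
  | .shr, x, y => x >>> y
  | .plus, x, y => plus x y

/-- Instructions of the word RAM. Registers and program positions are natural numbers. -/
inductive RamInstr where
  /-- `r := k` (modulo `2 ^ w`) -/
  | const (r k : ℕ)
  /-- `r := o a b`, for registers `a` and `b` -/
  | binary (o : RamOp) (r a b : ℕ)
  /-- `r := memory[a]`, the address being the content of the register `a` -/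
  | load (r a : ℕ)
  /-- `memory[a] := b`, the address being the content of the register `a` -/
  | store (a b : ℕ)
  /-- go to position `target` if the content of `a` is zero -/
  | jumpZero (a target : ℕ)
  /-- go to position `target` if the content of `a` is less than that of `b` (unsigned) -/
  | jumpLess (a b target : ℕ)
  /-- halt with a yes/no answer -/
  | halt (answer : Bool)

/-- A program is a finite list of instructions; it does not depend on the word length. -/
abbrev RamProgram := List RamInstr

/-- Configuration of a RAM with `w`-bit words and `M` memory cells. A program mentions only
finitely many registers, hence uses a constant number of words besides the memory. -/
structure RamConfig (w M : ℕ) where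
  pc : ℕ
  reg : ℕ → BitVec w
  mem : Fin M → BitVec w

/-- One instruction other than `halt`; `none` means that the machine crashes
(an access to a cell that does not exist). -/
def RamInstr.step {w M : ℕ} (plus : BitVec w → BitVec w → BitVec w) (s : RamConfig w M) :
    RamInstr → Option (RamConfig w M)
  | .const r k =>
      some { s with pc := s.pc + 1, reg := Function.update s.reg r (BitVec.ofNat w k) }
  | .binary o r a b =>
      some { s with
        pc := s.pc + 1, reg := Function.update s.reg r (o.eval plus (s.reg a) (s.reg b)) }
  | .load r a =>
      if h : (s.reg a).toNat < M then
        some { s with pc := s.pc + 1, reg := Function.update s.reg r (s.mem ⟨(s.reg a).toNat, h⟩) }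
      else none
  | .store a b =>
      if h : (s.reg a).toNat < M then
        some { s with pc := s.pc + 1, mem := Function.update s.mem ⟨(s.reg a).toNat, h⟩ (s.reg b) }
      else none
  | .jumpZero a target =>
      some { s with pc := if s.reg a = 0 then target else s.pc + 1 }
  | .jumpLess a b target =>
      some { s with pc := if (s.reg a).toNat < (s.reg b).toNat then target else s.pc + 1 }
  | .halt _ => none

/-- `ramRun plus P t s = some (b, σ)` says that `P`, started in the configuration `s`, halts after
executing at most `t` instructions, with answer `b` and memory contents `σ`. -/
def ramRun {w M : ℕ} (plus : BitVec w → BitVec w → BitVec w) (P : RamProgram) :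
    ℕ → RamConfig w M → Option (Bool × (Fin M → BitVec w))
  | 0, _ => none
  | t + 1, s =>
    match P[s.pc]? with
    | none => none
    | some (.halt b) => some (b, s.mem)
    | some i => (i.step plus s).bind (ramRun plus P t)

/-- Start of a query: memory `σ`, the queried word in register `0`, all other registers `0`. -/
def ramQuery {w M : ℕ} (σ : Fin M → BitVec w) (c : BitVec w) : RamConfig w M where
  pc := 0
  reg := Function.update (fun _ => 0) 0 c
  mem := σ

/-- `P` answers, in at most `t` steps each, an arbitrary sequence of queries "is `c = a + b` for some
`(a, b) ∈ A × B`?" by means of a memory of `M` words prepared for `A` and `B`: there is a nonempty set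
`I` of memory contents such that from every member of `I` every query is answered correctly, and
the memory is again in `I` afterwards. The memory includes the working space of the queries. -/
def AnswersThreeSumQueries {w n : ℕ} {U : Type} [Add U] (enc : U → BitVec w)
    (plus : BitVec w → BitVec w → BitVec w) (A B : Fin n → U) (P : RamProgram) (M t : ℕ) : Prop :=
  ∃ I : Set (Fin M → BitVec w), I.Nonempty ∧ ∀ σ ∈ I, ∀ c : U, ∃ (b : Bool) (σ' : Fin M → BitVec w),
    ramRun plus P t (ramQuery σ (enc c)) = some (b, σ') ∧ σ' ∈ I ∧
      (b = true ↔ ∃ i j, A i + B j = c)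

/-- 3SUM-Indexing can be solved with at most `space n` words and query time at most `time n` on lists
of length `n`: one query program works for all `n`, all word lengths `w` that are at least a
constant times `log n`, all universes `U` with an addition whose elements fit into one word and are
added in one step, and all lists `A`, `B` of `n` elements of `U`.
The time for preparing the memory is not restricted. -/
def ThreeSumIndexingSolvable (space time : ℕ → ℝ) : Prop :=
  ∃ (P : RamProgram) (κ : ℕ), ∀ n w : ℕ, κ * (Nat.log 2 n + 1) ≤ w →
    ∀ (U : Type) [Add U] (enc : U ↪ BitVec w) (plus : BitVec w → BitVec w → BitVec w),
      (∀ x y : U, plus (enc x) (enc y) = enc (x + y)) →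
      ∀ A B : Fin n → U, ∃ M t : ℕ, (M : ℝ) ≤ space n ∧ (t : ℝ) ≤ time n ∧
        AnswersThreeSumQueries enc plus A B P M t

/-- There is no solution with `n ^ (2 - Ω(1))` space and `n ^ (1 - Ω(1))` query time. -/
def StrongThreeSumIndexingConjecture : Prop :=
  ¬ ∃ ε : ℝ, 0 < ε ∧ ∃ space time : ℕ → ℝ, ThreeSumIndexingSolvable space time ∧
    space =O[atTop] (fun n : ℕ => (n : ℝ) ^ (2 - ε)) ∧
    time =O[atTop] (fun n : ℕ => (n : ℝ) ^ (1 - ε))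

/-! Let N = n² and let f map a position of A × B to the sum there. A query asks whether c is a value
of f, so it suffices to invert f in the manner of Hellman and of Fiat and Naor, with space about N/g
and time about g³, where g is about n^(δ/3).

Every g-th value in sorted order is a pivot (`exists_pivots`). A query that equals a pivot is
answered at once. Other values are light, and fewer than g light positions lie in one bucket, the
part between consecutive pivots. A table is a map from buckets to light positions; composed with the
bucket of f it is a map F on light positions. F is random except at m buckets, where its value is
stored: m walks of t steps are run, and the end bucket of each is overridden so that it leads back
to the start. A walk undisturbed by the others thus becomes a cycle of length t + 1
(`GoodWalk.periodic`), and for any x on it, the walk from the bucket of f x arrives at x within t +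
1 steps (`iterate_comp_succ`).

The random map must itself be stored. Buckets are arranged in a grid with O(n) rows and columns,
each row and each column receives random shifts, and a candidate is the sum of a row shift and a
column shift. Over all tables this takes about n g² words, which is below n²/g when g³ < n; this is
where δ < 1 enters. The sums at a family of points are independent once each point has a private row
or column (`Fresh`, `card_shiftMap_eq`), and two random walks are jointly fresh with high
probability (`card_not_fresh_le`). Only pairs of walks have to be controlled (`good_ge`), so on
average a table makes a fraction m(t+1)/(2M) of any set of light positions periodic, M being the
number of light positions (`exists_periodic_override`). Greedily chosen tables then cover everything
(`exists_cover`), with sizes balanced in `exists_parameters`. Values are made nearly uniform on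
light positions by rejection sampling (`lastWith`); if light positions are scarce, all are stored
(`exists_tables_of_few`).

The query algorithm is an explicit RAM program, verified by Hoare triples that carry step counts
(`RomMachine.Tri`). `exists_answers` joins both halves. Multiplying or dividing g by log n moves the
logarithms to the time or to the space. -/

/-! ### Runs of the word RAM -/

/-- Execution of `k` instructions, none of them `halt`. -/
def ramSteps {w M : ℕ} (plus : BitVec w → BitVec w → BitVec w) (P : RamProgram) :
    ℕ → RamConfig w M → Option (RamConfig w M)
  | 0, s => some s
  | k + 1, s =>
    match P[s.pc]? with
    | none => none
    | some i => (i.step plus s).bind (ramSteps plus P k)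

theorem ramSteps_add {w M : ℕ} {plus : BitVec w → BitVec w → BitVec w} {P : RamProgram}
    {k l : ℕ} {s s' s'' : RamConfig w M} (h : ramSteps plus P k s = some s')
    (h' : ramSteps plus P l s' = some s'') : ramSteps plus P (k + l) s = some s'' := by
  induction k generalizing s with
  | zero => simp only [ramSteps, Option.some.injEq] at h; subst h; simpa using h'
  | succ k ih =>
    rw [Nat.add_right_comm]
    simp only [ramSteps] at h ⊢
    split at h
    · simp at h
    · rw [Option.bind_eq_some_iff] at h
      obtain ⟨s1, h1, h2⟩ := h
      rw [h1]
      exact ih h2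

theorem ramRun_of_ramSteps {w M : ℕ} {plus : BitVec w → BitVec w → BitVec w} {P : RamProgram}
    {k t : ℕ} {s s' : RamConfig w M} {o : Bool × (Fin M → BitVec w)}
    (h : ramSteps plus P k s = some s') (h' : ramRun plus P t s' = some o) :
    ramRun plus P (k + t) s = some o := by
  induction k generalizing s with
  | zero => simp only [ramSteps, Option.some.injEq] at h; subst h; simpa using h'
  | succ k ih =>
    rw [Nat.add_right_comm]
    simp only [ramSteps] at h
    split at h
    · simp at h
    · rename_i i hi
      rw [Option.bind_eq_some_iff] at h
      obtain ⟨s1, h1, h2⟩ := h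
      have := ih h2
      rw [ramRun]
      simp only [hi]
      cases i <;> first | (simp only [h1]; exact this) | (simp [RamInstr.step] at h1)

theorem ramRun_succ {w M : ℕ} {plus : BitVec w → BitVec w → BitVec w} {P : RamProgram}
    {t : ℕ} {s : RamConfig w M} {o : Bool × (Fin M → BitVec w)}
    (h : ramRun plus P t s = some o) : ramRun plus P (t + 1) s = some o := by
  induction t generalizing s with
  | zero => simp [ramRun] at h
  | succ t ih =>
    rw [ramRun] at h ⊢
    split
    · rename_i hi; simp [hi] at h
    · rename_i b hi; simpa [hi] using h
    · rename_i i hb hi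
      simp only [hi] at h
      have h' : (i.step plus s).bind (ramRun plus P t) = some o := by
        cases i <;> exact h
      rw [Option.bind_eq_some_iff] at h' ⊢
      obtain ⟨s1, h1, h2⟩ := h'
      exact ⟨s1, h1, ih h2⟩

theorem ramRun_mono {w M : ℕ} {plus : BitVec w → BitVec w → BitVec w} {P : RamProgram}
    {t t' : ℕ} (htt : t ≤ t') {s : RamConfig w M} {o : Bool × (Fin M → BitVec w)}
    (h : ramRun plus P t s = some o) : ramRun plus P t' s = some o := by
  induction htt with
  | refl => exact h
  | step _ ih => exact ramRun_succ ih

theorem ramSteps_one {w M : ℕ} {plus : BitVec w → BitVec w → BitVec w} {P : RamProgram}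
    {i : RamInstr} {s s' : RamConfig w M} (hi : P[s.pc]? = some i) (h : i.step plus s = some s') :
    ramSteps plus P 1 s = some s' := by
  simp only [ramSteps, hi, h, Option.bind_some]

theorem ramRun_halt {w M : ℕ} {plus : BitVec w → BitVec w → BitVec w} {P : RamProgram}
    {b : Bool} {s : RamConfig w M} (hi : P[s.pc]? = some (.halt b)) :
    ramRun plus P 1 s = some (b, s.mem) := by
  simp only [ramRun, hi]

/-! ### Structured programs and timed Hoare triples -/

/-- Structured programs, compiled to RAM instructions by `Cmd.code`. -/
inductive Cmd where
  | op (i : RamInstr)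
  | seq (c d : Cmd)
  | unlessZero (a : ℕ) (c : Cmd)
  | unlessLess (a b : ℕ) (c : Cmd)
  | doWhileLess (c : Cmd) (a b : ℕ)

/-- Number of instructions of the compiled program. -/
def Cmd.len : Cmd → ℕ
  | .op _ => 1
  | .seq c d => c.len + d.len
  | .unlessZero _ c => c.len + 1
  | .unlessLess _ _ c => c.len + 1
  | .doWhileLess c _ _ => c.len + 1

/-- The compiled program, to be placed at position `p`. -/
def Cmd.code : Cmd → ℕ → RamProgram
  | .op i, _ => [i]
  | .seq c d, p => c.code p ++ d.code (p + c.len)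
  | .unlessZero a c, p => .jumpZero a (p + (c.len + 1)) :: c.code (p + 1)
  | .unlessLess a b c, p => .jumpLess a b (p + (c.len + 1)) :: c.code (p + 1)
  | .doWhileLess c a b, p => c.code p ++ [.jumpLess a b p]

theorem Cmd.length_code (c : Cmd) (p : ℕ) : (c.code p).length = c.len := by
  induction c generalizing p <;> simp [Cmd.code, Cmd.len, *]

/-- A word RAM whose memory contents, given by natural numbers, are never changed. -/
structure RomMachine where
  w : ℕ
  M : ℕ
  plus : BitVec w → BitVec w → BitVec w
  mem : ℕ → ℕ
  le_pow : M ≤ 2 ^ w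

namespace RomMachine

variable (m : RomMachine)

/-- Memory contents as words. -/
def words : Fin m.M → BitVec m.w := fun a => BitVec.ofNat m.w (m.mem a)

/-- The configuration with registers given by natural numbers. -/
def conf (p : ℕ) (ρ : ℕ → ℕ) : RamConfig m.w m.M := ⟨p, fun r => BitVec.ofNat m.w (ρ r), m.words⟩

/-- The addition of the universe, on natural numbers. -/
def plusNat (x y : ℕ) : ℕ := (m.plus (BitVec.ofNat m.w x) (BitVec.ofNat m.w y)).toNat

theorem plusNat_lt (x y : ℕ) : m.plusNat x y < 2 ^ m.w := BitVec.isLt _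

/-- From the registers `ρ`, the program `c` terminates within `T` steps in a state satisfying `Q`. -/
def Tri (c : Cmd) (T : ℕ) (ρ : ℕ → ℕ) (Q : (ℕ → ℕ) → Prop) : Prop :=
  -- The final registers are fixed before the surrounding program and the position of the code; only
  -- the step count may depend on these.
  ∃ ρ', Q ρ' ∧ ∀ (P pre post : RamProgram) (p : ℕ), pre.length = p → P = pre ++ c.code p ++ post →
    ∃ k ≤ T, ramSteps m.plus P k (m.conf p ρ) = some (m.conf (p + c.len) ρ')

variable {m}

theorem Tri.imp {c : Cmd} {T T' : ℕ} {ρ : ℕ → ℕ} {Q Q' : (ℕ → ℕ) → Prop} (h : m.Tri c T ρ Q)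
    (hT : T ≤ T') (hQ : ∀ ρ', Q ρ' → Q' ρ') : m.Tri c T' ρ Q' := by
  obtain ⟨ρ', h1, h2⟩ := h
  refine ⟨ρ', hQ _ h1, fun P pre post p hp hP => ?_⟩
  obtain ⟨k, hk, h⟩ := h2 P pre post p hp hP
  exact ⟨k, hk.trans hT, h⟩

theorem Tri.seq {c d : Cmd} {T T' : ℕ} {ρ : ℕ → ℕ} {Q : (ℕ → ℕ) → Prop}
    (h : m.Tri c T ρ (fun ρ' => m.Tri d T' ρ' Q)) : m.Tri (.seq c d) (T + T') ρ Q := by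
  obtain ⟨ρ1, ⟨ρ2, hQ, h2⟩, h1⟩ := h
  refine ⟨ρ2, hQ, fun P pre post p hp hP => ?_⟩
  obtain ⟨k, hk, hk'⟩ := h1 P pre (d.code (p + c.len) ++ post) p hp
    (by rw [hP, Cmd.code]; simp only [List.append_assoc])
  obtain ⟨l, hl, hl'⟩ := h2 P (pre ++ c.code p) post (p + c.len)
    (by rw [List.length_append, hp, Cmd.length_code])
    (by rw [hP, Cmd.code]; simp only [List.append_assoc])
  refine ⟨k + l, by omega, ?_⟩
  rw [Cmd.len, ← Nat.add_assoc]
  exact ramSteps_add hk' hl'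

theorem Tri.of_step {i : RamInstr} {ρ ρ' : ℕ → ℕ} {Q : (ℕ → ℕ) → Prop} (hQ : Q ρ')
    (h : ∀ p, i.step m.plus (m.conf p ρ) = some (m.conf (p + 1) ρ')) : m.Tri (.op i) 1 ρ Q := by
  refine ⟨ρ', hQ, fun P pre post p hp hP => ⟨1, le_rfl, ?_⟩⟩
  have : P[(m.conf p ρ).pc]? = some i := by
    subst hP hp; simp [conf, Cmd.code]
  simp only [ramSteps, this, h, Option.bind_some, Cmd.len]

theorem conf_update (p : ℕ) (ρ : ℕ → ℕ) (r v : ℕ) :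
    m.conf p (Function.update ρ r v) =
      { m.conf p ρ with reg := Function.update (m.conf p ρ).reg r (BitVec.ofNat m.w v) } := by
  simp only [conf, RamConfig.mk.injEq, true_and, and_true]
  funext q
  by_cases h : q = r
  · subst h; simp
  · simp [h]

theorem Tri.const {r k : ℕ} {ρ : ℕ → ℕ} {Q : (ℕ → ℕ) → Prop}
    (h : Q (Function.update ρ r k)) : m.Tri (.op (.const r k)) 1 ρ Q :=
  Tri.of_step h fun p => by rw [conf_update]; rfl

theorem Tri.binary {o : RamOp} {r a b v : ℕ} {ρ : ℕ → ℕ} {Q : (ℕ → ℕ) → Prop}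
    (hv : o.eval m.plus (BitVec.ofNat m.w (ρ a)) (BitVec.ofNat m.w (ρ b)) = BitVec.ofNat m.w v)
    (h : Q (Function.update ρ r v)) : m.Tri (.op (.binary o r a b)) 1 ρ Q :=
  Tri.of_step h fun p => by rw [conf_update, ← hv]; rfl

theorem Tri.add {r a b : ℕ} {ρ : ℕ → ℕ} {Q : (ℕ → ℕ) → Prop}
    (h : Q (Function.update ρ r (ρ a + ρ b))) : m.Tri (.op (.binary .add r a b)) 1 ρ Q :=
  Tri.binary (by simp [RamOp.eval, BitVec.ofNat_add]) h

theorem Tri.mul {r a b : ℕ} {ρ : ℕ → ℕ} {Q : (ℕ → ℕ) → Prop}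
    (h : Q (Function.update ρ r (ρ a * ρ b))) : m.Tri (.op (.binary .mul r a b)) 1 ρ Q :=
  Tri.binary (by simp [RamOp.eval, BitVec.ofNat_mul]) h

theorem Tri.plus {r a b : ℕ} {ρ : ℕ → ℕ} {Q : (ℕ → ℕ) → Prop}
    (h : Q (Function.update ρ r (m.plusNat (ρ a) (ρ b)))) :
    m.Tri (.op (.binary .plus r a b)) 1 ρ Q :=
  Tri.binary (by simp [RamOp.eval, plusNat]) h

theorem Tri.mov {r a : ℕ} {ρ : ℕ → ℕ} {Q : (ℕ → ℕ) → Prop}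
    (h : Q (Function.update ρ r (ρ a))) : m.Tri (.op (.binary .or r a a)) 1 ρ Q :=
  Tri.binary (by simp [RamOp.eval]) h

theorem Tri.div {r a b : ℕ} {ρ : ℕ → ℕ} {Q : (ℕ → ℕ) → Prop} (ha : ρ a < 2 ^ m.w)
    (hb : ρ b < 2 ^ m.w) (h : Q (Function.update ρ r (ρ a / ρ b))) :
    m.Tri (.op (.binary .div r a b)) 1 ρ Q := by
  refine Tri.binary ?_ h
  apply BitVec.eq_of_toNat_eq
  have : ρ a / ρ b < 2 ^ m.w := (Nat.div_le_self _ _).trans_lt ha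
  simp [RamOp.eval, Nat.mod_eq_of_lt, ha, hb, this]

theorem Tri.mod {r a b : ℕ} {ρ : ℕ → ℕ} {Q : (ℕ → ℕ) → Prop} (ha : ρ a < 2 ^ m.w)
    (hb : ρ b < 2 ^ m.w) (h : Q (Function.update ρ r (ρ a % ρ b))) :
    m.Tri (.op (.binary .mod r a b)) 1 ρ Q := by
  refine Tri.binary ?_ h
  apply BitVec.eq_of_toNat_eq
  have : ρ a % ρ b < 2 ^ m.w := (Nat.mod_le _ _).trans_lt ha
  simp [RamOp.eval, Nat.mod_eq_of_lt, ha, hb, this]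

theorem Tri.load {r a : ℕ} {ρ : ℕ → ℕ} {Q : (ℕ → ℕ) → Prop} (ha : ρ a < m.M)
    (h : Q (Function.update ρ r (m.mem (ρ a)))) : m.Tri (.op (.load r a)) 1 ρ Q := by
  refine Tri.of_step h fun p => ?_
  have : ((m.conf p ρ).reg a).toNat = ρ a := by
    simp [conf, Nat.mod_eq_of_lt (ha.trans_le m.le_pow)]
  rw [conf_update]
  simp only [RamInstr.step, this, ha, dif_pos]
  rfl

theorem Tri.unlessZero {a : ℕ} {c : Cmd} {T : ℕ} {ρ : ℕ → ℕ} {Q : (ℕ → ℕ) → Prop}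
    (ha : ρ a < 2 ^ m.w) (h0 : ρ a = 0 → Q ρ) (h1 : ρ a ≠ 0 → m.Tri c T ρ Q) :
    m.Tri (.unlessZero a c) (T + 1) ρ Q := by
  have hz : BitVec.ofNat m.w (ρ a) = 0 ↔ ρ a = 0 := by
    rw [← BitVec.toNat_inj]; simp [Nat.mod_eq_of_lt ha]
  have key : ∀ (P pre post : RamProgram) (p : ℕ), pre.length = p →
      P = pre ++ (Cmd.unlessZero a c).code p ++ post → ramSteps m.plus P 1 (m.conf p ρ) =
        some (m.conf (if ρ a = 0 then p + (c.len + 1) else p + 1) ρ) := by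
    intro P pre post p hp hP
    have : P[(m.conf p ρ).pc]? = some (.jumpZero a (p + (c.len + 1))) := by
      subst hP hp; simp [conf, Cmd.code]
    refine ramSteps_one this ?_
    simp only [RamInstr.step, conf, hz]
  by_cases ha0 : ρ a = 0
  · refine ⟨ρ, h0 ha0, fun P pre post p hp hP => ⟨1, by omega, ?_⟩⟩
    rw [key P pre post p hp hP, if_pos ha0]; rfl
  · obtain ⟨ρ', hQ, h⟩ := h1 ha0
    refine ⟨ρ', hQ, fun P pre post p hp hP => ?_⟩
    obtain ⟨k, hk, hk'⟩ := h P (pre ++ [.jumpZero a (p + (c.len + 1))]) post (p + 1)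
      (by simp [hp]) (by rw [hP, Cmd.code]; simp)
    refine ⟨1 + k, by omega, ramSteps_add (key P pre post p hp hP) ?_⟩
    rw [if_neg ha0, hk', Cmd.len, Nat.add_assoc, Nat.add_comm 1]

theorem Tri.unlessLess {a b : ℕ} {c : Cmd} {T : ℕ} {ρ : ℕ → ℕ} {Q : (ℕ → ℕ) → Prop}
    (ha : ρ a < 2 ^ m.w) (hb : ρ b < 2 ^ m.w) (h0 : ρ a < ρ b → Q ρ)
    (h1 : ρ b ≤ ρ a → m.Tri c T ρ Q) : m.Tri (.unlessLess a b c) (T + 1) ρ Q := by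
  have key : ∀ (P pre post : RamProgram) (p : ℕ), pre.length = p →
      P = pre ++ (Cmd.unlessLess a b c).code p ++ post → ramSteps m.plus P 1 (m.conf p ρ) =
        some (m.conf (if ρ a < ρ b then p + (c.len + 1) else p + 1) ρ) := by
    intro P pre post p hp hP
    have : P[(m.conf p ρ).pc]? = some (.jumpLess a b (p + (c.len + 1))) := by
      subst hP hp; simp [conf, Cmd.code]
    refine ramSteps_one this ?_
    simp only [RamInstr.step, conf, BitVec.toNat_ofNat, Nat.mod_eq_of_lt ha, Nat.mod_eq_of_lt hb]
  by_cases hab : ρ a < ρ b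
  · refine ⟨ρ, h0 hab, fun P pre post p hp hP => ⟨1, by omega, ?_⟩⟩
    rw [key P pre post p hp hP, if_pos hab]; rfl
  · obtain ⟨ρ', hQ, h⟩ := h1 (not_lt.1 hab)
    refine ⟨ρ', hQ, fun P pre post p hp hP => ?_⟩
    obtain ⟨k, hk, hk'⟩ := h P (pre ++ [.jumpLess a b (p + (c.len + 1))]) post (p + 1)
      (by simp [hp]) (by rw [hP, Cmd.code]; simp)
    refine ⟨1 + k, by omega, ramSteps_add (key P pre post p hp hP) ?_⟩
    rw [if_neg hab, hk', Cmd.len, Nat.add_assoc, Nat.add_comm 1]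

/-- The test stands after the body, so at least one pass is made: `d` counts the passes that remain
after the current one, and the induction is on `d`. -/
theorem Tri.doWhileLess {c : Cmd} {a b : ℕ} {T N : ℕ} {Q : (ℕ → ℕ) → Prop}
    (Inv : ℕ → (ℕ → ℕ) → Prop) (hN : N < 2 ^ m.w)
    (hstep : ∀ k < N, ∀ ρ, Inv k ρ →
      m.Tri c T ρ (fun ρ' => Inv (k + 1) ρ' ∧ ρ' a = k + 1 ∧ ρ' b = N))
    (hQ : ∀ ρ, Inv N ρ → Q ρ) :
    ∀ d k, k + (d + 1) = N → ∀ ρ, Inv k ρ →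
      m.Tri (.doWhileLess c a b) ((T + 1) * (d + 1)) ρ Q := by
  have key : ∀ (ρ' : ℕ → ℕ) (j : ℕ), ρ' a = j → ρ' b = N → j ≤ N →
      ∀ (P pre post : RamProgram) (p : ℕ), pre.length = p →
      P = pre ++ (Cmd.doWhileLess c a b).code p ++ post →
      ramSteps m.plus P 1 (m.conf (p + c.len) ρ') =
        some (m.conf (if j < N then p else p + c.len + 1) ρ') := by
    intro ρ' j ha hb hj P pre post p hp hP
    have : P[(m.conf (p + c.len) ρ').pc]? = some (.jumpLess a b p) := by
      subst hP
      simp only [conf, Cmd.code]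
      rw [List.append_assoc, List.getElem?_append_right (by omega), List.append_assoc,
        List.getElem?_append_right (by rw [Cmd.length_code]; omega), Cmd.length_code, hp]
      simp
    refine ramSteps_one this ?_
    simp only [RamInstr.step, conf, BitVec.toNat_ofNat, ha, hb, Nat.mod_eq_of_lt (hj.trans_lt hN), Nat.mod_eq_of_lt hN]
  intro d
  induction d with
  | zero =>
    intro k hk ρ hI
    obtain ⟨ρ', ⟨hI', ha, hb⟩, h⟩ := hstep k (by omega) ρ hI
    have hk1 : k + 1 = N := by omega
    refine ⟨ρ', hQ _ (hk1 ▸ hI'), fun P pre post p hp hP => ?_⟩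
    obtain ⟨l, hl, hl'⟩ := h P pre ([.jumpLess a b p] ++ post) p hp
      (by rw [hP, Cmd.code]; simp only [List.append_assoc])
    refine ⟨l + 1, by omega, ramSteps_add hl' ?_⟩
    rw [key ρ' (k + 1) ha hb (by omega) P pre post p hp hP, if_neg (by omega)]; rfl
  | succ d ih =>
    intro k hk ρ hI
    obtain ⟨ρ', ⟨hI', ha, hb⟩, h⟩ := hstep k (by omega) ρ hI
    obtain ⟨ρ'', hQ', h'⟩ := ih (k + 1) (by omega) ρ' hI'
    refine ⟨ρ'', hQ', fun P pre post p hp hP => ?_⟩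
    obtain ⟨l, hl, hl'⟩ := h P pre ([.jumpLess a b p] ++ post) p hp
      (by rw [hP, Cmd.code]; simp only [List.append_assoc])
    obtain ⟨l2, hl2, hl2'⟩ := h' P pre post p hp hP
    refine ⟨l + 1 + l2, by nlinarith, ramSteps_add (ramSteps_add hl' ?_) hl2'⟩
    rw [key ρ' (k + 1) ha hb (by omega) P pre post p hp hP, if_pos (by omega)]

end RomMachine

/-- Execute `c` if the registers `a` and `b` are equal. -/
def Cmd.ifEq (a b : ℕ) (c : Cmd) : Cmd := .unlessLess a b (.unlessLess b a c)

/-- `for i = 0, …, n - 1 do c`, for registers `i` and `n`; the register `99` is overwritten. -/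
def Cmd.for (i n : ℕ) (c : Cmd) : Cmd :=
  .seq (.op (.const i 0)) (.unlessZero n (.doWhileLess
    (.seq c (.seq (.op (.const 99 1)) (.op (.binary .add i i 99)))) i n))

namespace RomMachine

variable {m : RomMachine}

theorem Tri.ifEq {a b : ℕ} {c : Cmd} {T : ℕ} {ρ : ℕ → ℕ} {Q : (ℕ → ℕ) → Prop}
    (ha : ρ a < 2 ^ m.w) (hb : ρ b < 2 ^ m.w) (h0 : ρ a ≠ ρ b → Q ρ)
    (h1 : ρ a = ρ b → m.Tri c T ρ Q) : m.Tri (.ifEq a b c) (T + 2) ρ Q :=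
  Tri.unlessLess ha hb (fun h => h0 h.ne) fun h =>
    Tri.unlessLess hb ha (fun h => h0 h.ne') fun h' => h1 (le_antisymm h' h)

/-- The body must leave counter and bound unchanged. The next invariant is required of the registers
after the increment, which also writes 1 to register 99. -/
theorem Tri.for {i n : ℕ} {c : Cmd} {T N : ℕ} {ρ : ℕ → ℕ} {Q : (ℕ → ℕ) → Prop} (hi : i < 99)
    (hn : n < 99) (hin : n ≠ i) (hN : N < 2 ^ m.w) (hρ : ρ n = N) (Inv : ℕ → (ℕ → ℕ) → Prop)
    (h0 : Inv 0 (Function.update ρ i 0))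
    (hstep : ∀ k < N, ∀ ρ, Inv k ρ → ρ i = k → ρ n = N → m.Tri c T ρ fun ρ' =>
      ρ' i = k ∧ ρ' n = N ∧ Inv (k + 1) (Function.update (Function.update ρ' 99 1) i (k + 1)))
    (hQ : ∀ ρ, Inv N ρ → Q ρ) : m.Tri (.for i n c) ((T + 3) * N + 2) ρ Q := by
  refine Tri.imp (T := 1 + ((T + 3) * N + 1)) (Tri.seq (Tri.const ?_)) (by omega) fun _ h => h
  have hn' : Function.update ρ i 0 n = N := by simp [hin, hρ]
  -- The guard is needed for N = 0, because the loop inside would run once.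
  refine Tri.unlessZero (by rw [hn']; exact hN) (fun h => ?_) (fun h => ?_)
  · have : N = 0 := by rw [← hn', h]
    subst this
    exact hQ _ h0
  · obtain ⟨d, rfl⟩ : ∃ d, N = d + 1 := Nat.exists_eq_succ_of_ne_zero (by rwa [hn'] at h)
    refine Tri.doWhileLess (T := T + 2) (fun k ρ => Inv k ρ ∧ ρ i = k ∧ ρ n = d + 1) hN ?_
      (fun ρ h => hQ _ h.1) d 0 (by omega) _ ⟨h0, by simp, hn'⟩
    rintro k hk ρ ⟨hI, h1, h2⟩
    refine Tri.seq ((hstep k hk ρ hI h1 h2).imp le_rfl ?_)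
    rintro ρ' ⟨h1', h2', h3⟩
    refine Tri.seq (T := 1) (T' := 1) (Tri.const (Tri.add ?_))
    have e : (Function.update (Function.update ρ' 99 1) i
        (Function.update ρ' 99 1 i + Function.update ρ' 99 1 99)) =
        Function.update (Function.update ρ' 99 1) i (k + 1) := by
      simp [hi.ne, h1']
    rw [e]
    refine ⟨⟨h3, by simp, ?_⟩, by simp, ?_⟩ <;> simp [hin, hn.ne, h2']

/-- A terminating structured program followed by a test of the register `a` is a query program. -/
theorem ramRun_of_tri {c : Cmd} {T : ℕ} {ρ : ℕ → ℕ} {a : ℕ} {b : Bool}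
    {Q : (ℕ → ℕ) → Prop} (h : m.Tri c T ρ Q)
    (hQ : ∀ ρ', Q ρ' → ρ' a = if b then 1 else 0) (hw : 0 < m.w) :
    ramRun m.plus (c.code 0 ++ [.jumpZero a (c.len + 2), .halt true, .halt false]) (T + 2)
      (m.conf 0 ρ) = some (b, m.words) := by
  obtain ⟨ρ', hρ', h⟩ := h
  obtain ⟨k, hk, h⟩ := h _ [] [.jumpZero a (c.len + 2), .halt true, .halt false] 0 rfl rfl
  have hv := hQ _ hρ'
  have e (j : ℕ) : ([] ++ c.code 0 ++ [.jumpZero a (c.len + 2), .halt true, .halt false] :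
      RamProgram)[c.len + j]? =
      ([.jumpZero a (c.len + 2), .halt true, .halt false] : RamProgram)[j]? := by
    rw [List.nil_append, List.getElem?_append_right (by rw [Cmd.length_code]; omega),
      Cmd.length_code, Nat.add_sub_cancel_left]
  have h1w : BitVec.ofNat m.w 1 ≠ 0 := by
    intro h
    have := congrArg BitVec.toNat h
    simp [Nat.mod_eq_of_lt (Nat.one_lt_two_pow hw.ne')] at this
  rw [Nat.zero_add] at h
  refine ramRun_mono (t := k + 1 + 1) (by omega) (ramRun_of_ramSteps
    (s' := m.conf (if b then c.len + 1 else c.len + 2) ρ') (ramSteps_add h ?_) ?_)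
  · refine ramSteps_one (e 0) ?_
    cases b <;> simp_all [RamInstr.step, conf]
  · refine ramRun_halt (b := b) ?_
    cases b
    · exact e 2
    · exact e 1

end RomMachine

namespace RomMachine

variable {m : RomMachine}

theorem Tri.le {c : Cmd} {T T' : ℕ} {ρ : ℕ → ℕ} {Q : (ℕ → ℕ) → Prop} (h : m.Tri c T ρ Q)
    (hT : T ≤ T') : m.Tri c T' ρ Q :=
  h.imp hT fun _ h => h

end RomMachine

/-! ### Memory layout and query program -/

/-- The largest positive index `i < 2 ^ B` with `a i ≤ y`, or `0`. -/
def sortedIndex (a : ℕ → ℕ) (B y : ℕ) : ℕ := Nat.findGreatest (fun i => a i ≤ y) (2 ^ B - 1)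

theorem sortedIndex_lt (a : ℕ → ℕ) (B y : ℕ) : sortedIndex a B y < 2 ^ B :=
  (Nat.findGreatest_le _).trans_lt (Nat.sub_lt (by positivity) one_pos)

/-- Contents of the memory of the query program. The memory consists of eight interleaved arrays. -/
structure Layout where
  /-- length of the two input lists -/
  n : ℕ
  /-- number of bits of a bucket index -/
  B : ℕ
  /-- binary logarithm of the number of cells for overrides -/
  B' : ℕ
  /-- number of tables -/
  tables : ℕ
  /-- number of steps of a walk -/
  walk : ℕ
  /-- number of candidates for a step -/
  tries : ℕ
  /-- number of consecutive buckets with the same row -/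
  k : ℕ
  /-- number of rows, and number of columns -/
  r : ℕ
  /-- position used if all candidates fail -/
  dflt : ℕ
  /-- number of cells of each array -/
  size : ℕ
  /-- the eight arrays: header, first list, second list, pivots, keys and values of overrides,
  row shifts, column shifts -/
  arr : ℕ → ℕ → ℕ

/-- The header of a layout. -/
def Layout.header (D : Layout) : ℕ → ℕ
  | 1 => D.n
  | 2 => D.n * D.n
  | 3 => D.B
  | 4 => 2 ^ D.B
  | 5 => D.B'
  | 6 => 2 ^ D.B'
  | 7 => D.tables
  | 8 => D.walk
  | 9 => D.tries
  | 10 => D.k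
  | 11 => D.r
  | 12 => D.dflt
  | 13 => 1
  | 14 => 2
  | 15 => 8
  | _ => 0

/-- Agreement of a machine with a layout. -/
structure Layout.Fits (D : Layout) (m : RomMachine) : Prop where
  size_eq : m.M = 8 * D.size
  mem_eq : ∀ i, ∀ j < 8, m.mem (i * 8 + j) = D.arr j i
  header_eq : ∀ i < 16, D.arr 0 i = D.header i
  le_size : 16 ≤ D.size
  w_pos : 0 < m.w
  header_lt : ∀ i, D.header i < 2 ^ m.w

/-- Consistency of the parameters of a layout. -/
structure Layout.Valid (D : Layout) (w : ℕ) : Prop where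
  n_pos : 0 < D.n
  n_le : D.n ≤ D.size
  pow_le : 2 ^ D.B ≤ D.size
  pow_le' : 2 ^ D.B' ≤ D.size
  shifts_le : D.tables * D.r * D.tries ≤ D.size
  r_pos : 0 < D.r
  buckets_le : 2 ^ D.B ≤ D.k * D.r
  dflt_lt : D.dflt < D.n * D.n
  pivots_lt : ∀ i, D.arr 3 i < 2 ^ w
  pivots_mono : ∀ i j, i ≤ j → j < 2 ^ D.B → D.arr 3 i ≤ D.arr 3 j
  keys_lt : ∀ i, D.arr 4 i < 2 ^ w
  keys_mono : ∀ i j, i ≤ j → j < 2 ^ D.B' → D.arr 4 i ≤ D.arr 4 j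
  values_lt : ∀ i, D.arr 5 i < D.n * D.n
  rows_lt : ∀ i, D.arr 6 i < D.n * D.n
  cols_lt : ∀ i, D.arr 7 i < D.n * D.n
  sum_lt : 2 * (D.n * D.n) < 2 ^ w
  key_lt : D.tables * 2 ^ D.B < 2 ^ w

namespace Layout

variable (D : Layout) (m : RomMachine)

/-- The sum at the position `x` of the product of the two lists. -/
def val (x : ℕ) : ℕ := m.plusNat (D.arr 1 (x / D.n)) (D.arr 2 (x % D.n))

/-- The bucket of a word. -/
def bucket (y : ℕ) : ℕ := sortedIndex (D.arr 3) D.B y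

/-- The words other than pivots. -/
def Light (y : ℕ) : Prop := D.arr 3 (D.bucket y) ≠ y

/-- A candidate for the step from the bucket `v` in the table `i`. -/
def cand (i v u : ℕ) : ℕ :=
  (D.arr 6 ((i * D.r + v / D.k) * D.tries + u) +
    D.arr 7 ((i * D.r + v % D.r) * D.tries + u)) % (D.n * D.n)

open Classical in
/-- The last light candidate among the first `u` ones. -/
noncomputable def scan (i v : ℕ) : ℕ → ℕ
  | 0 => D.dflt
  | u + 1 => if D.Light (D.val m (D.cand i v u)) then D.cand i v u else scan i v u

/-- The key of the bucket `v` in the table `i`. -/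
def key (i v : ℕ) : ℕ := i * 2 ^ D.B + v

/-- The position of a key among the overrides. -/
def slot (i v : ℕ) : ℕ := sortedIndex (D.arr 4) D.B' (D.key i v)

open Classical in
/-- The step from the bucket `v` in the table `i`. -/
noncomputable def next (i v : ℕ) : ℕ :=
  if D.arr 4 (D.slot i v) = D.key i v then D.arr 5 (D.slot i v) else D.scan m i v D.tries

/-- The bucket reached from `v` by `j` steps in the table `i`. -/
noncomputable def walkFrom (i v j : ℕ) : ℕ := (fun v => D.bucket (D.val m (D.next m i v)))^[j] v

/-- The query algorithm finds `c`. -/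
def Finds (c : ℕ) : Prop :=
  ¬ D.Light c ∨ ∃ i < D.tables, ∃ j < D.walk, D.val m (D.next m i (D.walkFrom m i (D.bucket c) j)) = c

/-- The registers `1, …, 15` contain the header. -/
def Loaded (ρ : ℕ → ℕ) : Prop := ∀ q, 1 ≤ q → q ≤ 15 → ρ q = D.header q

variable {D m}

theorem Loaded.congr {ρ ρ' : ℕ → ℕ} (h : D.Loaded ρ) (h' : ∀ q < 20, ρ' q = ρ q) : D.Loaded ρ' :=
  fun q h1 h2 => by rw [h' q (by omega), h q h1 h2]

end Layout

/-- Load into the register `r` the cell of the array `j` given by the register `i`. -/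
def Cmd.fetch (r i j : ℕ) : Cmd :=
  .seq (.op (.binary .mul 98 i 15)) (.seq (.op (.const 99 j))
    (.seq (.op (.binary .add 98 98 99)) (.op (.load r 98))))

/-- Copy the register `a` to the register `r`. -/
def Cmd.mov (r a : ℕ) : Cmd := .op (.binary .or r a a)

/-- Binary search for the content of the register `y` in the sorted array `j`. -/
def Cmd.search (j y b v : ℕ) : Cmd :=
  .seq (.op (.const 80 0)) (.seq (.mov 81 v) (.for 82 b
    (.seq (.op (.binary .div 81 81 14)) (.seq (.op (.binary .add 83 80 81))
      (.seq (.fetch 84 83 j) (.unlessLess y 84 (.op (.binary .add 80 80 81))))))))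

/-- Compute bucket and lightness of the word in register `61`. -/
def Cmd.locate : Cmd :=
  .seq (.search 3 61 3 4) (.seq (.mov 62 80) (.seq (.fetch 68 62 3) (.seq (.op (.const 63 1))
    (.ifEq 68 61 (.op (.const 63 0))))))

/-- Compute value, bucket and lightness at the position in register `60`. -/
def Cmd.evaluate : Cmd :=
  .seq (.op (.binary .div 64 60 1)) (.seq (.op (.binary .mod 65 60 1)) (.seq (.fetch 66 64 1)
    (.seq (.fetch 67 65 2) (.seq (.op (.binary .plus 61 66 67)) .locate))))

/-- Go through the candidates of a step. -/
def Cmd.scan : Cmd :=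
  .seq (.op (.binary .div 44 31 10)) (.seq (.op (.binary .mod 45 31 11))
    (.seq (.op (.binary .mul 46 30 11)) (.seq (.op (.binary .add 44 46 44))
    (.seq (.op (.binary .mul 44 44 9)) (.seq (.op (.binary .add 45 46 45))
    (.seq (.op (.binary .mul 45 45 9)) (.for 47 9
      (.seq (.op (.binary .add 50 44 47)) (.seq (.fetch 48 50 6)
      (.seq (.op (.binary .add 51 45 47)) (.seq (.fetch 49 51 7)
      (.seq (.op (.binary .add 60 48 49)) (.seq (.op (.binary .mod 60 60 2))
      (.seq .evaluate (.unlessZero 63 (.mov 32 60))))))))))))))))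

/-- One step from the bucket in register `31` in the table in register `30`. -/
def Cmd.next : Cmd :=
  .seq (.op (.binary .mul 40 30 4)) (.seq (.op (.binary .add 40 40 31))
    (.seq (.search 4 40 5 6) (.seq (.mov 41 80) (.seq (.fetch 42 41 4) (.seq (.mov 32 12)
    (.seq (.op (.const 43 1))
    (.seq (.ifEq 42 40 (.seq (.op (.const 43 0)) (.fetch 32 41 5)))
    (.unlessZero 43 .scan))))))))

/-- All walks for the word in register `0`. -/
def Cmd.walks : Cmd :=
  .for 22 7 (.seq (.mov 30 22) (.seq (.mov 31 21) (.for 23 8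
    (.seq .next (.seq (.mov 60 32) (.seq .evaluate
      (.seq (.ifEq 61 0 (.op (.const 20 1))) (.mov 31 62))))))))

/-- The query for nonempty lists. -/
def Cmd.query : Cmd :=
  .seq (.mov 61 0) (.seq .locate (.seq (.op (.const 20 1))
    (.seq (.unlessZero 63 (.op (.const 20 0))) (.seq (.mov 21 62) .walks))))

/-- Load the registers `1, …, q` from the header. -/
def Cmd.init : ℕ → Cmd
  | 0 => .op (.const 20 0)
  | q + 1 => .seq (Cmd.init q) (.seq (.op (.const 98 ((q + 1) * 8))) (.op (.load (q + 1) 98)))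

/-- The query program. -/
def queryProgram : RamProgram :=
  let c : Cmd := .seq (.init 15) (.unlessZero 1 .query)
  c.code 0 ++ [.jumpZero 20 (c.len + 2), .halt true, .halt false]

/-! ### Correctness and running time of the query program -/

namespace RomMachine

variable {m : RomMachine} {D : Layout}

theorem Tri.fetch (hF : D.Fits m) {r i j : ℕ} {ρ : ℕ → ℕ} {Q : (ℕ → ℕ) → Prop} (hj : j < 8)
    (h8 : ρ 15 = 8) (hi : ρ i < D.size)
    (h : Q (Function.update (Function.update (Function.update ρ 98 (ρ i * 8 + j)) 99 j) r
      (D.arr j (ρ i)))) : m.Tri (.fetch r i j) 4 ρ Q := by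
  refine Tri.seq (T := 1) (T' := 3) (Tri.mul (Tri.seq (T := 1) (T' := 2) (Tri.const
    (Tri.seq (T := 1) (T' := 1) (Tri.add (Tri.load ?_ ?_))))))
  · simp [h8, hF.size_eq]; omega
  · convert h using 1
    funext q
    have := hF.mem_eq (ρ i) j hj
    by_cases h98 : q = 98 <;> by_cases h99 : q = 99 <;> by_cases hr : q = r <;>
      simp_all [Function.update_apply]

theorem Tri.search (hF : D.Fits m) {j y b v B : ℕ} {ρ : ℕ → ℕ} {Q : (ℕ → ℕ) → Prop}
    (hj : j < 8) (hy : y < 80) (hb : b < 80) (hv : v < 80) (hD : D.Loaded ρ)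
    (hyw : ρ y < 2 ^ m.w) (hbB : ρ b = B) (hvB : ρ v = 2 ^ B) (hBw : B < 2 ^ m.w)
    (hsize : 2 ^ B ≤ D.size) (hlt : ∀ i, D.arr j i < 2 ^ m.w)
    (hmono : ∀ i i', i ≤ i' → i' < 2 ^ B → D.arr j i ≤ D.arr j i')
    (h : ∀ ρ', (∀ q < 80, ρ' q = ρ q) → ρ' 80 = sortedIndex (D.arr j) B (ρ y) → Q ρ') :
    m.Tri (.search j y b v) (11 * B + 4) ρ Q := by
  have hSw : 8 * D.size ≤ 2 ^ m.w := hF.size_eq ▸ m.le_pow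
  refine Tri.le (T := 1 + (1 + ((8 + 3) * B + 2))) (Tri.seq (Tri.const (Tri.seq (Tri.mov ?_))))
    (by omega)
  refine Tri.for (N := B) (by omega) (by omega) (by omega) hBw ?_
    -- After k halvings the answer lies in the interval of length 2^(B-k) that starts at register
    -- 80. Entry 0 is never tested, which agrees with 0 being the default value of `sortedIndex`.
    (fun k σ => (∀ q < 80, σ q = ρ q) ∧ σ 81 = 2 ^ (B - k) ∧ σ 80 + 2 ^ (B - k) ≤ 2 ^ B ∧
      (σ 80 ≠ 0 → D.arr j (σ 80) ≤ ρ y) ∧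
      ∀ i, σ 80 + 2 ^ (B - k) ≤ i → i < 2 ^ B → ρ y < D.arr j i) ?_ ?_ ?_
  · simp [Function.update_apply, hbB, show b ≠ 81 by omega, show b ≠ 80 by omega]
  · refine ⟨?_, ?_, ?_, ?_, ?_⟩
    · intro q hq
      simp [Function.update_apply, show q ≠ 81 by omega, show q ≠ 80 by omega,
        show q ≠ 82 by omega]
    · simp [Function.update_apply, hvB, show v ≠ 80 by omega]
    · simp [Function.update_apply]
    · simp [Function.update_apply]
    · simp [Function.update_apply]; omega
  · rintro k hk σ ⟨h1, h2, h3, h4, h5⟩ h6 h7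
    have h14 : σ 14 = 2 := by rw [h1 _ (by omega), hD 14 (by omega) (by omega)]; rfl
    have h15 : σ 15 = 8 := by rw [h1 _ (by omega), hD 15 (by omega) (by omega)]; rfl
    obtain ⟨d, hd⟩ : ∃ d, B - k = d + 1 := ⟨B - k - 1, by omega⟩
    have hd' : B - (k + 1) = d := by omega
    rw [hd] at h2 h3 h5
    rw [hd']
    have hpd : 2 ^ (d + 1) = 2 * 2 ^ d := by rw [pow_succ, mul_comm]
    have hpos : 0 < 2 ^ d := by positivity
    have hhalf : 2 ^ (d + 1) / 2 = 2 ^ d := by omega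
    refine Tri.seq (T := 1) (T' := 7) (Tri.div ?_ ?_ (Tri.seq (T := 1) (T' := 6) (Tri.add
      (Tri.seq (T := 4) (T' := 2) (Tri.fetch hF hj ?_ ?_
        (Tri.unlessLess ?_ ?_ ?_ fun hle => Tri.add ?_))))))
    · rw [h2]; omega
    · rw [h14]; omega
    · simp [Function.update_apply, h15]
    · simp only [Function.update_apply]; simp [h2, h14, hhalf]; omega
    · simp [Function.update_apply, show y ≠ 84 by omega, show y ≠ 99 by omega,
        show y ≠ 98 by omega, show y ≠ 83 by omega, show y ≠ 81 by omega, h1 y hy, hyw]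
    · simp [Function.update_apply, hlt]
    · simp only [Function.update_apply]
      simp only [h2, h14, hhalf, show y ≠ 84 by omega, show y ≠ 99 by omega,
        show y ≠ 98 by omega, show y ≠ 83 by omega, show y ≠ 81 by omega, h1 y hy]
      simp only [reduceIte, Nat.reduceEqDiff]
      intro hlt'
      refine ⟨h6, ?_, ?_, trivial, ?_, ?_, ?_⟩
      · rw [if_neg (by omega), if_neg (by omega), if_neg (by omega), if_neg (by omega),
          if_neg (by omega), h7]
      · intro q hq
        rw [if_neg (by omega), if_neg (by omega), if_neg (by omega), if_neg (by omega),
          if_neg (by omega), if_neg (by omega), if_neg (by omega), h1 q hq]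
      · omega
      · exact h4
      · intro i hi hi'
        exact hlt'.trans_le (hmono _ _ hi hi')
    · revert hle
      simp only [Function.update_apply]
      simp only [h2, h14, hhalf, show y ≠ 84 by omega, show y ≠ 99 by omega,
        show y ≠ 98 by omega, show y ≠ 83 by omega, show y ≠ 81 by omega, h1 y hy]
      simp only [reduceIte, Nat.reduceEqDiff]
      intro hle
      refine ⟨h6, ?_, ?_, trivial, ?_, ?_, ?_⟩
      · rw [if_neg (by omega), if_neg (by omega), if_neg (by omega), if_neg (by omega),
          if_neg (by omega), if_neg (by omega), h7]
      · intro q hq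
        rw [if_neg (by omega), if_neg (by omega), if_neg (by omega), if_neg (by omega),
          if_neg (by omega), if_neg (by omega), if_neg (by omega), if_neg (by omega), h1 q hq]
      · omega
      · exact fun _ => hle
      · intro i hi hi'
        exact h5 i (by omega) hi'
  · rintro σ ⟨h1, h2, h3, h4, h5⟩
    simp only [Nat.sub_self, pow_zero] at h2 h3 h5
    refine h σ h1 ?_
    rw [eq_comm, sortedIndex, Nat.findGreatest_eq_iff]
    exact ⟨by omega, h4, fun i hi hi' => not_le.2 (h5 i (by omega) (by omega))⟩

end RomMachine

namespace RomMachine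

variable {m : RomMachine} {D : Layout}

theorem _root_.Layout.Fits.one_lt (hF : D.Fits m) : 1 < 2 ^ m.w :=
  Nat.one_lt_two_pow hF.w_pos.ne'

open Classical in
theorem Tri.locate (hF : D.Fits m) (hV : D.Valid m.w) {ρ : ℕ → ℕ} {Q : (ℕ → ℕ) → Prop}
    (hD : D.Loaded ρ) (hy : ρ 61 < 2 ^ m.w)
    (h : ∀ ρ', (∀ q < 62, ρ' q = ρ q) → ρ' 62 = D.bucket (ρ 61) →
      ρ' 63 = (if D.Light (ρ 61) then 1 else 0) → Q ρ') :
    m.Tri .locate (11 * D.B + 13) ρ Q := by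
  have h1w := hF.one_lt
  refine Tri.le (T := (11 * D.B + 4) + (1 + (4 + (1 + (1 + 2))))) (Tri.seq (Tri.search hF (by omega)
    (by omega) (by omega) (by omega) hD hy (hD 3 (by omega) (by omega)) (hD 4 (by omega) (by omega))
    (hF.header_lt 3) hV.pow_le hV.pivots_lt hV.pivots_mono ?_)) (by omega)
  intro σ h1 h2
  have h2' : σ 80 = D.bucket (ρ 61) := h2
  have hb : D.bucket (ρ 61) < D.size := (sortedIndex_lt _ _ _).trans_le hV.pow_le
  have h15 : σ 15 = 8 := by rw [h1 _ (by omega), hD 15 (by omega) (by omega)]; rfl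
  have h61 : σ 61 = ρ 61 := h1 _ (by omega)
  refine Tri.seq (Tri.mov (Tri.seq (Tri.fetch hF (by omega) ?_ ?_ (Tri.seq (Tri.const
    (Tri.ifEq ?_ ?_ ?_ ?_))))))
  · simp [h15]
  · simpa [h2'] using hb
  · simpa using hV.pivots_lt _
  · simpa [h61] using hy
  · simp only [Function.update_apply, reduceIte, Nat.reduceEqDiff, h61]
    intro hne
    rw [h2'] at hne
    refine h _ ?_ ?_ ?_
    · intro q hq
      simp only [Function.update_apply, show q ≠ 63 by omega, show q ≠ 68 by omega,
        show q ≠ 99 by omega, show q ≠ 98 by omega, show q ≠ 62 by omega, if_false]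
      exact h1 q (by omega)
    · simp [h2']
    · simp [Layout.Light, hne]
  · simp only [Function.update_apply, reduceIte, Nat.reduceEqDiff, h61]
    intro heq
    rw [h2'] at heq
    refine Tri.const (h _ ?_ ?_ ?_)
    · intro q hq
      simp only [Function.update_apply, show q ≠ 63 by omega, show q ≠ 68 by omega,
        show q ≠ 99 by omega, show q ≠ 98 by omega, show q ≠ 62 by omega, if_false]
      exact h1 q (by omega)
    · simp [h2']
    · simp [Layout.Light, heq]

open Classical in
theorem Tri.evaluate (hF : D.Fits m) (hV : D.Valid m.w) {ρ : ℕ → ℕ} {Q : (ℕ → ℕ) → Prop}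
    (hD : D.Loaded ρ) (hx : ρ 60 < D.n * D.n)
    (h : ∀ ρ', (∀ q < 61, ρ' q = ρ q) → ρ' 61 = D.val m (ρ 60) →
      ρ' 62 = D.bucket (D.val m (ρ 60)) →
      ρ' 63 = (if D.Light (D.val m (ρ 60)) then 1 else 0) → Q ρ') :
    m.Tri .evaluate (11 * D.B + 24) ρ Q := by
  have hxw : ρ 60 < 2 ^ m.w := hx.trans (hF.header_lt 2)
  have hn : ρ 1 = D.n := hD 1 (by omega) (by omega)
  have h15 : ρ 15 = 8 := hD 15 (by omega) (by omega)
  have hnw : D.n < 2 ^ m.w := hF.header_lt 1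
  have hdiv : ρ 60 / D.n < D.size := (Nat.div_lt_of_lt_mul hx).trans_le hV.n_le
  have hmod : ρ 60 % D.n < D.size := (Nat.mod_lt _ hV.n_pos).trans_le hV.n_le
  refine Tri.le (T := 1 + (1 + (4 + (4 + (1 + (11 * D.B + 13)))))) (Tri.seq (Tri.div hxw
    (by rwa [hn]) (Tri.seq (Tri.mod ?_ ?_ (Tri.seq (Tri.fetch hF (by omega) ?_ ?_
    (Tri.seq (Tri.fetch hF (by omega) ?_ ?_ (Tri.seq (Tri.plus
      (Tri.locate hF hV ?_ ?_ ?_))))))))))) (by omega)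
  · simpa using hxw
  · simpa [hn] using hnw
  · simpa using h15
  · simpa [hn] using hdiv
  · simpa using h15
  · simpa [hn] using hmod
  · refine hD.congr fun q hq => ?_
    simp only [Function.update_apply]
    simp only [show q ≠ 61 by omega, show q ≠ 64 by omega, show q ≠ 65 by omega,
      show q ≠ 66 by omega, show q ≠ 67 by omega, show q ≠ 98 by omega, show q ≠ 99 by omega,
      if_false]
  · rw [Function.update_self]
    exact m.plusNat_lt _ _
  · intro σ h1 h2 h3
    have h61 := h1 61 (by omega)
    simp only [Function.update_apply, reduceIte, Nat.reduceEqDiff, hn] at h2 h3 h61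
    refine h σ ?_ h61 h2 h3
    intro q hq
    rw [h1 q (by omega)]
    simp only [Function.update_apply]
    simp only [show q ≠ 61 by omega, show q ≠ 64 by omega, show q ≠ 65 by omega,
      show q ≠ 66 by omega, show q ≠ 67 by omega, show q ≠ 98 by omega, show q ≠ 99 by omega,
      if_false]

theorem _root_.Layout.Valid.div_lt (hV : D.Valid m.w) {v : ℕ} (hv : v < 2 ^ D.B) : v / D.k < D.r :=
  Nat.div_lt_of_lt_mul (hv.trans_le hV.buckets_le)

theorem _root_.Layout.Valid.shift_lt (hV : D.Valid m.w) {i h u : ℕ} (hi : i < D.tables)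
    (hh : h < D.r) (hu : u < D.tries) : (i * D.r + h) * D.tries + u < D.size := by
  refine lt_of_lt_of_le ?_ hV.shifts_le
  have h1 : i * D.r + h + 1 ≤ D.tables * D.r := by nlinarith
  have h2 := Nat.mul_le_mul_right D.tries h1
  nlinarith

theorem _root_.Layout.Valid.scan_lt (hV : D.Valid m.w) (i v u : ℕ) :
    D.scan m i v u < D.n * D.n := by
  induction u with
  | zero => exact hV.dflt_lt
  | succ u ih =>
    rw [Layout.scan]
    split
    · exact Nat.mod_lt _ (Nat.mul_pos hV.n_pos hV.n_pos)
    · exact ih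

theorem _root_.Layout.Valid.next_lt (hV : D.Valid m.w) (i v : ℕ) : D.next m i v < D.n * D.n := by
  rw [Layout.next]
  split
  · exact hV.values_lt _
  · exact hV.scan_lt _ _ _

/-- There is no early exit: each light candidate overwrites register 32, so the last one survives,
as in the recursion of `Layout.scan`. -/
theorem Tri.scan (hF : D.Fits m) (hV : D.Valid m.w) {ρ : ℕ → ℕ} {Q : (ℕ → ℕ) → Prop}
    {i v : ℕ} (hD : D.Loaded ρ) (hi : ρ 30 = i) (hv : ρ 31 = v) (hi' : i < D.tables)
    (hv' : v < 2 ^ D.B) (h32 : ρ 32 = D.dflt)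
    (h : ∀ ρ', (∀ q < 32, ρ' q = ρ q) → ρ' 32 = D.scan m i v D.tries → Q ρ') :
    m.Tri .scan ((11 * D.B + 41) * D.tries + 9) ρ Q := by
  have h2 : ρ 2 = D.n * D.n := hD 2 (by omega) (by omega)
  have h9 : ρ 9 = D.tries := hD 9 (by omega) (by omega)
  have h10 : ρ 10 = D.k := hD 10 (by omega) (by omega)
  have h11 : ρ 11 = D.r := hD 11 (by omega) (by omega)
  have hkw : D.k < 2 ^ m.w := hF.header_lt 10
  have hrw : D.r < 2 ^ m.w := hF.header_lt 11
  have hvw : v < 2 ^ m.w := hv'.trans (hF.header_lt 4)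
  have hNw : D.n * D.n < 2 ^ m.w := hF.header_lt 2
  refine Tri.le (T := 1 + (1 + (1 + (1 + (1 + (1 + (1 + ((11 * D.B + 38 + 3) * D.tries + 2))))))))
    (Tri.seq (Tri.div (by rwa [hv]) (by rwa [h10]) (Tri.seq (Tri.mod (by simpa [hv]) (by simpa [h11])
    (Tri.seq (Tri.mul (Tri.seq (Tri.add (Tri.seq (Tri.mul (Tri.seq (Tri.add
      (Tri.seq (Tri.mul ?_)))))))))))))) (by ring_nf; omega)
  refine Tri.for (N := D.tries) (by omega) (by omega) (by omega) (hF.header_lt 9)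
    -- Registers 44 and 45 hold the start of the candidate lists of the row and of the column.
    ?_ (fun k σ => (∀ q < 32, σ q = ρ q) ∧ σ 32 = D.scan m i v k ∧
      σ 44 = (i * D.r + v / D.k) * D.tries ∧ σ 45 = (i * D.r + v % D.r) * D.tries) ?_ ?_ ?_
  · simpa using h9
  · simp only [Function.update_apply, reduceIte, Nat.reduceEqDiff, hi, hv, h9, h10, h11, h32]
    refine ⟨fun q hq => ?_, rfl, trivial, trivial⟩
    simp only [show q ≠ 44 by omega, show q ≠ 45 by omega, show q ≠ 46 by omega,
      show q ≠ 47 by omega, if_false]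
  · rintro k hk σ ⟨a1, a2, a3, a4⟩ a5 a6
    have h15 : σ 15 = 8 := by rw [a1 _ (by omega), hD 15 (by omega) (by omega)]; rfl
    have hs2 : σ 2 = D.n * D.n := by rw [a1 _ (by omega), h2]
    have hc : (D.arr 6 ((i * D.r + v / D.k) * D.tries + k) +
        D.arr 7 ((i * D.r + v % D.r) * D.tries + k)) < 2 ^ m.w := by
      have := hV.rows_lt ((i * D.r + v / D.k) * D.tries + k)
      have := hV.cols_lt ((i * D.r + v % D.r) * D.tries + k)
      have := hV.sum_lt
      omega
    refine Tri.le (T := 1 + (4 + (1 + (4 + (1 + (1 + ((11 * D.B + 24) + (1 + 1))))))))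
      (Tri.seq (Tri.add (Tri.seq (Tri.fetch hF (by omega) ?_ ?_ (Tri.seq (Tri.add (Tri.seq
      (Tri.fetch hF (by omega) ?_ ?_ (Tri.seq (Tri.add (Tri.seq (Tri.mod ?_ ?_ (Tri.seq
      (Tri.evaluate hF hV ?_ ?_ ?_))))))))))))))
      (by omega)
    · simpa using h15
    · simpa [a3, a5] using hV.shift_lt hi' (hV.div_lt hv') hk
    · simpa using h15
    · simpa [a4, a5] using hV.shift_lt hi' (Nat.mod_lt _ hV.r_pos) hk
    · simpa [a3, a4, a5] using hc
    · simpa [hs2] using hNw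
    · refine hD.congr fun q hq => ?_
      rw [← a1 q (by omega)]
      simp only [Function.update_apply]
      simp only [show q ≠ 50 by omega, show q ≠ 48 by omega, show q ≠ 51 by omega,
        show q ≠ 49 by omega, show q ≠ 60 by omega, show q ≠ 98 by omega, show q ≠ 99 by omega,
        if_false]
    · simpa [hs2] using Nat.mod_lt _ (Nat.mul_pos hV.n_pos hV.n_pos)
    · intro τ b1 b2 b3 b4
      have e60 : τ 60 = D.cand i v k := by
        rw [b1 60 (by omega)]
        simp [a3, a4, a5, hs2, Layout.cand]
      have e60' := e60
      rw [b1 60 (by omega)] at e60'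
      rw [e60'] at b4
      have hfr : ∀ q < 48, τ q = σ q := by
        intro q hq
        rw [b1 q (by omega)]
        simp only [Function.update_apply]
        simp only [show q ≠ 50 by omega, show q ≠ 48 by omega, show q ≠ 51 by omega,
          show q ≠ 49 by omega, show q ≠ 60 by omega, show q ≠ 98 by omega, show q ≠ 99 by omega,
          if_false]
      have h63 : τ 63 < 2 ^ m.w := by
        rw [b4]; have := hF.one_lt; split <;> omega
      refine Tri.unlessZero h63 (fun h0 => ?_) (fun h0 => Tri.mov ?_)
      · have hl : ¬ D.Light (D.val m (D.cand i v k)) := by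
          intro hl; rw [b4, if_pos hl] at h0; omega
        refine ⟨by rw [hfr _ (by omega), a5], by rw [hfr _ (by omega), a6], ?_, ?_, ?_, ?_⟩
        · intro q hq
          simp only [Function.update_apply, show q ≠ 47 by omega, show q ≠ 99 by omega, if_false]
          rw [hfr _ (by omega), a1 q hq]
        · simp [hfr 32 (by omega), a2, Layout.scan, hl]
        · simp [hfr 44 (by omega), a3]
        · simp [hfr 45 (by omega), a4]
      · have hl : D.Light (D.val m (D.cand i v k)) := by
          by_contra hl; rw [b4, if_neg hl] at h0; omega
        refine ⟨by simp [hfr 47 (by omega), a5], by simp [hfr 9 (by omega), a6], ?_, ?_, ?_, ?_⟩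
        · intro q hq
          simp only [Function.update_apply, show q ≠ 47 by omega, show q ≠ 99 by omega,
            show q ≠ 32 by omega, if_false]
          rw [hfr _ (by omega), a1 q hq]
        · simp [e60, Layout.scan, hl]
        · simp [hfr 44 (by omega), a3]
        · simp [hfr 45 (by omega), a4]
  · rintro σ ⟨a1, a2, -, -⟩
    exact h σ a1 a2

end RomMachine

namespace RomMachine

variable {m : RomMachine} {D : Layout}

theorem Tri.next (hF : D.Fits m) (hV : D.Valid m.w) {ρ : ℕ → ℕ} {Q : (ℕ → ℕ) → Prop}
    {i v : ℕ} (hD : D.Loaded ρ) (hi : ρ 30 = i) (hv : ρ 31 = v) (hi' : i < D.tables)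
    (hv' : v < 2 ^ D.B)
    (h : ∀ ρ', (∀ q < 32, ρ' q = ρ q) → ρ' 32 = D.next m i v → Q ρ') :
    m.Tri .next (11 * D.B' + (11 * D.B + 41) * D.tries + 30) ρ Q := by
  have h4 : ρ 4 = 2 ^ D.B := hD 4 (by omega) (by omega)
  have h5 : ρ 5 = D.B' := hD 5 (by omega) (by omega)
  have h6 : ρ 6 = 2 ^ D.B' := hD 6 (by omega) (by omega)
  have hkey : D.key i v < 2 ^ m.w := by
    refine lt_of_lt_of_le ?_ hV.key_lt.le
    unfold Layout.key
    nlinarith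
  have h1w := hF.one_lt
  refine Tri.le (T := 1 + (1 + ((11 * D.B' + 4) + (1 + (4 + (1 + (1 + ((1 + 4 + 2) +
    ((11 * D.B + 41) * D.tries + 9 + 1)))))))))
    (Tri.seq (Tri.mul (Tri.seq (Tri.add (Tri.seq (Tri.search (B := D.B') hF (by omega) (by omega)
      (by omega) (by omega) ?_ ?_ ?_ ?_ (hF.header_lt 5) hV.pow_le' hV.keys_lt hV.keys_mono
      ?_)))))) (by omega)
  · refine hD.congr fun q hq => ?_
    simp only [Function.update_apply, show q ≠ 40 by omega, if_false]
  · simpa [hi, hv, h4, Layout.key] using hkey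
  · simpa using h5
  · simpa using h6
  simp only [Function.update_apply, reduceIte, Nat.reduceEqDiff, hi, hv, h4]
  intro σ a1 a2
  replace a2 : σ 80 = D.slot i v := a2
  have hsl : D.slot i v < D.size := (sortedIndex_lt _ _ _).trans_le hV.pow_le'
  have hfr : ∀ q < 40, σ q = ρ q := fun q hq => by
    rw [a1 q (by omega), if_neg (by omega), if_neg (by omega)]
  have s40 : σ 40 = D.key i v := by rw [a1 40 (by omega)]; simp [Layout.key]
  have s15 : σ 15 = 8 := by rw [hfr 15 (by omega)]; exact hD 15 (by omega) (by omega)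
  have s12 : σ 12 = D.dflt := by rw [hfr 12 (by omega)]; exact hD 12 (by omega) (by omega)
  refine Tri.seq (Tri.mov (Tri.seq (Tri.fetch hF (by omega) ?_ ?_ (Tri.seq (Tri.mov (Tri.seq
    (Tri.const (Tri.seq (Tri.ifEq ?_ ?_ ?_ ?_)))))))))
  · simpa using s15
  · simpa [a2] using hsl
  · simpa using hV.keys_lt _
  · simpa [s40] using hkey
  · simp only [Function.update_apply, reduceIte, Nat.reduceEqDiff, a2, s40]
    intro hne
    refine Tri.unlessZero ?_ ?_ fun _ => Tri.scan (i := i) (v := v) hF hV ?_ ?_ ?_ hi' hv' ?_ ?_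
    · simpa using h1w
    · simp
    · refine hD.congr fun q hq => ?_
      rw [← hfr q (by omega)]
      simp only [Function.update_apply, show q ≠ 43 by omega, show q ≠ 32 by omega,
        show q ≠ 42 by omega, show q ≠ 99 by omega, show q ≠ 98 by omega, show q ≠ 41 by omega,
        if_false]
    · simp [hfr 30 (by omega), hi]
    · simp [hfr 31 (by omega), hv]
    · simp [s12]
    · intro τ b1 b2
      refine h τ ?_ (by rw [b2, Layout.next, if_neg hne])
      intro q hq
      rw [b1 q hq, ← hfr q (by omega)]
      simp only [Function.update_apply, show q ≠ 43 by omega, show q ≠ 32 by omega,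
        show q ≠ 42 by omega, show q ≠ 99 by omega, show q ≠ 98 by omega, show q ≠ 41 by omega,
        if_false]
  · simp only [Function.update_apply, reduceIte, Nat.reduceEqDiff, s40]
    intro heq
    rw [a2] at heq
    refine Tri.seq (Tri.const (Tri.fetch hF (by omega) ?_ ?_ (Tri.unlessZero ?_ (fun _ => ?_) ?_)))
    · simpa using s15
    · simpa [a2] using hsl
    · simp
    · refine h _ ?_ ?_
      · intro q hq
        rw [← hfr q (by omega)]
        simp only [Function.update_apply, show q ≠ 43 by omega, show q ≠ 32 by omega,
          show q ≠ 42 by omega, show q ≠ 99 by omega, show q ≠ 98 by omega, show q ≠ 41 by omega,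
          if_false]
      · simp [a2, Layout.next, heq]
    · simp

-- The proposition `p` stands for a success before the walks, namely that the query is a pivot.
-- Register 20 accumulates successes, over tables in the outer loop and over steps in the inner one.
open Classical in
theorem Tri.walks (hF : D.Fits m) (hV : D.Valid m.w) {ρ : ℕ → ℕ} {Q : (ℕ → ℕ) → Prop}
    {c : ℕ} {p : Prop} (hD : D.Loaded ρ) (h0 : ρ 0 = c) (hc : c < 2 ^ m.w)
    (h21 : ρ 21 = D.bucket c) (h20 : ρ 20 = if p then 1 else 0)
    (h : ∀ ρ', ρ' 20 = (if p ∨ ∃ i < D.tables, ∃ j < D.walk,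
      D.val m (D.next m i (D.walkFrom m i (D.bucket c) j)) = c then 1 else 0) → Q ρ') :
    m.Tri .walks (((11 * D.B' + (11 * D.B + 41) * D.tries + 11 * D.B + 62) * D.walk + 7) * D.tables
      + 2) ρ Q := by
  refine Tri.le (T := ((1 + (1 + ((((11 * D.B' + (11 * D.B + 41) * D.tries + 30) +
    (1 + ((11 * D.B + 24) + (1 + 2 + 1)))) + 3) * D.walk + 2))) + 3) * D.tables + 2) ?_ ?_
  swap
  · gcongr ?_ * _ + 2
    have : (11 * D.B' + (11 * D.B + 41) * D.tries + 30) +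
      (1 + ((11 * D.B + 24) + (1 + 2 + 1))) + 3 =
      11 * D.B' + (11 * D.B + 41) * D.tries + 11 * D.B + 62 := by omega
    rw [this]; omega
  refine Tri.for (N := D.tables) (by omega) (by omega) (by omega) (hF.header_lt 7)
    (hD 7 (by omega) (by omega)) (fun a σ => (∀ q < 20, σ q = ρ q) ∧ σ 21 = D.bucket c ∧
      σ 20 = if p ∨ ∃ i < a, ∃ j < D.walk,
        D.val m (D.next m i (D.walkFrom m i (D.bucket c) j)) = c then 1 else 0) ?_ ?_ ?_
  · refine ⟨fun q hq => ?_, by simp [h21], by simp [h20]⟩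
    simp only [Function.update_apply, show q ≠ 22 by omega, if_false]
  · rintro i hi σ ⟨a1, a2, a3⟩ a4 a5
    refine Tri.seq (Tri.mov (Tri.seq (Tri.mov (Tri.for (N := D.walk) (by omega) (by omega)
      (by omega) (hF.header_lt 8) ?_ (fun b τ => (∀ q < 20, τ q = ρ q) ∧ τ 21 = D.bucket c ∧
        τ 22 = i ∧ τ 30 = i ∧ τ 31 = D.walkFrom m i (D.bucket c) b ∧
        τ 20 = if (p ∨ ∃ i' < i, ∃ j < D.walk,
            D.val m (D.next m i' (D.walkFrom m i' (D.bucket c) j)) = c) ∨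
          ∃ j < b, D.val m (D.next m i (D.walkFrom m i (D.bucket c) j)) = c then 1 else 0)
      ?_ ?_ ?_))))
    · simp only [Function.update_apply, reduceIte, Nat.reduceEqDiff]
      rw [a1 8 (by omega)]
      exact hD 8 (by omega) (by omega)
    · refine ⟨fun q hq => ?_, by simp [a2], by simp [a4], by simp [a4],
        by simp [a2, Layout.walkFrom], by simp [a3]⟩
      simp only [Function.update_apply, show q ≠ 23 by omega, show q ≠ 31 by omega,
        show q ≠ 30 by omega, if_false]
      exact a1 q hq
    · rintro j hj τ ⟨b1, b2, b3, b4, b5, b6⟩ b7 b8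
      have hv' : D.walkFrom m i (D.bucket c) j < 2 ^ D.B := by
        cases j with
        | zero => exact sortedIndex_lt _ _ _
        | succ j =>
          rw [Layout.walkFrom, Function.iterate_succ_apply']
          exact sortedIndex_lt _ _ _
      set v := D.walkFrom m i (D.bucket c) j with hv
      have hv1 : D.walkFrom m i (D.bucket c) (j + 1) = D.bucket (D.val m (D.next m i v)) := by
        rw [Layout.walkFrom, Function.iterate_succ_apply', hv, Layout.walkFrom]
      have hτ : D.Loaded τ := hD.congr b1
      refine Tri.seq (Tri.next hF hV hτ b4 b5 hi hv' fun υ c1 c2 => Tri.seq (Tri.mov (Tri.seq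
        (Tri.evaluate hF hV ?_ ?_ ?_))))
      · refine hτ.congr fun q hq => ?_
        simp only [Function.update_apply, show q ≠ 60 by omega, if_false]
        exact c1 q (by omega)
      · simpa [c2] using hV.next_lt i v
      · intro φ d1 d2 d3 d4
        have hfr : ∀ q < 32, φ q = τ q := by
          intro q hq
          rw [d1 q (by omega), ← c1 q hq]
          simp only [Function.update_apply, show q ≠ 60 by omega, if_false]
        have e61 : φ 61 = D.val m (D.next m i v) := by rw [d2]; simp [c2]
        have e62 : φ 62 = D.walkFrom m i (D.bucket c) (j + 1) := by rw [d3, hv1]; simp [c2]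
        have e0 : φ 0 = c := by rw [hfr 0 (by omega), b1 0 (by omega), h0]
        refine Tri.seq (Tri.ifEq ?_ ?_ ?_ ?_)
        · rw [e61]; exact m.plusNat_lt _ _
        · rw [e0]; exact hc
        · rw [e61, e0]
          intro hne
          refine Tri.mov ⟨by simp [hfr 23 (by omega), b7], by simp [hfr 8 (by omega), b8],
            ?_, by simp [hfr 21 (by omega), b2], by simp [hfr 22 (by omega), b3],
            by simp [hfr 30 (by omega), b4], by simp [e62], ?_⟩
          · intro q hq
            simp only [Function.update_apply, show q ≠ 23 by omega, show q ≠ 31 by omega,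
              show q ≠ 99 by omega, if_false]
            rw [hfr q (by omega), b1 q hq]
          · simp only [Function.update_apply, reduceIte, Nat.reduceEqDiff, hfr 20 (by omega), b6]
            congr 1
            simp only [Nat.lt_succ_iff_lt_or_eq, or_and_right, exists_or, exists_eq_left,
              ← hv, hne, or_false]
        · rw [e61, e0]
          intro heq
          refine Tri.const (Tri.mov ⟨by simp [hfr 23 (by omega), b7], by simp [hfr 8 (by omega), b8],
            ?_, by simp [hfr 21 (by omega), b2], by simp [hfr 22 (by omega), b3],
            by simp [hfr 30 (by omega), b4], by simp [e62], ?_⟩)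
          · intro q hq
            simp only [Function.update_apply, show q ≠ 23 by omega, show q ≠ 31 by omega,
              show q ≠ 99 by omega, show q ≠ 20 by omega, if_false]
            rw [hfr q (by omega), b1 q hq]
          · simp only [Function.update_apply, reduceIte, Nat.reduceEqDiff]
            rw [if_pos]
            exact Or.inr ⟨j, by omega, by rw [← hv]; exact heq⟩
    · rintro τ ⟨b1, b2, b3, b4, b5, b6⟩
      refine ⟨b3, ?_, ?_, by simp [b2], ?_⟩
      · rw [b1 7 (by omega)]; exact hD 7 (by omega) (by omega)
      · intro q hq
        simp only [Function.update_apply, show q ≠ 22 by omega, show q ≠ 99 by omega, if_false]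
        exact b1 q hq
      · simp only [Function.update_apply, reduceIte, Nat.reduceEqDiff, b6]
        congr 1
        simp only [Nat.lt_succ_iff_lt_or_eq, or_and_right, exists_or, exists_eq_left, or_assoc]
  · rintro σ ⟨a1, a2, a3⟩
    exact h σ a3

open Classical in
theorem Tri.query (hF : D.Fits m) (hV : D.Valid m.w) {ρ : ℕ → ℕ} {Q : (ℕ → ℕ) → Prop}
    {c : ℕ} (hD : D.Loaded ρ) (h0 : ρ 0 = c) (hc : c < 2 ^ m.w)
    (h : ∀ ρ', ρ' 20 = (if D.Finds m c then 1 else 0) → Q ρ') :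
    m.Tri .query (((11 * D.B' + (11 * D.B + 41) * D.tries + 11 * D.B + 62) * D.walk + 7) * D.tables
      + 11 * D.B + 20) ρ Q := by
  refine Tri.le (T := 1 + ((11 * D.B + 13) + (1 + ((1 + 1) + (1 +
    (((11 * D.B' + (11 * D.B + 41) * D.tries + 11 * D.B + 62) * D.walk + 7) * D.tables + 2))))))
    (Tri.seq (Tri.mov (Tri.seq (Tri.locate hF hV ?_ ?_ ?_)))) (by omega)
  · refine hD.congr fun q hq => ?_
    simp only [Function.update_apply, show q ≠ 61 by omega, if_false]
  · simpa [h0] using hc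
  · simp only [Function.update_apply, reduceIte, Nat.reduceEqDiff, h0]
    intro σ a1 a2 a3
    have hfr : ∀ q < 60, σ q = ρ q := fun q hq => by rw [a1 q (by omega), if_neg (by omega)]
    have h63 : σ 63 < 2 ^ m.w := by rw [a3]; have := hF.one_lt; split <;> omega
    have key : ∀ τ, (∀ q < 20, τ q = ρ q) → τ 62 = D.bucket c →
        τ 20 = (if ¬ D.Light c then 1 else 0) → m.Tri (.seq (.mov 21 62) .walks) (1 +
          (((11 * D.B' + (11 * D.B + 41) * D.tries + 11 * D.B + 62) * D.walk + 7) * D.tables + 2))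
          τ Q := by
      intro τ b1 b2 b3
      refine Tri.seq (Tri.mov (Tri.walks (c := c) (p := ¬ D.Light c) hF hV ?_ ?_ hc ?_ ?_ ?_))
      · refine hD.congr fun q hq => ?_
        simp only [Function.update_apply, show q ≠ 21 by omega, if_false]
        exact b1 q hq
      · simp [b1 0 (by omega), h0]
      · simp [b2]
      · have : Function.update τ 21 (τ 62) 20 = τ 20 := by simp
        rw [this]
        convert b3
      · exact fun ρ' h' => h ρ' (by convert h'; exact Iff.rfl)
    refine Tri.seq (Tri.const (Tri.seq (Tri.unlessZero ?_ (fun h' => ?_) (fun h' => Tri.const ?_))))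
    · simpa using h63
    · refine key _ ?_ (by simp [a2]) ?_
      · intro q hq
        simp only [Function.update_apply, show q ≠ 20 by omega, if_false]
        exact hfr q (by omega)
      · have : ¬ D.Light c := by
          intro hl
          simp [a3, hl] at h'
        simp [this]
    · refine key _ ?_ (by simp [a2]) ?_
      · intro q hq
        simp only [Function.update_apply, show q ≠ 20 by omega, if_false]
        exact hfr q (by omega)
      · have : D.Light c := by
          by_contra hl
          simp [a3, hl] at h'
        simp [this]

theorem Tri.init (hF : D.Fits m) {ρ : ℕ → ℕ} (a : ℕ) (ha : a ≤ 15) :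
    m.Tri (.init a) (2 * a + 1) ρ fun ρ' => ρ' 0 = ρ 0 ∧ ρ' 20 = 0 ∧
      ∀ q, 1 ≤ q → q ≤ a → ρ' q = D.header q := by
  induction a with
  | zero => exact Tri.const ⟨by simp, by simp, by intros; omega⟩
  | succ a ih =>
    refine Tri.seq (T := 2 * a + 1) (T' := 2) ((ih (by omega)).imp le_rfl ?_)
    rintro σ ⟨h1, h2, h3⟩
    have hs := hF.le_size
    refine Tri.seq (T := 1) (T' := 1) (Tri.const (Tri.load ?_ ⟨?_, ?_, ?_⟩))
    · simp [hF.size_eq]; omega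
    · simp [h1]
    · simp [h2, Function.update_apply, show 20 ≠ a + 1 by omega]
    · intro q hq hq'
      by_cases hqa : q = a + 1
      · subst hqa
        have := hF.mem_eq (a + 1) 0 (by omega)
        simp only [Nat.add_zero] at this
        simp [this, hF.header_eq (a + 1) (by omega)]
      · simp [Function.update_apply, hqa, show q ≠ 98 by omega, h3 q hq (by omega)]

open Classical in
/-- Correctness and running time of the query program. -/
theorem run_queryProgram (hF : D.Fits m) (hV : 0 < D.n → D.Valid m.w) {σ : Fin m.M → BitVec m.w}
    (hσ : σ = m.words) (c : BitVec m.w) :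
    ramRun m.plus queryProgram
      (((11 * D.B' + (11 * D.B + 41) * D.tries + 11 * D.B + 62) * D.walk + 7) * D.tables
        + 11 * D.B + 54) (ramQuery σ c) =
      some (decide (0 < D.n ∧ D.Finds m c.toNat), σ) := by
  subst hσ
  have e : ramQuery m.words c = m.conf 0 (Function.update (fun _ => 0) 0 c.toNat) := by
    simp only [ramQuery, conf, RamConfig.mk.injEq, true_and, and_true]
    funext q
    by_cases hq : q = 0 <;> simp [hq]
  rw [e]
  refine ramRun_mono (t := (31 + (((11 * D.B' + (11 * D.B + 41) * D.tries + 11 * D.B + 62)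
    * D.walk + 7) * D.tables + 11 * D.B + 20 + 1)) + 2) (by omega)
    (ramRun_of_tri (c := .seq (.init 15) (.unlessZero 1 .query))
      (Q := fun ρ' => ρ' 20 = if decide (0 < D.n ∧ D.Finds m c.toNat) then 1 else 0)
      (Tri.seq ((Tri.init hF 15 le_rfl).imp (by omega) ?_)) (fun _ h => h) hF.w_pos)
  · rintro ρ ⟨h0, h20, hL⟩
    have h1 : ρ 1 = D.n := hL 1 (by omega) (by omega)
    refine Tri.unlessZero ?_ ?_ fun hn => Tri.query (c := c.toNat) hF (hV ?_) hL ?_ c.isLt ?_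
    · rw [h1]; exact hF.header_lt 1
    · rw [h1]; intro hn; simp [hn, h20]
    · omega
    · simpa using h0
    · intro ρ' h'
      have hn' : 0 < D.n := by omega
      rw [h']
      simp [hn']

end RomMachine

/-! ### Counting by resampling a coordinate -/

section Resampling

variable {I X : Type*} [Fintype I] [DecidableEq I] [Fintype X]

/-- Exchanging the new value with the coordinate that it replaces is an involution on pairs of a
tuple and a value. -/
theorem sum_update {M : Type*} [AddCommMonoid M] (i : I) (G : (I → X) → M) :
    Fintype.card X • ∑ s, G s = ∑ s, ∑ x, G (Function.update s i x) := by
  have h : Fintype.card X • ∑ s, G s = ∑ s, ∑ _x : X, G s := by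
    simp [Finset.smul_sum]
  rw [h, ← Fintype.sum_prod_type', ← Fintype.sum_prod_type']
  refine Fintype.sum_bijective (fun p : (I → X) × X => (Function.update p.1 i p.2, p.1 i)) ?_ _ _ ?_
  · refine Function.Involutive.bijective ?_
    rintro ⟨s, x⟩
    simp
  · rintro ⟨s, x⟩
    simp

theorem card_filter_update (i : I) (P : (I → X) → Prop) [DecidablePred P] :
    Fintype.card X * (Finset.univ.filter P).card =
      ∑ s : I → X, (Finset.univ.filter fun x => P (Function.update s i x)).card := by
  simp only [Finset.card_filter]
  exact sum_update i fun s => if P s then 1 else 0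

/-- A conditional probability bound: `C` does not see coordinate `i`, so given `C` that coordinate
is still uniform and `P` has probability at most M/|X|. -/
theorem card_filter_update_le (i : I) (C P : (I → X) → Prop) [DecidablePred C] [DecidablePred P]
    {M : ℕ}
    (hC : ∀ s x, C (Function.update s i x) ↔ C s)
    (hP : ∀ s, (Finset.univ.filter fun x => P (Function.update s i x)).card ≤ M) :
    Fintype.card X * (Finset.univ.filter fun s => C s ∧ P s).card ≤
      M * (Finset.univ.filter C).card := by
  rw [card_filter_update i (fun s => C s ∧ P s), Finset.card_filter C, Finset.mul_sum]
  refine Finset.sum_le_sum fun s _ => ?_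
  simp only [hC]
  by_cases h : C s
  · simpa [h] using hP s
  · simp [h]

theorem sum_apply_one {M : Type*} [AddCommMonoid M] (i : I) (f : X → M) :
    Fintype.card X • ∑ s : I → X, f (s i) = Fintype.card X ^ Fintype.card I • ∑ x, f x := by
  rw [sum_update i]
  simp

theorem sum_apply_two {M : Type*} [AddCommMonoid M] {i j : I} (hij : i ≠ j) (f : X → X → M) :
    Fintype.card X ^ 2 • ∑ s : I → X, f (s i) (s j) =
      Fintype.card X ^ Fintype.card I • ∑ x, ∑ y, f x y := by
  rw [pow_two, mul_smul, sum_update i]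
  simp only [Function.update_self, Function.update_of_ne hij.symm]
  rw [Finset.sum_comm, Finset.smul_sum, Finset.smul_sum]
  exact Finset.sum_congr rfl fun x _ => sum_apply_one j (f x)

end Resampling

/-! ### Families of points with private rows or columns -/

section Fresh

variable {I X ι : Type*}

/-- Every member of a family of points has a private row or a private column. -/
def Fresh (p q : X → ι) (z : I → X) : Prop :=
  ∀ a, (∀ i, i ≠ a → p (z i) ≠ p (z a)) ∨ ∀ i, i ≠ a → q (z i) ≠ q (z a)

theorem Fresh.comp {J : Type*} {p q : X → ι} {z : I → X} (h : Fresh p q z) {e : J → I}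
    (he : Function.Injective e) : Fresh p q (fun j => z (e j)) := fun a =>
  (h (e a)).imp (fun h _ hi => h _ fun h' => hi (he h')) fun h _ hi => h _ fun h' => hi (he h')

theorem Fresh.ne {p q : X → ι} {z : I → X} (h : Fresh p q z) {i a : I} (hia : i ≠ a) :
    ¬ (p (z i) = p (z a) ∧ q (z i) = q (z a)) := fun h' =>
  (h a).elim (fun h => h i hia h'.1) fun h => h i hia h'.2

variable [Fintype I] [DecidableEq I] [Fintype X]

-- The two collisions are charged to two different resampled coordinates. Coordinate κ must be kept
-- because of the condition on `W`; if it is i or k, then a is resampled in its place.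
open Classical in
theorem card_row_col_le {p q : X → ι} {ρ : ℕ}
    (hp : ∀ c, (Finset.univ.filter fun x => p x = c).card ≤ ρ)
    (hq : ∀ c, (Finset.univ.filter fun x => q x = c).card ≤ ρ)
    (W : Finset X) (κ : I) {a i k : I} (hi : i ≠ a) (hk : k ≠ a)
    (hik : i ≠ k) :
    Fintype.card X ^ 2 *
      (Finset.univ.filter fun z : I → X => z κ ∈ W ∧ p (z i) = p (z a) ∧ q (z k) = q (z a)).card ≤
      ρ ^ 2 * (Finset.univ.filter fun z : I → X => z κ ∈ W).card := by
  have hp' : ∀ c, (Finset.univ.filter fun x => c = p x).card ≤ ρ := fun c => by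
    simpa only [eq_comm] using hp c
  have hq' : ∀ c, (Finset.univ.filter fun x => c = q x).card ≤ ρ := fun c => by
    simpa only [eq_comm] using hq c
  have two : ∀ {A B C : ℕ}, Fintype.card X * A ≤ ρ * B → Fintype.card X * B ≤ ρ * C →
      Fintype.card X ^ 2 * A ≤ ρ ^ 2 * C := by
    intro A B C h1 h2
    calc Fintype.card X ^ 2 * A = Fintype.card X * (Fintype.card X * A) := by ring
      _ ≤ Fintype.card X * (ρ * B) := by gcongr
      _ = ρ * (Fintype.card X * B) := by ring
      _ ≤ ρ * (ρ * C) := by gcongr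
      _ = ρ ^ 2 * C := by ring
  by_cases hκi : κ = i
  · subst hκi
    refine two (B := (Finset.univ.filter fun z : I → X => z κ ∈ W ∧ p (z κ) = p (z a)).card) ?_ ?_
    · simp only [← and_assoc]
      refine card_filter_update_le k (fun z => z κ ∈ W ∧ p (z κ) = p (z a))
        (fun z => q (z k) = q (z a)) (fun s x => ?_) (fun s => ?_)
      · simp [hik, hk.symm]
      · simpa [hk.symm] using hq _
    · refine card_filter_update_le a (fun z => z κ ∈ W) (fun z => p (z κ) = p (z a)) (fun s x => ?_) (fun s => ?_)
      · simp [hi]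
      · simpa [hi] using hp' _
  by_cases hκk : κ = k
  · subst hκk
    refine two (B := (Finset.univ.filter fun z : I → X => z κ ∈ W ∧ q (z κ) = q (z a)).card) ?_ ?_
    · simp only [and_comm (a := p _ = p _), ← and_assoc]
      refine card_filter_update_le i (fun z => z κ ∈ W ∧ q (z κ) = q (z a))
        (fun z => p (z i) = p (z a)) (fun s x => ?_) (fun s => ?_)
      · simp [hκi, hi.symm]
      · simpa [hi.symm] using hp _
    · refine card_filter_update_le a (fun z => z κ ∈ W) (fun z => q (z κ) = q (z a)) (fun s x => ?_) (fun s => ?_)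
      · simp [hk]
      · simpa [hk] using hq' _
  · refine two (B := (Finset.univ.filter fun z : I → X => z κ ∈ W ∧ p (z i) = p (z a)).card) ?_ ?_
    · simp only [← and_assoc]
      refine card_filter_update_le k (fun z => z κ ∈ W ∧ p (z i) = p (z a))
        (fun z => q (z k) = q (z a)) (fun s x => ?_) (fun s => ?_)
      · simp [hκk, hik, hk.symm]
      · simpa [hk.symm] using hq _
    · refine card_filter_update_le i (fun z => z κ ∈ W) (fun z => p (z i) = p (z a)) (fun s x => ?_) (fun s => ?_)
      · simp [hκi]
      · simpa [hi.symm] using hp _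

open Classical in
theorem card_bucket_le {p q : X → ι} {g : ℕ}
    (hg : ∀ c d, (Finset.univ.filter fun x => p x = c ∧ q x = d).card ≤ g)
    (W : Finset X) (κ : I) {a i : I} (hi : i ≠ a) :
    Fintype.card X *
      (Finset.univ.filter fun z : I → X => z κ ∈ W ∧ p (z i) = p (z a) ∧ q (z i) = q (z a)).card ≤
      g * (Finset.univ.filter fun z : I → X => z κ ∈ W).card := by
  have hg' : ∀ c d, (Finset.univ.filter fun x => c = p x ∧ d = q x).card ≤ g := fun c d => by
    simpa only [eq_comm] using hg c d
  by_cases hκi : κ = i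
  · subst hκi
    refine card_filter_update_le a (fun z => z κ ∈ W)
      (fun z => p (z κ) = p (z a) ∧ q (z κ) = q (z a)) (fun s x => ?_) (fun s => ?_)
    · simp [hi]
    · simpa [hi] using hg' _ _
  · refine card_filter_update_le i (fun z => z κ ∈ W)
      (fun z => p (z i) = p (z a) ∧ q (z i) = q (z a)) (fun s x => ?_) (fun s => ?_)
    · simp [hκi]
    · simpa [hi.symm] using hg _ _

-- Union bound. A point a that spoils freshness shares its row with some i and its column with some
-- k. If i ≠ k, these are two collisions of probability ρ/|X| each; if i = k, both points lie in one
-- bucket, which has probability g/|X|.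
open Classical in
theorem card_not_fresh_le {p q : X → ι} {ρ g : ℕ}
    (hp : ∀ c, (Finset.univ.filter fun x => p x = c).card ≤ ρ)
    (hq : ∀ c, (Finset.univ.filter fun x => q x = c).card ≤ ρ)
    (hg : ∀ c d, (Finset.univ.filter fun x => p x = c ∧ q x = d).card ≤ g)
    (W : Finset X) (κ : I) :
    Fintype.card X ^ 2 * (Finset.univ.filter fun z : I → X => z κ ∈ W ∧ ¬ Fresh p q z).card ≤
      (Fintype.card I ^ 3 * ρ ^ 2 + Fintype.card I ^ 2 * (g * Fintype.card X)) *
        (Finset.univ.filter fun z : I → X => z κ ∈ W).card := by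
  set c := (Finset.univ.filter fun z : I → X => z κ ∈ W).card with hc
  let E3 : I × I × I → Finset (I → X) := fun t => Finset.univ.filter fun z =>
    (t.2.1 ≠ t.1 ∧ t.2.2 ≠ t.1 ∧ t.2.1 ≠ t.2.2) ∧
      z κ ∈ W ∧ p (z t.2.1) = p (z t.1) ∧ q (z t.2.2) = q (z t.1)
  let E2 : I × I → Finset (I → X) := fun t => Finset.univ.filter fun z =>
    t.2 ≠ t.1 ∧ z κ ∈ W ∧ p (z t.2) = p (z t.1) ∧ q (z t.2) = q (z t.1)
  have hsub : (Finset.univ.filter fun z : I → X => z κ ∈ W ∧ ¬ Fresh p q z) ⊆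
      Finset.univ.biUnion E3 ∪ Finset.univ.biUnion E2 := by
    intro z hz
    obtain ⟨-, hW, hz⟩ := Finset.mem_filter.1 hz
    unfold Fresh at hz
    push Not at hz
    obtain ⟨a, ⟨i, hi, hpi⟩, k, hk, hqk⟩ := hz
    by_cases hik : i = k
    · subst hik
      refine Finset.mem_union_right _ (Finset.mem_biUnion.2 ⟨(a, i), Finset.mem_univ _, ?_⟩)
      simp [E2, hi, hW, hpi, hqk]
    · refine Finset.mem_union_left _ (Finset.mem_biUnion.2 ⟨(a, i, k), Finset.mem_univ _, ?_⟩)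
      simp [E3, hi, hk, hik, hW, hpi, hqk]
  have h3 : ∀ t, Fintype.card X ^ 2 * (E3 t).card ≤ ρ ^ 2 * c := by
    rintro ⟨a, i, k⟩
    by_cases h : i ≠ a ∧ k ≠ a ∧ i ≠ k
    · simp only [E3, h, ne_eq, not_false_eq_true, true_and]
      simpa [h] using card_row_col_le hp hq W κ h.1 h.2.1 h.2.2
    · have : E3 (a, i, k) = ∅ := by
        simp only [E3]
        rw [Finset.filter_eq_empty_iff]
        intro z _ h'
        exact h h'.1
      simp [this]
  have h2 : ∀ t, Fintype.card X ^ 2 * (E2 t).card ≤ (g * Fintype.card X) * c := by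
    rintro ⟨a, i⟩
    by_cases h : i ≠ a
    · have := card_bucket_le hg W κ h
      simp only [E2, h, ne_eq, not_false_eq_true, true_and]
      rw [pow_two, mul_assoc]
      refine (Nat.mul_le_mul_left _ this).trans (le_of_eq ?_)
      rw [hc]
      ring
    · have : E2 (a, i) = ∅ := by
        simp only [E2]
        rw [Finset.filter_eq_empty_iff]
        intro z _ h'
        exact h h'.1
      simp [this]
  calc _ ≤ Fintype.card X ^ 2 * (∑ t, (E3 t).card + ∑ t, (E2 t).card) := by
        gcongr
        exact (Finset.card_le_card hsub).trans ((Finset.card_union_le _ _).trans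
          (add_le_add Finset.card_biUnion_le Finset.card_biUnion_le))
    _ = ∑ t, Fintype.card X ^ 2 * (E3 t).card + ∑ t, Fintype.card X ^ 2 * (E2 t).card := by
        rw [mul_add, Finset.mul_sum, Finset.mul_sum]
    _ ≤ ∑ _t : I × I × I, ρ ^ 2 * c + ∑ _t : I × I, (g * Fintype.card X) * c :=
        add_le_add (Finset.sum_le_sum fun t _ => h3 t) (Finset.sum_le_sum fun t _ => h2 t)
    _ = _ := by
        simp only [Finset.sum_const, Finset.card_univ, Fintype.card_prod, smul_eq_mul]
        ring

open Classical in
theorem card_filter_apply_mem (W : Finset X) (κ : I) :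
    Fintype.card X * (Finset.univ.filter fun z : I → X => z κ ∈ W).card =
      Fintype.card X ^ Fintype.card I * W.card := by
  have := sum_apply_one κ (fun x => if x ∈ W then 1 else 0)
  rw [smul_eq_mul, smul_eq_mul] at this
  rw [Finset.card_filter, this]
  congr 1
  simp

end Fresh

/-! ### Walks under a random function given by row and column shifts -/

section Walks

variable {J X : Type*}

/-- The points of the walks of length `t` under `F` from the starting points `s`. -/
def walks (t : ℕ) (F : X → X) (s : J → X) : J × Fin (t + 1) → X := fun i => F^[i.2] (s i.1)

theorem walks_eq_iff {t : ℕ} {F : X → X} {s : J → X} {z : J × Fin (t + 1) → X} :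
    walks t F s = z ↔ (s = fun j => z (j, 0)) ∧
      ∀ i : J × Fin t, F (z (i.1, i.2.castSucc)) = z (i.1, i.2.succ) := by
  constructor
  · rintro rfl
    refine ⟨rfl, fun i => ?_⟩
    simp [walks, Function.iterate_succ_apply']
  · rintro ⟨rfl, h⟩
    funext ⟨j, i⟩
    induction i using Fin.induction with
    | zero => rfl
    | succ i ih =>
      rw [← h (j, i)]
      simp only [walks, Fin.val_succ, Function.iterate_succ_apply'] at ih ⊢
      rw [← ih]
      rfl

end Walks

section RandomFunction

/-- Translation by `δ c` preserves `P` and moves `e` by `c`; averaging over all `c` shows that `e`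
is uniform on Γ and independent of `P`. -/
theorem card_mul_card_shift {Ω Γ : Type*} [Fintype Ω] [AddGroup Ω] [Fintype Γ] [AddGroup Γ]
    (δ : Γ → Ω) (e : Ω → Γ) (P : Ω → Prop) [DecidablePred P] (S : Γ → Prop) [DecidablePred S]
    (hP : ∀ R c, P (R + δ c) ↔ P R) (he : ∀ R c, e (R + δ c) = e R + c) :
    Fintype.card Γ * (Finset.univ.filter fun R => P R ∧ S (e R)).card =
      (Finset.univ.filter P).card * (Finset.univ.filter S).card := by
  have h1 : ∀ c : Γ, (Finset.univ.filter fun R => P R ∧ S (e R)).card =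
      ∑ R, if P R ∧ S (e R + c) then 1 else 0 := fun c => by
    rw [Finset.card_filter, ← Equiv.sum_comp (Equiv.addRight (δ c))]
    simp [hP, he]
  have h2 : Fintype.card Γ * (Finset.univ.filter fun R => P R ∧ S (e R)).card =
      ∑ c : Γ, ∑ R, if P R ∧ S (e R + c) then 1 else 0 := by
    rw [← Finset.sum_congr rfl fun c _ => h1 c]
    simp
  rw [h2, Finset.sum_comm, Finset.card_filter P, Finset.sum_mul]
  refine Finset.sum_congr rfl fun R _ => ?_
  by_cases h : P R
  · simp only [h, true_and, if_true, one_mul]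
    rw [Finset.card_filter]
    exact Equiv.sum_comp (Equiv.addLeft (e R)) fun c => if S c then 1 else 0
  · simp [h]

variable {I X ι Γ : Type*} [Fintype ι] [DecidableEq ι] [Fintype Γ] [AddCommGroup Γ]
  [DecidableEq X]

/-- The function determined by random shifts of the rows and columns. -/
def shiftMap (p q : X → ι) (sel : Γ → X) (R : (ι → Γ) × (ι → Γ)) (x : X) : X :=
  sel (R.1 (p x) + R.2 (q x))

/-- The values at fresh points are independent. Points are added one at a time: changing the shift
of the private row or column of the new point makes its sum uniform and leaves all earlier values
alone. -/
theorem card_shiftMap_eq [Fintype I] [DecidableEq I] {p q : X → ι} (sel : Γ → X) {z : I → X}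
    (hz : Fresh p q z) (y : I → X) (s : Finset I) :
    Fintype.card Γ ^ s.card *
        (Finset.univ.filter fun R => ∀ i ∈ s, shiftMap p q sel R (z i) = y i).card =
      Fintype.card ((ι → Γ) × (ι → Γ)) *
        ∏ i ∈ s, (Finset.univ.filter fun c => sel c = y i).card := by
  induction s using Finset.induction_on with
  | empty => simp
  | insert a s ha ih =>
    have hstep : Fintype.card Γ * (Finset.univ.filter fun R : (ι → Γ) × (ι → Γ) =>
        (∀ i ∈ s, shiftMap p q sel R (z i) = y i) ∧ sel (R.1 (p (z a)) + R.2 (q (z a))) = y a).card =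
        (Finset.univ.filter fun R : (ι → Γ) × (ι → Γ) =>
          ∀ i ∈ s, shiftMap p q sel R (z i) = y i).card *
        (Finset.univ.filter fun c => sel c = y a).card := by
      have hne : ∀ i ∈ s, i ≠ a := fun i hi h => ha (h ▸ hi)
      rcases hz a with h | h
      · refine card_mul_card_shift (Ω := (ι → Γ) × (ι → Γ)) (Γ := Γ) (fun c => (Pi.single (p (z a)) c, 0))
          (fun R => R.1 (p (z a)) + R.2 (q (z a))) _ (fun c => sel c = y a) (fun R c => ?_)
          (fun R c => ?_)
        · refine forall₂_congr fun i hi => ?_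
          simp [shiftMap, Pi.single_eq_of_ne (h i (hne i hi))]
        · simp [add_right_comm]
      · refine card_mul_card_shift (Ω := (ι → Γ) × (ι → Γ)) (Γ := Γ) (fun c => (0, Pi.single (q (z a)) c))
          (fun R => R.1 (p (z a)) + R.2 (q (z a))) _ (fun c => sel c = y a) (fun R c => ?_)
          (fun R c => ?_)
        · refine forall₂_congr fun i hi => ?_
          simp [shiftMap, Pi.single_eq_of_ne (h i (hne i hi))]
        · simp [add_assoc]
    have e : (Finset.univ.filter fun R => ∀ i ∈ insert a s, shiftMap p q sel R (z i) = y i) =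
        (Finset.univ.filter fun R : (ι → Γ) × (ι → Γ) =>
        (∀ i ∈ s, shiftMap p q sel R (z i) = y i) ∧
          sel (R.1 (p (z a)) + R.2 (q (z a))) = y a) := by
      refine Finset.filter_congr fun R _ => ?_
      rw [Finset.forall_mem_insert, and_comm]
      rfl
    rw [Finset.card_insert_of_notMem ha, Finset.prod_insert ha, e, pow_succ, mul_assoc, hstep,
      ← mul_assoc, ih]
    ring

variable [Fintype I] [DecidableEq I]

theorem card_shiftMap_bounds [Nonempty Γ] {p q : X → ι} {sel : Γ → X} {z : I → X}
    (hz : Fresh p q z) (y : I → X) {a b : ℝ} (ha : 0 ≤ a)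
    (hlo : ∀ x, a * Fintype.card Γ ≤ (Finset.univ.filter fun c => sel c = x).card)
    (hhi : ∀ x, ((Finset.univ.filter fun c => sel c = x).card : ℝ) ≤ b * Fintype.card Γ) :
    Fintype.card ((ι → Γ) × (ι → Γ)) * a ^ Fintype.card I ≤
      (Finset.univ.filter fun R => ∀ i, shiftMap p q sel R (z i) = y i).card ∧
    ((Finset.univ.filter fun R => ∀ i, shiftMap p q sel R (z i) = y i).card : ℝ) ≤
      Fintype.card ((ι → Γ) × (ι → Γ)) * b ^ Fintype.card I := by
  have h := card_shiftMap_eq sel hz y Finset.univ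
  simp only [Finset.mem_univ, true_imp_iff, Finset.card_univ] at h
  have hK : (0 : ℝ) < (Fintype.card Γ : ℝ) ^ Fintype.card I := by
    have : 0 < Fintype.card Γ := Fintype.card_pos
    positivity
  have h' : (Fintype.card Γ : ℝ) ^ Fintype.card I *
      (Finset.univ.filter fun R => ∀ i, shiftMap p q sel R (z i) = y i).card =
      Fintype.card ((ι → Γ) × (ι → Γ)) *
        ∏ i, ((Finset.univ.filter fun c => sel c = y i).card : ℝ) := by exact_mod_cast h
  have e (c : ℝ) : (Fintype.card Γ : ℝ) ^ Fintype.card I *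
      (Fintype.card ((ι → Γ) × (ι → Γ)) * c ^ Fintype.card I) =
      Fintype.card ((ι → Γ) × (ι → Γ)) * ∏ _i : I, (c * Fintype.card Γ) := by
    simp [mul_pow]
    ring
  constructor
  · rw [← mul_le_mul_iff_right₀ hK, h', e]
    gcongr with i
    exact hlo _
  · rw [← mul_le_mul_iff_right₀ hK, h', e]
    gcongr with i
    exact hhi _

variable {J : Type*}

/-- Double counting of shifts with starting points against prescribed trajectories z. A fresh
trajectory with |J| walks imposes |J|·t independent transitions, each of probability between a and
b. -/
theorem card_walks_bounds [Fintype X] [Fintype J] [DecidableEq J] [Nonempty Γ] {p q : X → ι} {sel : Γ → X} {t : ℕ} {a b : ℝ} (ha : 0 ≤ a)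
    (hlo : ∀ x, a * Fintype.card Γ ≤ (Finset.univ.filter fun c => sel c = x).card)
    (hhi : ∀ x, ((Finset.univ.filter fun c => sel c = x).card : ℝ) ≤ b * Fintype.card Γ)
    (E : (J × Fin (t + 1) → X) → Prop) [DecidablePred E] (hE : ∀ z, E z → Fresh p q z) :
    Fintype.card ((ι → Γ) × (ι → Γ)) * a ^ (Fintype.card J * t) * (Finset.univ.filter E).card ≤
      ((∑ R, (Finset.univ.filter fun s : J → X =>
        E (walks t (shiftMap p q sel R) s)).card : ℕ) : ℝ) ∧
    ((∑ R, (Finset.univ.filter fun s : J → X =>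
        E (walks t (shiftMap p q sel R) s)).card : ℕ) : ℝ) ≤
      Fintype.card ((ι → Γ) × (ι → Γ)) * b ^ (Fintype.card J * t) * (Finset.univ.filter E).card := by
  have key : ∑ R, (Finset.univ.filter fun s : J → X =>
      E (walks t (shiftMap p q sel R) s)).card = ∑ z ∈ Finset.univ.filter E,
        (Finset.univ.filter fun R => ∀ i : J × Fin t,
          shiftMap p q sel R (z (i.1, i.2.castSucc)) = z (i.1, i.2.succ)).card := by
    simp only [Finset.card_filter (p := fun R => ∀ i : J × Fin t, _)]
    rw [Finset.sum_comm]
    refine Finset.sum_congr rfl fun R _ => ?_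
    rw [← Finset.card_filter, Finset.filter_filter]
    refine Finset.card_bij (fun s _ => walks t (shiftMap p q sel R) s) ?_ ?_ ?_
    · intro s hs
      simp only [Finset.mem_filter, Finset.mem_univ, true_and] at hs ⊢
      exact ⟨hs, (walks_eq_iff.1 rfl).2⟩
    · intro s _ s' _ h
      funext j
      exact congrFun h (j, 0)
    · intro z hz
      simp only [Finset.mem_filter, Finset.mem_univ, true_and] at hz
      have : walks t (shiftMap p q sel R) (fun j => z (j, 0)) = z := walks_eq_iff.2 ⟨rfl, hz.2⟩
      exact ⟨fun j => z (j, 0), by simpa [this] using hz.1, this⟩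
  have hb : ∀ z, E z → _ := fun z hz => card_shiftMap_bounds (I := J × Fin t) (sel := sel)
    ((hE z hz).comp (e := fun i : J × Fin t => (i.1, i.2.castSucc)) (by
      rintro ⟨j, i⟩ ⟨j', i'⟩ h
      simpa using h)) (fun i => z (i.1, i.2.succ)) ha hlo hhi
  rw [show Fintype.card (J × Fin t) = Fintype.card J * t by simp] at hb
  rw [key, Nat.cast_sum, mul_comm _ ((Finset.univ.filter E).card : ℝ),
    mul_comm _ ((Finset.univ.filter E).card : ℝ)]
  constructor
  · have := Finset.card_nsmul_le_sum (Finset.univ.filter E) _ _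
      fun z hz => (hb z (Finset.mem_filter.1 hz).2).1
    rwa [nsmul_eq_mul] at this
  · have := Finset.sum_le_card_nsmul (Finset.univ.filter E) _ _
      fun z hz => (hb z (Finset.mem_filter.1 hz).2).2
    rwa [nsmul_eq_mul] at this

end RandomFunction

/-! ### Closing walks up to cycles -/

section Coverage

variable {X ι β : Type*} {p q : X → ι}

/-- The map `F` with the values at the buckets in `O` replaced. -/
noncomputable def override (v : X → β) (O : Finset β) (val : β → X) (F : X → X) (x : X) : X :=
  open Classical in if v x ∈ O then val (v x) else F x

variable {v : X → β} {t m : ℕ} {F : X → X} {s : Fin m → X}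

/-- The walk from `s j` is fresh, and no other walk ends in a bucket on it. -/
def GoodWalk (p q : X → ι) (v : X → β) (t : ℕ) (F : X → X) (s : Fin m → X) (j : Fin m) : Prop :=
  Fresh p q (walks t F fun _ : Unit => s j) ∧
    ∀ j', j' ≠ j → ∀ i ≤ t, v (F^[t] (s j')) ≠ v (F^[i] (s j))

theorem GoodWalk.ne (hv : ∀ x y, v x = v y ↔ p x = p y ∧ q x = q y) {j : Fin m}
    (h : GoodWalk p q v t F s j) {i k : ℕ} (hi : i ≤ t) (hk : k ≤ t) (hik : i ≠ k) :
    v (F^[i] (s j)) ≠ v (F^[k] (s j)) := by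
  rw [Ne, hv]
  exact h.1.ne (i := ((), ⟨i, by omega⟩)) (a := ((), ⟨k, by omega⟩)) (by simpa using hik)

/-- Before its end, a good walk meets no overridden bucket: freshness keeps it away from its own end
bucket, and other walks end elsewhere. The override at its end leads back to the start. -/
theorem GoodWalk.periodic [DecidableEq β] (hv : ∀ x y, v x = v y ↔ p x = p y ∧ q x = q y)
    {val : β → X} (hval : ∀ j, GoodWalk p q v t F s j → val (v (F^[t] (s j))) = s j) {j : Fin m}
    (h : GoodWalk p q v t F s j) {κ : ℕ} (hκ : κ ≤ t) :
    (override v (Finset.univ.image fun j => v (F^[t] (s j))) val F)^[t + 1] (F^[κ] (s j)) =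
      F^[κ] (s j) := by
  set Φ := override v (Finset.univ.image fun j => v (F^[t] (s j))) val F with hΦ
  have hstep : ∀ i < t, Φ (F^[i] (s j)) = F^[i + 1] (s j) := by
    intro i hi
    rw [hΦ, override, if_neg, Function.iterate_succ_apply']
    simp only [Finset.mem_image, Finset.mem_univ, true_and, not_exists]
    intro j'
    by_cases hj : j' = j
    · subst hj
      exact h.ne hv le_rfl hi.le hi.ne'
    · exact h.2 j' hj i hi.le
  have hiter : ∀ i ≤ t, Φ^[i] (s j) = F^[i] (s j) := by
    intro i
    induction i with
    | zero => intro; rfl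
    | succ i ih =>
      intro hi
      rw [Function.iterate_succ_apply', ih (by omega), hstep i (by omega)]
  have hlast : Φ^[t + 1] (s j) = s j := by
    rw [Function.iterate_succ_apply', hiter t le_rfl, hΦ, override, if_pos, hval j h]
    exact Finset.mem_image_of_mem _ (Finset.mem_univ j)
  rw [← hiter κ hκ, ← Function.iterate_add_apply, add_comm, Function.iterate_add_apply, hlast]

/-- Two walks that meet run together from then on, so the one that is further along ends on the
other, which is forbidden. Hence points on good walks are counted only once. -/
theorem GoodWalk.eq_of_apply_eq (hv : ∀ x y, v x = v y ↔ p x = p y ∧ q x = q y) {j j' : Fin m}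
    (h : GoodWalk p q v t F s j) (h' : GoodWalk p q v t F s j') {κ κ' : ℕ} (hκ : κ ≤ t)
    (hκ' : κ' ≤ t) (he : F^[κ] (s j) = F^[κ'] (s j')) : j = j' ∧ κ = κ' := by
  have aux : ∀ {j j' : Fin m} {κ κ' : ℕ}, GoodWalk p q v t F s j → κ ≤ κ' → κ' ≤ t →
      F^[κ] (s j) = F^[κ'] (s j') → j = j' := by
    intro j j' κ κ' h hle hκ' he
    by_contra hne
    have := congrArg F^[t - κ'] he
    rw [← Function.iterate_add_apply, ← Function.iterate_add_apply, Nat.sub_add_cancel hκ'] at this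
    exact h.2 j' (Ne.symm hne) _ (by omega) (congrArg v this.symm)
  have hj : j = j' := by
    rcases le_total κ κ' with hle | hle
    · exact aux h hle hκ' he
    · exact (aux h' hle hκ he.symm).symm
  subst hj
  refine ⟨rfl, ?_⟩
  by_contra hne
  exact h.ne hv hκ hκ' hne (congrArg v he)

open Classical in
theorem exists_override (hm : 0 < m) (hv : ∀ x y, v x = v y ↔ p x = p y ∧ q x = q y)
    (W : Finset X) (s : Fin m → X) : ∃ (O : Finset β) (val : β → X), O.card ≤ m ∧
      ∑ j : Fin m, ∑ κ : Fin (t + 1),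
        (if F^[κ] (s j) ∈ W ∧ GoodWalk p q v t F s j then 1 else 0) ≤
      (W.filter fun x => (override v O val F)^[t + 1] x = x).card := by
  -- Several walks may end in the same bucket; a good one takes precedence, and it is then the only
  -- walk ending there.
  let val : β → X := fun b =>
    if h : ∃ j, v (F^[t] (s j)) = b ∧ GoodWalk p q v t F s j then s h.choose else s ⟨0, hm⟩
  have hval : ∀ j, GoodWalk p q v t F s j → val (v (F^[t] (s j))) = s j := by
    intro j hj
    have h : ∃ j', v (F^[t] (s j')) = v (F^[t] (s j)) ∧ GoodWalk p q v t F s j' := ⟨j, rfl, hj⟩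
    simp only [val, dif_pos h]
    congr 1
    by_contra hne
    exact hj.2 _ hne t le_rfl h.choose_spec.1
  refine ⟨Finset.univ.image fun j => v (F^[t] (s j)), val, ?_, ?_⟩
  · exact Finset.card_image_le.trans (by simp)
  · rw [← Fintype.sum_prod_type' fun (j : Fin m) (κ : Fin (t + 1)) =>
      if F^[κ] (s j) ∈ W ∧ GoodWalk p q v t F s j then 1 else 0, ← Finset.card_filter]
    refine Finset.card_le_card_of_injOn (fun i => F^[i.2] (s i.1)) ?_ ?_
    · rintro ⟨j, κ⟩ h
      simp only [Finset.coe_filter, Finset.mem_univ, true_and, Set.mem_ofPred_eq] at h ⊢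
      exact ⟨h.1, h.2.periodic hv hval (by omega)⟩
    · rintro ⟨j, κ⟩ h ⟨j', κ'⟩ h' he
      simp only [Finset.coe_filter, Finset.mem_univ, true_and, Set.mem_ofPred_eq] at h h'
      obtain ⟨rfl, hκ⟩ := h.2.eq_of_apply_eq hv h'.2 (κ := κ) (κ' := κ') (by omega) (by omega) he
      exact Prod.ext rfl (Fin.ext hκ)

/-- The walk from `a` is fresh and is in `W` after `κ` steps. -/
def Hits (p q : X → ι) (t : ℕ) (W : Finset X) (F : X → X) (κ : Fin (t + 1)) (a : X) : Prop :=
  F^[κ] a ∈ W ∧ Fresh p q (walks t F fun _ : Unit => a)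

/-- The walks from `a` and `b` are fresh together, and the first is in `W` after `κ` steps. -/
def HitsPair (p q : X → ι) (t : ℕ) (W : Finset X) (F : X → X) (κ : Fin (t + 1)) (a b : X) : Prop :=
  F^[κ] a ∈ W ∧ Fresh p q (walks t F fun j : Bool => cond j b a)

theorem HitsPair.hits {W : Finset X} {κ : Fin (t + 1)} {a b : X} (h : HitsPair p q t W F κ a b) :
    Hits p q t W F κ a :=
  ⟨h.1, h.2.comp (e := fun i : Unit × Fin (t + 1) => (false, i.2)) (by
    rintro ⟨⟨⟩, i⟩ ⟨⟨⟩, i'⟩ h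
    simpa using h)⟩

-- If the walk from `s j` is fresh together with each other walk, no other walk meets one of its
-- buckets, so it is good. Every partner for which this fails contributes a loss of 1. The bound
-- involves at most two walks at a time, so joint freshness of all m walks is not needed.
open Classical in
theorem good_ge (hv : ∀ x y, v x = v y ↔ p x = p y ∧ q x = q y) (W : Finset X) (s : Fin m → X)
    (j : Fin m) (κ : Fin (t + 1)) :
    (if Hits p q t W F κ (s j) then (1 : ℝ) else 0) -
      ∑ j' ∈ Finset.univ.erase j, ((if Hits p q t W F κ (s j) then (1 : ℝ) else 0) -
        if HitsPair p q t W F κ (s j) (s j') then (1 : ℝ) else 0) ≤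
      if F^[κ] (s j) ∈ W ∧ GoodWalk p q v t F s j then 1 else 0 := by
  have hnn : ∀ j', (0 : ℝ) ≤ (if Hits p q t W F κ (s j) then (1 : ℝ) else 0) -
      if HitsPair p q t W F κ (s j) (s j') then (1 : ℝ) else 0 := by
    intro j'
    by_cases h : HitsPair p q t W F κ (s j) (s j')
    · simp [h, h.hits]
    · simp only [h, if_false, sub_zero]
      split <;> norm_num
  by_cases h : Hits p q t W F κ (s j)
  swap
  · have h1 : (0 : ℝ) ≤ if F^[κ] (s j) ∈ W ∧ GoodWalk p q v t F s j then 1 else 0 := by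
      split <;> norm_num
    have h2 := Finset.sum_nonneg fun j' (_ : j' ∈ Finset.univ.erase j) => hnn j'
    simp only [h, if_false, zero_sub] at h2 ⊢
    linarith
  by_cases hall : ∀ j' ∈ Finset.univ.erase j, HitsPair p q t W F κ (s j) (s j')
  · have hg : GoodWalk p q v t F s j := by
      refine ⟨h.2, fun j' hj' i hi he => ?_⟩
      refine (hall j' (by simp [hj'])).2.ne (i := (true, ⟨t, by omega⟩))
        (a := (false, ⟨i, by omega⟩)) (by simp) ?_
      exact (hv _ _).1 he
    have h1 := Finset.sum_nonneg fun j' (_ : j' ∈ Finset.univ.erase j) => hnn j'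
    rw [if_pos (show F^[κ] (s j) ∈ W ∧ GoodWalk p q v t F s j from ⟨h.1, hg⟩)]
    simp only [h, if_true] at h1 ⊢
    linarith
  · push Not at hall
    obtain ⟨j', hj', hn⟩ := hall
    have h1 := Finset.single_le_sum (fun j' (_ : j' ∈ Finset.univ.erase j) => hnn j') hj'
    have h2 : (0 : ℝ) ≤ if F^[κ] (s j) ∈ W ∧ GoodWalk p q v t F s j then 1 else 0 := by
      split <;> norm_num
    simp only [h, hn, if_true, if_false] at h1 ⊢
    linarith

end Coverage

/-! ### Averaging over shifts and starting points -/

section Averaging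

theorem sum_sum_const {A B : Type*} [Fintype A] [Fintype B] (r : ℝ) :
    ∑ _a : A, ∑ _b : B, r = Fintype.card A * (Fintype.card B * r) := by
  simp

theorem mul_sum_sum {A B : Type*} [Fintype A] [Fintype B] (r : ℝ) (f : A → B → ℝ) :
    ∑ a, ∑ b, r * f a b = r * ∑ a, ∑ b, f a b := by
  simp only [Finset.mul_sum]

theorem sum_mul_sum_comm {A B C D : Type*} [Fintype A] [Fintype B] [Fintype C] [Fintype D]
    (r : ℝ) (f : A → B → C → D → ℝ) :
    ∑ a, ∑ b, r * ∑ c, ∑ d, f a b c d = r * ∑ c, ∑ d, ∑ a, ∑ b, f a b c d := by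
  have h := Finset.sum_comm (s := (Finset.univ : Finset (A × B)))
    (t := (Finset.univ : Finset (C × D))) (f := fun x y => f x.1 x.2 y.1 y.2)
  simp only [Fintype.sum_prod_type] at h
  rw [← h, Finset.mul_sum]
  simp only [Finset.mul_sum]

variable {X ι β Γ : Type*} [Fintype X] [Fintype ι] [DecidableEq ι] [Fintype Γ] [AddCommGroup Γ]

theorem sum_apply_erase {m : ℕ} (f : X → X → ℝ) (j : Fin m) :
    (Fintype.card X : ℝ) ^ 2 * ∑ s : Fin m → X, ∑ j' ∈ Finset.univ.erase j, f (s j) (s j') =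
      (m - 1 : ℕ) * ((Fintype.card X : ℝ) ^ m * ∑ a, ∑ b, f a b) := by
  rw [Finset.sum_comm, Finset.mul_sum]
  have : ∀ j' ∈ Finset.univ.erase j, (Fintype.card X : ℝ) ^ 2 * ∑ s : Fin m → X, f (s j) (s j') =
      (Fintype.card X : ℝ) ^ m * ∑ a, ∑ b, f a b := by
    intro j' hj'
    have := sum_apply_two (Finset.ne_of_mem_erase hj').symm f
    simpa [nsmul_eq_mul] using this
  rw [Finset.sum_congr rfl this]
  simp

-- The upper bound of `card_walks_bounds` for one walk, with the freshness of the trajectory dropped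
-- from the count.
open Classical in
theorem sum_hits_le [Nonempty Γ] {p q : X → ι} {sel : Γ → X} {t : ℕ} {a b : ℝ} (ha : 0 ≤ a)
    (hb : 0 ≤ b)
    (hlo : ∀ x, a * Fintype.card Γ ≤ (Finset.univ.filter fun c => sel c = x).card)
    (hhi : ∀ x, ((Finset.univ.filter fun c => sel c = x).card : ℝ) ≤ b * Fintype.card Γ)
    (W : Finset X) (κ : Fin (t + 1)) (hX : 0 < Fintype.card X) :
    ∑ R, ∑ x, (if Hits p q t W (shiftMap p q sel R) κ x then (1 : ℝ) else 0) ≤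
      Fintype.card ((ι → Γ) × (ι → Γ)) * (W.card * (Fintype.card X * b) ^ t) := by
  have h := (card_walks_bounds (J := Unit) (p := p) (q := q) (sel := sel) (t := t) ha hlo hhi
    (fun z => z ((), κ) ∈ W ∧ Fresh p q z) fun z hz => hz.2).2
  have h1 : ∀ R, ((Finset.univ.filter fun s : Unit → X =>
      walks t (shiftMap p q sel R) s ((), κ) ∈ W ∧
        Fresh p q (walks t (shiftMap p q sel R) s)).card : ℝ) =
      ∑ x, (if Hits p q t W (shiftMap p q sel R) κ x then (1 : ℝ) else 0) := by
    intro R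
    rw [Finset.natCast_card_filter, ← Equiv.sum_comp (Equiv.funUnique Unit X)]
    exact Finset.sum_congr rfl fun s _ => if_congr Iff.rfl rfl rfl
  have hN : (0 : ℝ) < Fintype.card X := by exact_mod_cast hX
  have h2 : ((Finset.univ.filter fun z : Unit × Fin (t + 1) → X =>
      z ((), κ) ∈ W ∧ Fresh p q z).card : ℝ) ≤ (Fintype.card X : ℝ) ^ t * W.card := by
    have h3 := card_filter_apply_mem W ((), κ)
    have h4 : ((Finset.univ.filter fun z : Unit × Fin (t + 1) → X => z ((), κ) ∈ W).card : ℝ) =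
        (Fintype.card X : ℝ) ^ t * W.card := by
      rw [← mul_right_inj' hN.ne']
      have h5 : (Fintype.card X : ℝ) * (Finset.univ.filter fun z : Unit × Fin (t + 1) → X =>
        z ((), κ) ∈ W).card = (Fintype.card X : ℝ) ^ Fintype.card (Unit × Fin (t + 1)) * W.card := by
        exact_mod_cast h3
      rw [h5]
      simp only [Fintype.card_prod, Fintype.card_unit, Fintype.card_fin]
      ring
    rw [← h4]
    exact_mod_cast Finset.card_le_card fun z hz => by
      simp only [Finset.mem_filter, Finset.mem_univ, true_and] at hz ⊢
      exact hz.1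
  rw [Nat.cast_sum] at h
  simp only [h1] at h
  refine h.trans ?_
  rw [Fintype.card_unit, one_mul, mul_assoc]
  refine mul_le_mul_of_nonneg_left ?_ (Nat.cast_nonneg _)
  calc b ^ t * _ ≤ b ^ t * ((Fintype.card X : ℝ) ^ t * W.card) := by gcongr
    _ = W.card * (Fintype.card X * b) ^ t := by rw [mul_pow]; ring

-- The lower bound of `card_walks_bounds` for two walks. They have 2(t+1) points together, and by
-- `card_not_fresh_le` at most a fraction η of the trajectories is not fresh.
open Classical in
theorem le_sum_hitsPair [Nonempty Γ] {p q : X → ι} {sel : Γ → X} {t : ℕ} {a b : ℝ} (ha : 0 ≤ a)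
    (hlo : ∀ x, a * Fintype.card Γ ≤ (Finset.univ.filter fun c => sel c = x).card)
    (hhi : ∀ x, ((Finset.univ.filter fun c => sel c = x).card : ℝ) ≤ b * Fintype.card Γ)
    {ρ g : ℕ}
    (hp : ∀ c, (Finset.univ.filter fun x => p x = c).card ≤ ρ)
    (hq : ∀ c, (Finset.univ.filter fun x => q x = c).card ≤ ρ)
    (hg : ∀ c d, (Finset.univ.filter fun x => p x = c ∧ q x = d).card ≤ g)
    {η : ℝ} (hη : ((2 * (t + 1)) ^ 3 * ρ ^ 2 + (2 * (t + 1)) ^ 2 * (g * Fintype.card X) : ℝ) ≤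
      η * (Fintype.card X : ℝ) ^ 2)
    (W : Finset X) (κ : Fin (t + 1)) (hX : 0 < Fintype.card X) :
    Fintype.card ((ι → Γ) × (ι → Γ)) * (W.card * Fintype.card X *
      ((Fintype.card X * a) ^ (2 * t) * (1 - η))) ≤
      ∑ R, ∑ x, ∑ y, (if HitsPair p q t W (shiftMap p q sel R) κ x y then (1 : ℝ) else 0) := by
  have h := (card_walks_bounds (J := Bool) (p := p) (q := q) (sel := sel) (t := t) ha hlo hhi
    (fun z => z (false, κ) ∈ W ∧ Fresh p q z) fun z hz => hz.2).1
  have h1 : ∀ R, ((Finset.univ.filter fun s : Bool → X =>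
      walks t (shiftMap p q sel R) s (false, κ) ∈ W ∧
        Fresh p q (walks t (shiftMap p q sel R) s)).card : ℝ) =
      ∑ x, ∑ y, (if HitsPair p q t W (shiftMap p q sel R) κ x y then (1 : ℝ) else 0) := by
    intro R
    rw [Finset.natCast_card_filter, ← Fintype.sum_prod_type',
      ← Equiv.sum_comp (Equiv.boolArrowEquivProd X)]
    refine Finset.sum_congr rfl fun s _ => if_congr ?_ rfl rfl
    have : s = fun j => cond j (s true) (s false) := by funext j; cases j <;> rfl
    rw [HitsPair]
    conv_lhs => rw [this]
    rfl
  have hN : (0 : ℝ) < Fintype.card X := by exact_mod_cast hX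
  set c := (Finset.univ.filter fun z : Bool × Fin (t + 1) → X => z (false, κ) ∈ W).card with hc
  have h4 : (c : ℝ) = (Fintype.card X : ℝ) ^ (2 * t + 1) * W.card := by
    have h3 := card_filter_apply_mem W (false, κ)
    rw [← mul_right_inj' hN.ne']
    have h5 : (Fintype.card X : ℝ) * c =
        (Fintype.card X : ℝ) ^ Fintype.card (Bool × Fin (t + 1)) * W.card := by exact_mod_cast h3
    rw [h5]
    simp only [Fintype.card_prod, Fintype.card_bool, Fintype.card_fin]
    ring
  have h2 : (c : ℝ) * (1 - η) ≤ (Finset.univ.filter fun z : Bool × Fin (t + 1) → X =>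
      z (false, κ) ∈ W ∧ Fresh p q z).card := by
    have h5 := card_not_fresh_le (fun c => by convert hp c) (fun c => by convert hq c)
      (fun c d => by convert hg c d) W (false, κ)
    have h6 : (Finset.univ.filter fun z : Bool × Fin (t + 1) → X =>
        z (false, κ) ∈ W ∧ Fresh p q z).card + (Finset.univ.filter fun z : Bool × Fin (t + 1) → X =>
        z (false, κ) ∈ W ∧ ¬ Fresh p q z).card = c := by
      rw [hc, ← Finset.card_filter_add_card_filter_not (s := Finset.univ.filter
        fun z : Bool × Fin (t + 1) → X => z (false, κ) ∈ W) (Fresh p q), Finset.filter_filter,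
        Finset.filter_filter]
    set u := (Finset.univ.filter fun z : Bool × Fin (t + 1) → X =>
        z (false, κ) ∈ W ∧ ¬ Fresh p q z).card
    simp only [Fintype.card_prod, Fintype.card_bool, Fintype.card_fin] at h5
    have h7 : (Fintype.card X : ℝ) ^ 2 * u ≤ ((2 * (t + 1)) ^ 3 * ρ ^ 2 +
        (2 * (t + 1)) ^ 2 * (g * Fintype.card X)) * c := by exact_mod_cast h5
    have h8 : (Fintype.card X : ℝ) ^ 2 * u ≤ (Fintype.card X : ℝ) ^ 2 * (η * c) := by
      refine h7.trans ?_
      calc _ ≤ (η * (Fintype.card X : ℝ) ^ 2) * c := by gcongr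
        _ = _ := by ring
    have h9 : (u : ℝ) ≤ η * c := le_of_mul_le_mul_left h8 (by positivity)
    have h10 : ((Finset.univ.filter fun z : Bool × Fin (t + 1) → X =>
        z (false, κ) ∈ W ∧ Fresh p q z).card : ℝ) + u = c := by exact_mod_cast h6
    linarith
  rw [Nat.cast_sum] at h
  simp only [h1] at h
  refine le_trans ?_ h
  rw [Fintype.card_bool, mul_assoc (Fintype.card ((ι → Γ) × (ι → Γ)) : ℝ)]
  refine mul_le_mul_of_nonneg_left ?_ (Nat.cast_nonneg _)
  calc _ = a ^ (2 * t) * (c * (1 - η)) := by rw [h4, mul_pow]; ring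
    _ ≤ _ := by gcongr

/-- Some choice of shifts and starting points makes many points periodic. -/
theorem exists_periodic_override [Nonempty Γ] {p q : X → ι} {v : X → β}
    (hv : ∀ x y, v x = v y ↔ p x = p y ∧ q x = q y) {sel : Γ → X} {t : ℕ} {a b : ℝ} (ha : 0 ≤ a)
    (hb : 0 ≤ b)
    (hlo : ∀ x, a * Fintype.card Γ ≤ Nat.card {c // sel c = x})
    (hhi : ∀ x, (Nat.card {c // sel c = x} : ℝ) ≤ b * Fintype.card Γ)
    {ρ g : ℕ}
    (hp : ∀ c, Nat.card {x // p x = c} ≤ ρ)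
    (hq : ∀ c, Nat.card {x // q x = c} ≤ ρ)
    (hg : ∀ x, Nat.card {y // v y = v x} ≤ g)
    {η : ℝ} (hη : ((2 * (t + 1)) ^ 3 * ρ ^ 2 + (2 * (t + 1)) ^ 2 * (g * Fintype.card X) : ℝ) ≤
      η * (Fintype.card X : ℝ) ^ 2) (hη0 : 0 ≤ η)
    {ε : ℝ} (hε : 0 ≤ ε) (hεa : 1 - ε ≤ (Fintype.card X * a) ^ (2 * t))
    (hεb : (Fintype.card X * b) ^ t ≤ 1 + ε) {m : ℕ} (hm : 0 < m)
    (hmε : (m + 1) * (2 * ε + η) ≤ 1 / 2) (hX : 0 < Fintype.card X) (W : Finset X) :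
    ∃ (R : (ι → Γ) × (ι → Γ)) (O : Finset β) (val : β → X), O.card ≤ m ∧
      m * (t + 1) * W.card ≤ 2 * Fintype.card X *
        Nat.card {x // x ∈ W ∧ (override v O val (shiftMap p q sel R))^[t + 1] x = x} := by
  classical
  simp only [Nat.card_eq_fintype_card, Fintype.card_subtype] at hlo hhi hp hq hg
  have hg' : ∀ c d, (Finset.univ.filter fun x => p x = c ∧ q x = d).card ≤ g := by
    intro c d
    by_cases h : ∃ x, p x = c ∧ q x = d
    · obtain ⟨x, rfl, rfl⟩ := h
      simpa only [hv] using hg x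
    · rw [Finset.filter_eq_empty_iff.2 fun x _ hx => h ⟨x, hx⟩]
      simp
  choose O val hO hcov using fun (R : (ι → Γ) × (ι → Γ)) (s : Fin m → X) =>
    exists_override (p := p) (q := q) (t := t) (F := shiftMap p q sel R) hm hv W s
  set cov : (ι → Γ) × (ι → Γ) → (Fin m → X) → ℕ := fun R s => (W.filter fun x =>
    (override v (O R s) (val R s) (shiftMap p q sel R))^[t + 1] x = x).card with hcovdef
  set N : ℝ := (Fintype.card X : ℝ) with hN
  have hN0 : 0 < N := by rw [hN]; exact_mod_cast hX
  set Ω : ℝ := (Fintype.card ((ι → Γ) × (ι → Γ)) : ℝ) with hΩ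
  have hΩ0 : 0 ≤ Ω := Nat.cast_nonneg _
  have hm1 : (1 : ℝ) ≤ m := by exact_mod_cast hm
  let g1 : (ι → Γ) × (ι → Γ) → Fin (t + 1) → X → ℝ := fun R κ x =>
    if Hits p q t W (shiftMap p q sel R) κ x then 1 else 0
  let g2 : (ι → Γ) × (ι → Γ) → Fin (t + 1) → X → X → ℝ := fun R κ x y =>
    if HitsPair p q t W (shiftMap p q sel R) κ x y then 1 else 0
  -- For a fixed walk and time, the main term is at least 1 - ε - η and each other walk costs at
  -- most 2ε + η, relative to the probability that a uniform point is in `W`. The assumption `hmε`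
  -- leaves 1/2.
  have key : ∀ κ, ∀ j : Fin m, N ^ m * (Ω * (W.card * N * (1 / 2))) ≤
      N ^ 2 * ∑ R, ∑ s : Fin m → X, (g1 R κ (s j) -
        ∑ j' ∈ Finset.univ.erase j, (g1 R κ (s j) - g2 R κ (s j) (s j'))) := by
    intro κ j
    have hS1 : ∑ R, ∑ x, g1 R κ x ≤ Ω * (W.card * (N * b) ^ t) :=
      sum_hits_le ha hb hlo hhi W κ hX
    have hS2 : Ω * (W.card * N * ((N * a) ^ (2 * t) * (1 - η))) ≤ ∑ R, ∑ x, ∑ y, g2 R κ x y :=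
      le_sum_hitsPair ha hlo hhi hp hq hg' hη W κ hX
    have hone : ∀ R, N ^ 2 * ∑ s : Fin m → X, g1 R κ (s j) = N ^ m * (N * ∑ x, g1 R κ x) := by
      intro R
      have := sum_apply_one j (g1 R κ)
      rw [nsmul_eq_mul, nsmul_eq_mul, Fintype.card_fin, Nat.cast_pow] at this
      rw [pow_two, mul_assoc, this]
      ring
    have htwo : ∀ R, N ^ 2 * ∑ s : Fin m → X, ∑ j' ∈ Finset.univ.erase j,
        (g1 R κ (s j) - g2 R κ (s j) (s j')) =
        (m - 1 : ℕ) * (N ^ m * (N * ∑ x, g1 R κ x - ∑ x, ∑ y, g2 R κ x y)) := by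
      intro R
      rw [sum_apply_erase (fun x y => g1 R κ x - g2 R κ x y) j]
      congr 2
      simp only [Finset.sum_sub_distrib, Finset.sum_const, Finset.card_univ, nsmul_eq_mul,
        ← Finset.mul_sum, hN]
    have hle : ∑ R, ∑ x, ∑ y, g2 R κ x y ≤ N * ∑ R, ∑ x, g1 R κ x := by
      rw [Finset.mul_sum]
      refine Finset.sum_le_sum fun R _ => ?_
      rw [Finset.mul_sum]
      refine Finset.sum_le_sum fun x _ => ?_
      have : N * g1 R κ x = ∑ _y : X, g1 R κ x := by simp [hN]
      rw [this]
      refine Finset.sum_le_sum fun y _ => ?_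
      simp only [g1, g2]
      by_cases h : HitsPair p q t W (shiftMap p q sel R) κ x y
      · simp [h, h.hits]
      · simp only [h, if_false]
        split <;> norm_num
    set S1 := ∑ R, ∑ x, g1 R κ x
    set S2 := ∑ R, ∑ x, ∑ y, g2 R κ x y
    have hsum : N ^ 2 * ∑ R, ∑ s : Fin m → X, (g1 R κ (s j) -
        ∑ j' ∈ Finset.univ.erase j, (g1 R κ (s j) - g2 R κ (s j) (s j'))) =
        N ^ m * (N * S1 - (m - 1) * (N * S1 - S2)) := by
      simp only [Finset.sum_sub_distrib (f := fun s : Fin m → X => g1 _ κ (s j)), Finset.mul_sum,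
        mul_sub]
      simp only [← Finset.mul_sum, ← mul_sub]
      have : ∀ R, N ^ 2 * (∑ s : Fin m → X, g1 R κ (s j) - ∑ s : Fin m → X,
          ∑ j' ∈ Finset.univ.erase j, (g1 R κ (s j) - g2 R κ (s j) (s j'))) =
          N ^ m * (N * ∑ x, g1 R κ x - (m - 1) *
            (N * ∑ x, g1 R κ x - ∑ x, ∑ y, g2 R κ x y)) := by
        intro R
        rw [mul_sub, hone, htwo, Nat.cast_sub hm, Nat.cast_one]
        ring
      rw [Finset.mul_sum, Finset.sum_congr rfl fun R _ => this R]
      simp only [← Finset.mul_sum, Finset.sum_sub_distrib, S1, S2]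
    rw [hsum]
    refine mul_le_mul_of_nonneg_left ?_ (by positivity)
    have hη1 : η ≤ 1 / 2 := by nlinarith
    have hW0 : (0 : ℝ) ≤ W.card := Nat.cast_nonneg _
    have b1 : N * S1 ≤ (Ω * (W.card * N)) * (1 + ε) := by
      calc N * S1 ≤ N * (Ω * (W.card * (N * b) ^ t)) := by gcongr
        _ ≤ N * (Ω * (W.card * (1 + ε))) := by gcongr
        _ = _ := by ring
    have b2 : (Ω * (W.card * N)) * (1 - ε - η) ≤ S2 := by
      refine le_trans ?_ hS2
      have : 1 - ε - η ≤ (N * a) ^ (2 * t) * (1 - η) := by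
        calc 1 - ε - η ≤ (1 - ε) * (1 - η) := by nlinarith
          _ ≤ _ := by gcongr; linarith
      calc _ = Ω * (W.card * N * (1 - ε - η)) := by ring
        _ ≤ _ := by gcongr
    have hA : 0 ≤ Ω * (W.card * N) := by positivity
    have b3 : (m : ℝ) * (N * S1 - S2) ≤ m * ((Ω * (W.card * N)) * (2 * ε + η)) := by
      gcongr
      linarith
    have b4 : (Ω * (W.card * N)) * (1 - ε - η) - m * ((Ω * (W.card * N)) * (2 * ε + η)) ≥
        (Ω * (W.card * N)) * (1 / 2) := by
      have : 1 / 2 ≤ (1 - ε - η) - m * (2 * ε + η) := by nlinarith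
      calc (Ω * (W.card * N)) * (1 / 2) ≤ (Ω * (W.card * N)) * ((1 - ε - η) - m * (2 * ε + η)) := by
            gcongr
        _ = _ := by ring
    nlinarith
  have hlow : ∀ R s, ∑ κ : Fin (t + 1), ∑ j : Fin m, (g1 R κ (s j) -
        ∑ j' ∈ Finset.univ.erase j, (g1 R κ (s j) - g2 R κ (s j) (s j'))) ≤ cov R s := by
    intro R s
    refine le_trans ?_ (Nat.cast_le.2 (hcov R s))
    rw [Finset.sum_comm]
    push_cast
    exact Finset.sum_le_sum fun j _ => Finset.sum_le_sum fun κ _ => good_ge hv W s j κ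
  have htot : N ^ m * (Ω * (W.card * N * (1 / 2))) * (m * (t + 1)) ≤
      N ^ 2 * ∑ R, ∑ s : Fin m → X, (cov R s : ℝ) := by
    calc N ^ m * (Ω * (W.card * N * (1 / 2))) * (m * (t + 1)) =
        ∑ _κ : Fin (t + 1), ∑ _j : Fin m, N ^ m * (Ω * (W.card * N * (1 / 2))) := by
          simp
          ring
      _ ≤ ∑ κ : Fin (t + 1), ∑ j : Fin m, N ^ 2 * ∑ R, ∑ s : Fin m → X, (g1 R κ (s j) -
        ∑ j' ∈ Finset.univ.erase j, (g1 R κ (s j) - g2 R κ (s j) (s j'))) :=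
          Finset.sum_le_sum fun κ _ => Finset.sum_le_sum fun j _ => key κ j
      _ = N ^ 2 * ∑ R, ∑ s : Fin m → X, ∑ κ : Fin (t + 1), ∑ j : Fin m, (g1 R κ (s j) -
        ∑ j' ∈ Finset.univ.erase j, (g1 R κ (s j) - g2 R κ (s j) (s j'))) := by
          exact sum_mul_sum_comm (N ^ 2) fun κ j R (s : Fin m → X) => g1 R κ (s j) -
            ∑ j' ∈ Finset.univ.erase j, (g1 R κ (s j) - g2 R κ (s j) (s j'))
      _ ≤ _ := by
          gcongr with R _ s _
          exact hlow R s
  -- Some choice is at least as good as the average.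
  have hex : ∃ R ∈ (Finset.univ : Finset ((ι → Γ) × (ι → Γ))), ∃ s ∈ (Finset.univ : Finset (Fin m → X)),
      (m : ℝ) * (t + 1) * W.card ≤ 2 * N * cov R s := by
    by_contra hcon
    push Not at hcon
    have hXne : Nonempty X := Fintype.card_pos_iff.1 hX
    have h1 : ∑ R : (ι → Γ) × (ι → Γ), ∑ s : Fin m → X, 2 * N * (cov R s : ℝ) <
        ∑ _R : (ι → Γ) × (ι → Γ), ∑ _s : Fin m → X, (m : ℝ) * (t + 1) * W.card := by
      refine Finset.sum_lt_sum_of_nonempty Finset.univ_nonempty fun R hR => ?_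
      exact Finset.sum_lt_sum_of_nonempty Finset.univ_nonempty fun s hs => hcon R hR s hs
    rw [mul_sum_sum, sum_sum_const, ← hΩ, Fintype.card_fun, Fintype.card_fin, Nat.cast_pow,
      ← hN] at h1
    have h2 : N ^ 2 * (2 * N * ∑ R, ∑ s : Fin m → X, (cov R s : ℝ)) <
        N ^ 2 * (Ω * (N ^ m * ((m : ℝ) * (t + 1) * W.card))) := by gcongr
    have h3 := mul_le_mul_of_nonneg_left htot (by positivity : 0 ≤ 2 * N)
    refine absurd (h3.trans_lt ?_) (lt_irrefl (2 * N * (N ^ m * (Ω * (W.card * N * (1 / 2))) *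
      (m * (t + 1)))))
    calc _ = N ^ 2 * (2 * N * ∑ R, ∑ s : Fin m → X, (cov R s : ℝ)) := by ring
      _ < _ := h2
      _ = _ := by ring
  obtain ⟨R, -, s, -, h⟩ := hex
  refine ⟨R, O R s, val R s, hO R s, ?_⟩
  have e : Nat.card {x // x ∈ W ∧
      (override v (O R s) (val R s) (shiftMap p q sel R))^[t + 1] x = x} = cov R s :=
    Nat.subtype_card _ fun x => Finset.mem_filter
  rw [e]
  rw [hN] at h
  exact_mod_cast h

end Averaging

/-! ### Rejection sampling of light positions -/

section LastLight

variable {α : Type*} (P : α → Prop) (d : α)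

open Classical in
/-- The last member of a tuple with the property `P`, or `d`. -/
noncomputable def lastWith : (U : ℕ) → (Fin U → α) → α
  | 0, _ => d
  | U + 1, γ => if P (γ (Fin.last U)) then γ (Fin.last U) else lastWith U (Fin.init γ)

variable {P d}

theorem lastWith_mem (hd : P d) : ∀ (U : ℕ) (γ : Fin U → α), P (lastWith P d U γ)
  | 0, _ => hd
  | U + 1, γ => by
    rw [lastWith]
    split
    · assumption
    · exact lastWith_mem hd U _

variable [Fintype α]

-- All candidates fail with probability (1 - M/K)^U, and the result is then `d`. Otherwise the
-- result is uniform among the M light elements. The identity is multiplied by M to avoid a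
-- division.
open Classical in
theorem card_lastWith {x : α} (hx : P x) (U : ℕ) :
    (Nat.card {γ // lastWith P d U γ = x} : ℝ) * Nat.card {y // P y} =
      (1 - (1 - (Nat.card {y // P y} : ℝ) / Fintype.card α) ^ U +
        if d = x then (Nat.card {y // P y} : ℝ) *
          (1 - (Nat.card {y // P y} : ℝ) / Fintype.card α) ^ U else 0) *
        Fintype.card (Fin U → α) := by
  have hα : (Fintype.card α : ℝ) ≠ 0 := by
    have := Fintype.card_pos_iff.2 ⟨x⟩
    positivity
  set M : ℝ := (Nat.card {y // P y} : ℝ) with hM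
  set K : ℝ := (Fintype.card α : ℝ) with hK
  induction U with
  | zero =>
    by_cases h : d = x <;> simp [lastWith, h]
  | succ U ih =>
    -- Condition on the last candidate: x itself decides in favour of x, another light element
    -- against it, and a dark one passes to the shorter tuple.
    have hcard : (Nat.card {γ // lastWith P d (U + 1) γ = x} : ℝ) =
        Fintype.card (Fin U → α) + (K - M) * Nat.card {γ // lastWith P d U γ = x} := by
      have h1 : (Nat.card {γ // lastWith P d (U + 1) γ = x} : ℝ) =
          ∑ y : α, ∑ γ : Fin U → α, if (if P y then y = x else lastWith P d U γ = x)
            then (1 : ℝ) else 0 := by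
        rw [Nat.card_eq_fintype_card, Fintype.card_subtype, Finset.natCast_card_filter,
          ← Equiv.sum_comp (Fin.snocEquiv fun _ => α), Fintype.sum_prod_type]
        refine Finset.sum_congr rfl fun y _ => Finset.sum_congr rfl fun γ _ => if_congr ?_ rfl rfl
        have hi : Fin.init ((Fin.snocEquiv fun _ => α) (y, γ)) = γ :=
          Fin.init_snoc (α := fun _ => α) y γ
        simp only [lastWith, hi]
        simp only [Fin.snocEquiv_apply, Fin.snoc_last]
        split <;> rfl
      have h2 : ∀ y : α, (∑ γ : Fin U → α, if (if P y then y = x else lastWith P d U γ = x)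
            then (1 : ℝ) else 0) = (if y = x then (Fintype.card (Fin U → α) : ℝ) else 0) +
            if P y then 0 else (Nat.card {γ // lastWith P d U γ = x} : ℝ) := by
        intro y
        by_cases hy : P y
        · by_cases hyx : y = x
          · simp [hyx, hx]
          · simp [hy, hyx]
        · have hyx : y ≠ x := fun h => hy (h ▸ hx)
          rw [Nat.card_eq_fintype_card, Fintype.card_subtype, Finset.natCast_card_filter]
          simp [hy, hyx]
      rw [h1, Finset.sum_congr rfl fun y _ => h2 y, Finset.sum_add_distrib]
      congr 1
      · simp
      · rw [Finset.sum_ite, Finset.sum_const_zero, zero_add, Finset.sum_const, nsmul_eq_mul]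
        congr 1
        rw [hK, hM, Nat.card_eq_fintype_card, Fintype.card_subtype,
          ← Finset.card_univ, ← Finset.card_filter_add_card_filter_not (s := Finset.univ) P]
        push_cast
        ring
    have hpow : (Fintype.card (Fin (U + 1) → α) : ℝ) = K * Fintype.card (Fin U → α) := by
      simp [hK, pow_succ, mul_comm]
    rw [hcard, hpow, add_mul, mul_assoc, ih, pow_succ]
    have : (K - M) = (1 - M / K) * K := by field_simp
    rw [this]
    have hMK : M = (M / K) * K := by field_simp
    split
    · generalize hr : M / K = r at *
      rw [hMK]
      ring
    · generalize hr : M / K = r at *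
      rw [hMK]
      ring

end LastLight

/-! ### Greedy covering -/

section Greedy

variable {X Tb : Type*} [Fintype X]

/-- Each new table covers a fraction 1/Q of what is left. After Q·l tables at most (1 - 1/Q)^(Q·l) ≤
2^(-l) of the points remain uncovered, which is less than one point. -/
theorem exists_cover {cov : Tb → X → Prop} {Q l : ℕ} (hQ : 0 < Q)
    (h : ∀ W : Finset X, ∃ τ, W.card ≤ Q * Nat.card {x // x ∈ W ∧ cov τ x})
    (hl : Fintype.card X < 2 ^ l) : ∃ τ : ℕ → Tb, ∀ x, ∃ i < Q * l, cov (τ i) x := by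
  classical
  have key : ∀ k, ∃ τ : ℕ → Tb,
      ((Finset.univ.filter fun x => ∀ i < k, ¬ cov (τ i) x).card : ℝ) ≤
        (1 - 1 / (Q : ℝ)) ^ k * Fintype.card X := by
    have hQ' : (0 : ℝ) < Q := by exact_mod_cast hQ
    intro k
    induction k with
    | zero =>
      obtain ⟨τ, -⟩ := h ∅
      exact ⟨fun _ => τ, by simp⟩
    | succ k ih =>
      obtain ⟨τ, hτ⟩ := ih
      set W := Finset.univ.filter fun x => ∀ i < k, ¬ cov (τ i) x with hW
      obtain ⟨τ', hτ'⟩ := h W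
      refine ⟨fun i => if i < k then τ i else τ', ?_⟩
      have e : (Finset.univ.filter fun x => ∀ i < k + 1, ¬ cov (if i < k then τ i else τ') x) =
          W.filter fun x => ¬ cov τ' x := by
        ext x
        simp only [hW, Finset.mem_filter, Finset.mem_univ, true_and]
        constructor
        · intro hx
          refine ⟨fun i hi => by simpa [hi] using hx i (by omega), ?_⟩
          simpa using hx k (by omega)
        · rintro ⟨hx, hx'⟩ i hi
          by_cases hik : i < k
          · simpa [hik] using hx i hik
          · simpa [hik] using hx'
      have h1 : Nat.card {x // x ∈ W ∧ cov τ' x} = (W.filter fun x => cov τ' x).card :=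
        Nat.subtype_card _ fun x => Finset.mem_filter
      have h2 := Finset.card_filter_add_card_filter_not (s := W) (fun x => cov τ' x)
      rw [h1] at hτ'
      have h2' : ((W.filter fun x => cov τ' x).card : ℝ) + (W.filter fun x => ¬ cov τ' x).card =
        W.card := by exact_mod_cast h2
      have h3 : (W.card : ℝ) ≤ Q * (W.filter fun x => cov τ' x).card := by exact_mod_cast hτ'
      rw [e, pow_succ]
      have h4 : (W.card : ℝ) / Q ≤ (W.filter fun x => cov τ' x).card := by
        rw [div_le_iff₀ hQ']; linarith
      have hQ1 : (0 : ℝ) ≤ 1 - 1 / Q := by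
        have : (1 : ℝ) ≤ Q := by exact_mod_cast hQ
        rw [sub_nonneg, div_le_one hQ']
        exact this
      calc ((W.filter fun x => ¬ cov τ' x).card : ℝ) ≤ (1 - 1 / Q) * W.card := by
            rw [sub_mul, one_mul, one_div, inv_mul_eq_div]; linarith
        _ ≤ (1 - 1 / Q) * ((1 - 1 / (Q : ℝ)) ^ k * Fintype.card X) := by gcongr
        _ = _ := by ring
  obtain ⟨τ, hτ⟩ := key (Q * l)
  refine ⟨τ, ?_⟩
  have hQ' : (0 : ℝ) < Q := by exact_mod_cast hQ
  have h1 : (1 - 1 / (Q : ℝ)) ^ Q ≤ 1 / 2 := by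
    have h2 : 1 - 1 / (Q : ℝ) ≤ Real.exp (-(1 / Q)) := Real.one_sub_le_exp_neg _
    have hQ1 : (0 : ℝ) ≤ 1 - 1 / Q := by
      have : (1 : ℝ) ≤ Q := by exact_mod_cast hQ
      rw [sub_nonneg, div_le_one hQ']
      exact this
    calc (1 - 1 / (Q : ℝ)) ^ Q ≤ Real.exp (-(1 / Q)) ^ Q := by gcongr
      _ = Real.exp (-1) := by
        rw [← Real.exp_nat_mul]; congr 1; field_simp
      _ ≤ 1 / 2 := by
        rw [Real.exp_neg, one_div]
        gcongr
        linarith [Real.exp_one_gt_d9]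
  have h2 : ((Finset.univ.filter fun x => ∀ i < Q * l, ¬ cov (τ i) x).card : ℝ) < 1 := by
    refine hτ.trans_lt ?_
    rw [pow_mul]
    have hQ1 : (0 : ℝ) ≤ 1 - 1 / Q := by
      have : (1 : ℝ) ≤ Q := by exact_mod_cast hQ
      rw [sub_nonneg, div_le_one hQ']
      exact this
    have hl' : (Fintype.card X : ℝ) < 2 ^ l := by exact_mod_cast hl
    calc _ ≤ (1 / 2 : ℝ) ^ l * Fintype.card X := by gcongr
      _ < (1 / 2 : ℝ) ^ l * 2 ^ l := by gcongr
      _ = 1 := by rw [← mul_pow]; norm_num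
  have h3 : (Finset.univ.filter fun x => ∀ i < Q * l, ¬ cov (τ i) x) = ∅ := by
    rw [← Finset.card_eq_zero]
    have : (Finset.univ.filter fun x => ∀ i < Q * l, ¬ cov (τ i) x).card < 1 := by exact_mod_cast h2
    omega
  intro x
  by_contra hx
  push Not at hx
  have : x ∈ (Finset.univ.filter fun x => ∀ i < Q * l, ¬ cov (τ i) x) := by simpa using hx
  simp [h3] at this

end Greedy

/-! ### Existence of good tables -/

/-- Partial inverses of a function on `N` positions, given by sparse tables of explicit values and
by sequences of candidates which are sums of two shifts. -/
structure Tables (N : ℕ) where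
  tables : ℕ
  walk : ℕ
  tries : ℕ
  k : ℕ
  r : ℕ
  dflt : Fin N
  row : ℕ → ℕ → ℕ → Fin N
  col : ℕ → ℕ → ℕ → Fin N
  keys : ℕ → Finset ℕ
  target : ℕ → ℕ → Fin N

namespace Tables

open Classical in
/-- The position following the bucket `v` in the table `i`. -/
noncomputable def step {N : ℕ} (τ : Tables N) (light : Fin N → Prop) (i v : ℕ) : Fin N :=
  if v ∈ τ.keys i then τ.target i v
  else lastWith light τ.dflt τ.tries fun u => τ.row i (v / τ.k) u + τ.col i (v % τ.r) u

/-- The walks in the tables reach all light positions, within certain resources. -/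
structure Good {n : ℕ} (τ : Tables (n * n)) (light : Fin (n * n) → Prop) (bk : Fin (n * n) → ℕ)
    (V g lam : ℕ) : Prop where
  covers : ∀ x, light x → ∃ i < τ.tables, ∃ j < τ.walk,
    τ.step light i ((fun v => bk (τ.step light i v))^[j] (bk x)) = x
  r_pos : 0 < τ.r
  le_mul : V ≤ τ.k * τ.r
  keys_lt : ∀ i, ∀ v ∈ τ.keys i, v < V
  sum_keys : g * ∑ i ∈ Finset.range τ.tables, (τ.keys i).card ≤ 8 * lam * (n * n)
  walk_pos : 0 < τ.walk
  tables_pos : 0 < τ.tables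
  k_le : τ.k ≤ V + 8 * n
  r_le : τ.r ≤ 8 * n
  time_le : τ.tables * τ.walk * (τ.tries + 1) ≤ 20480 * g ^ 3 * lam ^ 2
  shifts_le : τ.tables * τ.r * τ.tries ≤ 65536 * n * g ^ 2 * lam ^ 2

end Tables

/-- Periodicity is a statement about positions, but a query knows only the bucket of its unknown
position. A return to x after j + 1 steps is a walk of j steps on buckets followed by one step that
yields x. -/
theorem iterate_comp_succ {α β : Type*} (s : α → β) (b : β → α) (x : β) (j : ℕ) :
    (fun y => s (b y))^[j + 1] x = s ((fun v => b (s v))^[j] (b x)) := by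
  induction j with
  | zero => rfl
  | succ j ih => rw [Function.iterate_succ_apply', ih, Function.iterate_succ_apply']

open Classical in
/-- If few positions are light, all of them are stored. -/
theorem exists_tables_of_few {n V g lam : ℕ} (hn : 0 < n) (hg : 0 < g)
    (hlam : 0 < lam) {light : Fin (n * n) → Prop} {bk : Fin (n * n) → ℕ} (hbk : ∀ x, bk x < V)
    (hle : ∀ v, Nat.card {x // light x ∧ bk x = v} ≤ g)
    (hfew : Nat.card {x // light x} * g < n * n) :
    ∃ τ : Tables (n * n), τ.Good light bk V g lam := by
  set L : ℕ → Finset (Fin (n * n)) := fun v => Finset.univ.filter fun x => light x ∧ bk x = v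
    with hL
  have hLg : ∀ v, (L v).card ≤ g := fun v => by
    rw [← Nat.subtype_card (L v) (p := fun x => light x ∧ bk x = v) (by simp [hL])]
    exact hle v
  have hnn : 0 < n * n := by positivity
  -- Table i stores the i-th light position of every bucket that has one. Walks consist of one step,
  -- and no random candidates are used.
  refine ⟨⟨g, 1, 0, V, 1, ⟨0, hnn⟩, fun _ _ _ => ⟨0, hnn⟩, fun _ _ _ => ⟨0, hnn⟩,
    fun i => (Finset.range V).filter fun v => i < (L v).card,
    fun i v => (L v).toList.getD i ⟨0, hnn⟩⟩, ?_, one_pos, by simp, ?_, ?_, one_pos, hg,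
    Nat.le_add_right _ _, by simp only; omega, ?_, by simp⟩
  · intro x hx
    have hx' : x ∈ (L (bk x)).toList := by simp [hL, hx]
    have hi : (L (bk x)).toList.idxOf x < (L (bk x)).card := by
      rw [← Finset.length_toList]
      exact List.idxOf_lt_length_of_mem hx'
    refine ⟨_, hi.trans_le (hLg _), 0, one_pos, ?_⟩
    simp only [Function.iterate_zero, id_eq, Tables.step, Finset.mem_filter, Finset.mem_range,
      hbk, hi, and_self, if_true]
    rw [List.getD_eq_getElem _ _ (List.idxOf_lt_length_of_mem hx'), List.getElem_idxOf]
  · intro i v hv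
    simpa using (Finset.mem_filter.1 hv).1
  · have h1 : ∑ i ∈ Finset.range g, ((Finset.range V).filter fun v => i < (L v).card).card ≤
        Nat.card {x // light x} := by
      simp only [Finset.card_filter]
      rw [Finset.sum_comm]
      calc _ ≤ ∑ v ∈ Finset.range V, (L v).card := by
            refine Finset.sum_le_sum fun v _ => ?_
            rw [← Finset.card_filter]
            calc _ ≤ (Finset.range (L v).card).card :=
                  Finset.card_le_card fun i hi => by simpa using (Finset.mem_filter.1 hi).2
              _ = _ := Finset.card_range _
        _ = (Finset.univ.filter light).card := by
            rw [Finset.card_eq_sum_card_fiberwise (f := bk) (t := Finset.range V)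
              fun x _ => by simpa using hbk x]
            refine Finset.sum_congr rfl fun v _ => ?_
            rw [hL, Finset.filter_filter]
        _ = _ := (Nat.subtype_card _ fun x => by simp).symm
    calc _ ≤ g * Nat.card {x // light x} := Nat.mul_le_mul_left _ h1
      _ ≤ n * n := by rw [mul_comm]; exact hfew.le
      _ ≤ 8 * lam * (n * n) := Nat.le_mul_of_pos_left _ (by omega)
  · have h1 : 1 ≤ g ^ 2 := Nat.one_le_pow _ _ hg
    have h2 : 1 ≤ lam ^ 2 := Nat.one_le_pow _ _ hlam
    calc g * 1 * (0 + 1) = 1 * (g * 1) * 1 := by ring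
      _ ≤ 20480 * (g * g ^ 2) * lam ^ 2 := by gcongr; norm_num
      _ = _ := by ring

theorem pow_le_one_add_two_mul {y : ℝ} {t : ℕ} (hy : 0 ≤ y) (hty : t * y ≤ 1) :
    (1 + y) ^ t ≤ 1 + 2 * (t * y) := by
  calc (1 + y) ^ t ≤ Real.exp y ^ t := by
        gcongr
        linarith [Real.add_one_le_exp y]
    _ = Real.exp (t * y) := (Real.exp_nat_mul _ _).symm
    _ ≤ _ := by
      have h0 : 0 ≤ t * y := by positivity
      have := Real.abs_exp_sub_one_sub_id_le (x := t * y) (by rwa [abs_of_nonneg h0])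
      have h2 := (abs_le.1 this).2
      nlinarith

/-- The probability that all of `U` random positions are dark. -/
theorem pow_dark_le {M K : ℝ} {U a : ℕ} (hK : 0 < K) (hMK : M ≤ K)
    (hU : K * a ≤ M * U) : (1 - M / K) ^ U ≤ (1 / 2) ^ a := by
  have h1 : 0 ≤ 1 - M / K := by
    rw [sub_nonneg, div_le_one hK]; exact hMK
  calc (1 - M / K) ^ U ≤ Real.exp (-(M / K)) ^ U := by
        gcongr; exact Real.one_sub_le_exp_neg _
    _ = Real.exp (-(M * U / K)) := by
        rw [← Real.exp_nat_mul]; congr 1; ring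
    _ ≤ Real.exp (-a) := by
        gcongr
        rw [le_div_iff₀ hK]; linarith
    _ = Real.exp (-1) ^ a := by rw [← Real.exp_nat_mul]; congr 1; ring
    _ ≤ (1 / 2) ^ a := by
        gcongr
        rw [Real.exp_neg, one_div]
        gcongr
        linarith [Real.exp_one_gt_d9]

/-- Buckets in the same row differ by less than k ≤ r, so they cannot share a residue modulo r.
Hence row and column determine the bucket. -/
theorem div_mod_injective {k r v v' : ℕ} (hkr : k ≤ r) (hk : 0 < k) (h : v / k = v' / k)
    (h' : v % r = v' % r) : v = v' := by
  wlog hle : v ≤ v' generalizing v v'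
  · exact (this h.symm h'.symm (by omega)).symm
  have h1 := Nat.div_add_mod v k
  have h2 := Nat.div_add_mod v' k
  have h3 := Nat.mod_lt v hk
  have h4 := Nat.mod_lt v' hk
  rw [h] at h1
  have h5 : v' - v < r := by omega
  have h6 := (Nat.modEq_iff_dvd' hle).1 h'
  have := Nat.eq_zero_of_dvd_of_lt h6 h5
  omega

open Classical in
theorem card_fiber_comp_le {X : Type*} [Fintype X] {v : X → ℕ} {g : ℕ}
    (hg : ∀ c, Nat.card {x // v x = c} ≤ g) (P : ℕ → Prop) (S : Finset ℕ) (hS : ∀ x, P (v x) → v x ∈ S) :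
    Nat.card {x // P (v x)} ≤ S.card * g := by
  rw [Nat.subtype_card (Finset.univ.filter fun x => P (v x)) (by simp)]
  refine (Finset.card_le_mul_card_image_of_maps_to (f := v) (t := S)
    (fun x hx => hS x (Finset.mem_filter.1 hx).2) g fun c _ => ?_).trans_eq (mul_comm _ _)
  refine le_trans ?_ (hg c)
  rw [Nat.subtype_card (Finset.univ.filter fun x => v x = c) (by simp)]
  exact Finset.card_le_card fun x hx => by simpa using (Finset.mem_filter.1 hx).2

section OneTable

variable {N : ℕ} [NeZero N] {light : Fin N → Prop} {d : Fin N}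

open Classical in
/-- The step to light positions given by shifts and overrides. -/
noncomputable def lightStep (hd : light d) (k r U : ℕ) (row col : ℕ → ℕ → Fin N) (O : Finset ℕ)
    (val : ℕ → {x // light x}) (v : ℕ) : {x // light x} :=
  if v ∈ O then val v
  else ⟨lastWith light d U fun u => row (v / k) u + col (v % r) u, lastWith_mem hd _ _⟩

-- An instance of `exists_periodic_override`: the points are the light positions, a row consists of
-- k consecutive buckets, a column is a residue class modulo r, and a shift is a U-tuple of
-- positions from whose sums the last light candidate is taken.
open Classical in
theorem exists_periodic_lightStep (hd : light d) {v : {x // light x} → ℕ} {k r : ℕ} (hk : 0 < k)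
    (hkr : k ≤ r) (hV : ∀ x, v x < k * r) {g : ℕ} (hg0 : 0 < g)
    (hg : ∀ c, Nat.card {x // v x = c} ≤ g) {t U m lam : ℕ} (hm : 0 < m)
    (hmT : 64 * (t + 1) ^ 2 * g * m ≤ Nat.card {x // light x})
    (hρ : 2 * (t + 1) * (k * g) ^ 2 ≤ Nat.card {x // light x} * g)
    (hU : N * (4 * lam) ≤ Nat.card {x // light x} * U) (hN : N < 2 ^ (2 * lam))
    (W : Finset {x // light x}) :
    ∃ (row col : ℕ → ℕ → Fin N) (O : Finset ℕ) (val : ℕ → {x // light x}), O.card ≤ m ∧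
      m * (t + 1) * W.card ≤ 2 * Nat.card {x // light x} *
        Nat.card {x // x ∈ W ∧
          (fun x => lightStep hd k r U row col O val (v x))^[t + 1] x = x} := by
  have hr : 0 < r := by omega
  let p : {x // light x} → Fin r := fun x => ⟨v x / k, Nat.div_lt_of_lt_mul (hV x)⟩
  let q : {x // light x} → Fin r := fun x => ⟨v x % r, Nat.mod_lt _ hr⟩
  let sel : (Fin U → Fin N) → {x // light x} := fun γ => ⟨lastWith light d U γ, lastWith_mem hd _ _⟩
  have hMN : Nat.card {x // light x} ≤ N := by
    rw [Nat.card_eq_fintype_card]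
    simpa using Fintype.card_subtype_le light
  have hM0 : 0 < Nat.card {x // light x} := by
    rw [Nat.card_eq_fintype_card]; exact Fintype.card_pos_iff.2 ⟨⟨d, hd⟩⟩
  have hN0 : 0 < N := Nat.pos_of_ne_zero (NeZero.ne N)
  set M : ℝ := (Nat.card {x // light x} : ℝ) with hM
  have hMfin : (Fintype.card {x // light x} : ℝ) = M := by rw [hM, Nat.card_eq_fintype_card]
  have hM0' : 0 < M := by rw [hM]; exact_mod_cast hM0
  have hN0' : (0 : ℝ) < N := by exact_mod_cast hN0
  have hMN' : M ≤ N := by rw [hM]; exact_mod_cast hMN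
  set φ : ℝ := (1 - M / N) ^ U with hφ
  have hφ0 : 0 ≤ φ := by
    have : 0 ≤ 1 - M / N := by rw [sub_nonneg, div_le_one hN0']; exact hMN'
    positivity
  have hφ1 : φ ≤ (1 / 2) ^ (4 * lam) := by
    refine pow_dark_le hN0' hMN' ?_
    rw [hM]; exact_mod_cast hU
  have hmT' : 64 * ((t : ℝ) + 1) ^ 2 * g * m ≤ M := by rw [hM]; exact_mod_cast hmT
  have hm1 : (1 : ℝ) ≤ m := by exact_mod_cast hm
  have hg1 : (1 : ℝ) ≤ g := by exact_mod_cast hg0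
  -- The failure probability φ is at most 2^(-4·lam), whereas both 32mt and M are at most 2^(2·lam).
  have hMφ : 32 * (m * (t * (M * φ))) ≤ 1 := by
    have h1 : 32 * ((m : ℝ) * t) ≤ M := by
      refine le_trans ?_ hmT'
      have h2 : (t : ℝ) ≤ (t + 1) ^ 2 := by nlinarith [Nat.cast_nonneg (α := ℝ) t]
      calc 32 * ((m : ℝ) * t) ≤ 64 * ((m : ℝ) * (t + 1) ^ 2) := by gcongr; norm_num
        _ ≤ 64 * ((m : ℝ) * (t + 1) ^ 2) * g := le_mul_of_one_le_right (by positivity) hg1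
        _ = _ := by ring
    have h3 : M ≤ 2 ^ (2 * lam) := hMN'.trans (by exact_mod_cast hN.le)
    calc 32 * (m * (t * (M * φ))) = 32 * ((m : ℝ) * t) * M * φ := by ring
      _ ≤ 2 ^ (2 * lam) * 2 ^ (2 * lam) * (1 / 2) ^ (4 * lam) := by
        gcongr
        exact h1.trans h3
      _ = 1 := by
        rw [← pow_add, one_div, inv_pow, show 2 * lam + 2 * lam = 4 * lam by ring]
        exact mul_inv_cancel₀ (by positivity)
  have hφM : φ ≤ M * φ := by
    have : (1 : ℝ) ≤ M := by rw [hM]; exact_mod_cast hM0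
    nlinarith
  have hφle : φ ≤ 1 := hφ1.trans (pow_le_one₀ (by norm_num) (by norm_num))
  have hsel : ∀ x : {x // light x}, (Nat.card {c // sel c = x} : ℝ) * M =
      (1 - φ + if d = x then M * φ else 0) * Fintype.card (Fin U → Fin N) := by
    intro x
    have h := card_lastWith (d := d) x.2 U
    have e : Nat.card {c // sel c = x} = Nat.card {γ // lastWith light d U γ = x} := by
      refine Nat.card_congr (Equiv.subtypeEquivRight fun γ => ?_)
      simp only [sel, Subtype.ext_iff]
    rw [e, h]
    simp [hφ, hM]
  have hlo : ∀ x : {x // light x}, (1 - φ) / M * Fintype.card (Fin U → Fin N) ≤ Nat.card {c // sel c = x} := by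
    intro x
    rw [div_mul_eq_mul_div, div_le_iff₀ hM0', hsel x]
    gcongr
    split
    · have := mul_nonneg hM0'.le hφ0
      linarith
    · linarith
  have hhi : ∀ x : {x // light x}, (Nat.card {c // sel c = x} : ℝ) ≤ (1 + M * φ) / M * Fintype.card (Fin U → Fin N) := by
    intro x
    rw [div_mul_eq_mul_div, le_div_iff₀ hM0', hsel x]
    refine mul_le_mul_of_nonneg_right ?_ (Nat.cast_nonneg _)
    split
    · linarith
    · have := mul_nonneg hM0'.le hφ0
      linarith
  have hv : ∀ x y, v x = v y ↔ p x = p y ∧ q x = q y := by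
    intro x y
    simp only [p, q, Fin.mk.injEq]
    exact ⟨fun h => by rw [h]; exact ⟨rfl, rfl⟩, fun h => div_mod_injective hkr hk h.1 h.2⟩
  -- A row has k buckets with at most g light positions each; the same holds for a column, because
  -- all bucket numbers are below k·r.
  have hp : ∀ c, Nat.card {x // p x = c} ≤ k * g := by
    intro c
    simp only [p, Fin.ext_iff]
    refine (card_fiber_comp_le hg (fun w => w / k = c)
      ((Finset.range k).image fun j => c * k + j) fun x hx => ?_).trans
      (Nat.mul_le_mul_right _ (Finset.card_image_le.trans_eq (Finset.card_range k)))
    refine Finset.mem_image.2 ⟨v x % k, Finset.mem_range.2 (Nat.mod_lt _ hk), ?_⟩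
    rw [← hx, mul_comm]
    exact Nat.div_add_mod _ _
  have hq : ∀ c, Nat.card {x // q x = c} ≤ k * g := by
    intro c
    simp only [q, Fin.ext_iff]
    have h0 : ∀ x, v x % r = (c : ℕ) → v x ∈ (Finset.range k).image fun j => r * j + c := by
      intro x hx
      refine Finset.mem_image.2 ⟨v x / r, Finset.mem_range.2
        (Nat.div_lt_of_lt_mul ((hV x).trans_eq (mul_comm _ _))), ?_⟩
      rw [← hx]
      exact Nat.div_add_mod _ _
    exact (card_fiber_comp_le hg (fun w => w % r = c) _ h0).trans
      (Nat.mul_le_mul_right _ (Finset.card_image_le.trans_eq (Finset.card_range k)))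
  have hη : ((2 * ((t : ℝ) + 1)) ^ 3 * ((k * g : ℕ) : ℝ) ^ 2 +
      (2 * ((t : ℝ) + 1)) ^ 2 * (g * Fintype.card {x // light x}) : ℝ) ≤
      1 / (8 * m) * (Fintype.card {x // light x} : ℝ) ^ 2 := by
    rw [hMfin]
    have hρ' : 2 * ((t : ℝ) + 1) * ((k * g : ℕ) : ℝ) ^ 2 ≤ M * g := by
      rw [hM]; exact_mod_cast hρ
    generalize ((k * g : ℕ) : ℝ) = ρ at *
    rw [div_mul_eq_mul_div, one_mul, le_div_iff₀ (by positivity)]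
    have h1 : 64 * ((t : ℝ) + 1) ^ 2 * g * m * M ≤ M * M := by gcongr
    have h2 : 64 * ((t : ℝ) + 1) ^ 2 * m * (2 * ((t : ℝ) + 1) * ρ ^ 2) ≤
        64 * ((t : ℝ) + 1) ^ 2 * m * (M * g) := by gcongr
    linarith
  have hεa : 1 - 1 / (16 * (m : ℝ)) ≤ ((Fintype.card {x // light x} : ℝ) * ((1 - φ) / M)) ^ (2 * t) := by
    rw [hMfin, mul_div_cancel₀ _ hM0'.ne']
    have h1 := one_add_mul_le_pow (a := -φ) (by linarith) (2 * t)
    rw [← sub_eq_add_neg] at h1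
    refine le_trans ?_ h1
    have h2 : 2 * t * φ ≤ 1 / (16 * (m : ℝ)) := by
      rw [le_div_iff₀ (by positivity)]
      calc 2 * t * φ * (16 * m) ≤ 2 * t * (M * φ) * (16 * m) := by gcongr
        _ = 32 * (m * (t * (M * φ))) := by ring
        _ ≤ 1 := hMφ
    push_cast
    linarith
  have hεb : ((Fintype.card {x // light x} : ℝ) * ((1 + M * φ) / M)) ^ t ≤ 1 + 1 / (16 * (m : ℝ)) := by
    rw [hMfin, mul_div_cancel₀ _ hM0'.ne']
    have h0 : 0 ≤ M * φ := mul_nonneg hM0'.le hφ0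
    have h2 : 2 * (t * (M * φ)) ≤ 1 / (16 * (m : ℝ)) := by
      rw [le_div_iff₀ (by positivity)]
      linarith
    have h3 : 1 / (16 * (m : ℝ)) ≤ 1 := by
      rw [div_le_one (by positivity)]; linarith
    refine (pow_le_one_add_two_mul h0 (by linarith)).trans (by linarith)
  -- With ε = 1/(16m) and η = 1/(8m), the total loss (m + 1)(2ε + η) is (m + 1)/(4m) ≤ 1/2.
  obtain ⟨R, O, val, hO, hcov⟩ := exists_periodic_override (p := p) (q := q) (v := v) hv
    (sel := sel) (t := t) (div_nonneg (by linarith) hM0'.le)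
    (div_nonneg (by have := mul_nonneg hM0'.le hφ0; linarith) hM0'.le) hlo hhi hp hq
    (fun x => hg _) hη (by positivity) (ε := 1 / (16 * (m : ℝ))) (by positivity) hεa hεb hm
    (by
      have h2 : 2 * (1 / (16 * (m : ℝ))) + 1 / (8 * m) = 1 / (4 * m) := by field_simp; norm_num
      rw [h2, mul_one_div, div_le_iff₀ (by positivity)]
      linarith)
    (by rwa [← Nat.card_eq_fintype_card]) W
  -- Outside the r × U array the shifts are set to 0; such entries are never read.
  refine ⟨fun h u => if hh : h < r then (if hu : u < U then R.1 ⟨h, hh⟩ ⟨u, hu⟩ else 0) else 0,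
    fun h u => if hh : h < r then (if hu : u < U then R.2 ⟨h, hh⟩ ⟨u, hu⟩ else 0) else 0,
    O, val, hO, ?_⟩
  have hfun : (fun x => lightStep hd k r U
      (fun h u => if hh : h < r then (if hu : u < U then R.1 ⟨h, hh⟩ ⟨u, hu⟩ else 0) else 0)
      (fun h u => if hh : h < r then (if hu : u < U then R.2 ⟨h, hh⟩ ⟨u, hu⟩ else 0) else 0)
      O val (v x)) = override v O val (shiftMap p q sel R) := by
    funext x
    unfold lightStep override shiftMap
    by_cases hx : v x ∈ O
    · rw [if_pos hx, if_pos hx]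
    rw [if_neg hx, if_neg hx]
    simp only [sel]
    refine Subtype.ext ?_
    simp only
    congr 1
    funext u
    rw [dif_pos (Nat.div_lt_of_lt_mul (hV x)), dif_pos u.2, dif_pos (Nat.mod_lt _ hr), dif_pos u.2]
    rfl
  rw [hfun]
  convert hcov using 2
  rw [Nat.card_eq_fintype_card]

end OneTable

/-- Parameters of the tables. -/
theorem exists_parameters {n V g lam M : ℕ} (hn : 0 < n) (hg : 0 < g) (hlam : 0 < lam)
    (hVg : V * g ≤ 2 * (n * n + g)) (hg3 : 256 * g ^ 3 ≤ n * n) (hgn : 4 * g + 4 ≤ n)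
    (hmany : n * n ≤ M * g) (hMN : M ≤ n * n) : ∃ t s k m : ℕ, 0 < k ∧ k ≤ 8 * n ∧
      V ≤ k * (8 * n) ∧ 0 < m ∧ 64 * (t + 1) ^ 2 * g * m ≤ M ∧
      2 * (t + 1) * (k * g) ^ 2 ≤ M * g ∧ n * n * (4 * lam) ≤ M * (4 * lam * s) ∧
      2 * M ≤ m * (t + 1) * (256 * (t + 1) * g) ∧
      g * (512 * (t + 1) * g * lam * m) ≤ 8 * lam * (n * n) ∧
      512 * (t + 1) * g * lam * (t + 1) * (4 * lam * s + 1) ≤ 20480 * g ^ 3 * lam ^ 2 ∧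
      512 * (t + 1) * g * lam * (8 * n) * (4 * lam * s) ≤ 65536 * n * g ^ 2 * lam ^ 2 := by
  obtain ⟨N, hNdef⟩ : ∃ N, N = n * n := ⟨_, rfl⟩
  rw [← hNdef] at hVg hg3 hmany hMN ⊢
  have hN0 : 0 < N := by rw [hNdef]; positivity
  have hM0 : 0 < M := by
    rcases Nat.eq_zero_or_pos M with h | h
    · rw [h] at hmany; omega
    · exact h
  -- The walk length is the largest that row and column collisions allow, t + 1 ≈ gM/N. About s ≈
  -- N/M tries are needed per light candidate, k makes the grid hold V buckets, and m is the number
  -- of walks for which pairs still rarely collide. Then (t + 1)s = O(g), which gives the bounds on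
  -- time and shifts.
  obtain ⟨t, ht⟩ : ∃ t, t = g * M / N := ⟨_, rfl⟩
  obtain ⟨s, hs⟩ : ∃ s, s = N / M + 1 := ⟨_, rfl⟩
  obtain ⟨k, hk⟩ : ∃ k, k = V / (8 * n) + 1 := ⟨_, rfl⟩
  obtain ⟨m, hm⟩ : ∃ m, m = M / (64 * (t + 1) ^ 2 * g) := ⟨_, rfl⟩
  have hTN : (t + 1) * N ≤ 2 * (g * M) := by
    have h1 : t * N ≤ g * M := ht ▸ Nat.div_mul_le_self _ _
    nlinarith
  have hNT : g * M ≤ (t + 1) * N := by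
    rw [ht, mul_comm (_ + 1)]; exact (Nat.lt_mul_div_succ _ hN0).le
  have hsM : s * M ≤ 2 * N := by
    have h1 : N / M * M ≤ N := Nat.div_mul_le_self _ _
    rw [hs, add_mul, one_mul]
    omega
  have hMs : N ≤ M * s := by
    rw [hs]; exact (Nat.lt_mul_div_succ _ hM0).le
  have hT2g : t + 1 ≤ 2 * g := by
    refine Nat.le_of_mul_le_mul_right (hTN.trans ?_) hN0
    calc 2 * (g * M) ≤ 2 * (g * N) := by gcongr
      _ = _ := by ring
  have hTs : (t + 1) * s ≤ 4 * g := by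
    have h1 := Nat.mul_le_mul hTN hsM
    refine Nat.le_of_mul_le_mul_right (c := N * M) ?_ (by positivity)
    linarith
  have hkg : 2 * (k * g) ≤ n := by
    have h1 : V / (8 * n) * (8 * n) ≤ V := Nat.div_mul_le_self _ _
    have h2 : V / (8 * n) * (8 * n) * g ≤ 2 * (N + g) := (Nat.mul_le_mul_right _ h1).trans hVg
    have h3 : n * (4 * g + 4) ≤ n * n := Nat.mul_le_mul_left _ hgn
    refine Nat.le_of_mul_le_mul_right (c := 4 * n) ?_ (by positivity)
    have h4 : 2 * (k * g) * (4 * n) = V / (8 * n) * (8 * n) * g + 8 * (n * g) := by rw [hk]; ring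
    have h5 : g ≤ n * g := Nat.le_mul_of_pos_left _ hn
    rw [h4]
    rw [hNdef] at h2
    nlinarith
  -- This is where 256g³ ≤ N is used: it makes m positive.
  have hm0 : 64 * (t + 1) ^ 2 * g ≤ M := by
    refine Nat.le_of_mul_le_mul_right (c := N * N) ?_ (by positivity)
    calc 64 * (t + 1) ^ 2 * g * (N * N) = 64 * g * (((t + 1) * N) * ((t + 1) * N)) := by ring
      _ ≤ 64 * g * ((2 * (g * M)) * (2 * (g * M))) := by gcongr
      _ = 256 * g ^ 3 * (M * M) := by ring
      _ ≤ N * (M * N) := by gcongr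
      _ = _ := by ring
  have hmM : 64 * (t + 1) ^ 2 * g * m ≤ M := by rw [hm]; exact Nat.mul_div_le _ _
  have hm1 : 0 < m := by rw [hm]; exact Nat.div_pos hm0 (by positivity)
  refine ⟨t, s, k, m, by rw [hk]; exact Nat.succ_pos _, ?_, ?_, hm1, hmM, ?_, ?_, ?_, ?_, ?_, ?_⟩
  · have : k ≤ k * g := Nat.le_mul_of_pos_right _ hg
    omega
  · rw [hk, mul_comm]; exact (Nat.lt_mul_div_succ _ (by positivity)).le
  · have h1 : 2 * (k * g) * (2 * (k * g)) ≤ N := hNdef ▸ Nat.mul_le_mul hkg hkg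
    have h2 := Nat.mul_le_mul_left (t + 1) h1
    linarith
  · calc N * (4 * lam) ≤ M * s * (4 * lam) := by gcongr
      _ = _ := by ring
  · have h1 : M < 64 * (t + 1) ^ 2 * g * (m + 1) := by
      rw [hm]; exact Nat.lt_mul_div_succ _ (by positivity)
    have h2 : 64 * (t + 1) ^ 2 * g * 1 ≤ 64 * (t + 1) ^ 2 * g * m := by gcongr; exact hm1
    linarith
  · have h1 : 64 * (t + 1) * g ^ 2 * m ≤ N := by
      refine Nat.le_of_mul_le_mul_left (c := t + 1) ?_ (by positivity)
      calc (t + 1) * (64 * (t + 1) * g ^ 2 * m) = g * (64 * (t + 1) ^ 2 * g * m) := by ring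
        _ ≤ g * M := by gcongr
        _ ≤ _ := hNT
    calc g * (512 * (t + 1) * g * lam * m) = 8 * lam * (64 * (t + 1) * g ^ 2 * m) := by ring
      _ ≤ _ := by gcongr
  · have h1 : 1 ≤ lam * s := Nat.mul_pos hlam (by rw [hs]; exact Nat.succ_pos _)
    calc 512 * (t + 1) * g * lam * (t + 1) * (4 * lam * s + 1)
        ≤ 512 * (t + 1) * g * lam * (t + 1) * (4 * lam * s + lam * s) := by gcongr
      _ = 2560 * g * lam ^ 2 * (t + 1) * ((t + 1) * s) := by ring
      _ ≤ 2560 * g * lam ^ 2 * (2 * g) * (4 * g) := by gcongr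
      _ = _ := by ring
  · calc 512 * (t + 1) * g * lam * (8 * n) * (4 * lam * s)
        = 16384 * n * g * lam ^ 2 * ((t + 1) * s) := by ring
      _ ≤ 16384 * n * g * lam ^ 2 * (4 * g) := by gcongr
      _ = _ := by ring

open Classical in
/-- If many positions are light, walks reach them. -/
theorem exists_tables_of_many {n V g lam : ℕ} (hn : 0 < n) (hg : 0 < g)
    (hlam : 0 < lam) {light : Fin (n * n) → Prop} {bk : Fin (n * n) → ℕ} (hbk : ∀ x, bk x < V)
    (hle : ∀ v, Nat.card {x // light x ∧ bk x = v} ≤ g) (hN : n * n < 2 ^ (2 * lam))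
    (hVg : V * g ≤ 2 * (n * n + g)) (hg3 : 256 * g ^ 3 ≤ n * n) (hgn : 4 * g + 4 ≤ n)
    (hmany : n * n ≤ Nat.card {x // light x} * g) :
    ∃ τ : Tables (n * n), τ.Good light bk V g lam := by
  have : NeZero (n * n) := ⟨by positivity⟩
  have hMN : Nat.card {x // light x} ≤ n * n := by
    rw [Nat.card_eq_fintype_card]
    simpa using Fintype.card_subtype_le light
  have hM0 : 0 < Nat.card {x // light x} := by
    rcases Nat.eq_zero_or_pos (Nat.card {x // light x}) with h | h
    · rw [h, zero_mul] at hmany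
      exact absurd hmany (by have : 0 < n * n := by positivity
                             omega)
    · exact h
  obtain ⟨⟨d, hd⟩⟩ : Nonempty {x // light x} := (Nat.card_pos_iff.1 hM0).1
  obtain ⟨t, s, k, m, hk, hkr, hV, hm, h1, h2, h3, h4, h5, h6, h7⟩ :=
    exists_parameters hn hg hlam hVg hg3 hgn hmany hMN
  let v : {x // light x} → ℕ := fun x => bk x
  have hgv : ∀ c, Nat.card {x // v x = c} ≤ g := by
    intro c
    refine le_trans (le_of_eq ?_) (hle c)
    exact Nat.card_congr (Equiv.subtypeSubtypeEquivSubtypeInter light fun x => bk x = c)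
  have hone := exists_periodic_lightStep hd (v := v) hk hkr (fun x => (hbk x).trans_le hV) hg hgv hm
    h1 h2 h3 hN
  let Tb := (ℕ → ℕ → Fin (n * n)) × (ℕ → ℕ → Fin (n * n)) × {O : Finset ℕ // O.card ≤ m} ×
    (ℕ → {x // light x})
  let F : Tb → ℕ → {x // light x} := fun τ =>
    lightStep hd k (8 * n) (4 * lam * s) τ.1 τ.2.1 τ.2.2.1 τ.2.2.2
  -- By `h4`, one table covers a fraction 1/Q of any set, with Q = 256(t + 1)g, and 2^(2·lam)
  -- exceeds the number of positions.
  obtain ⟨τ, hτ⟩ := exists_cover (Tb := Tb) (X := {x // light x}) (Q := 256 * (t + 1) * g)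
    (l := 2 * lam) (cov := fun τ x => (fun x => F τ (v x))^[t + 1] x = x) (by positivity)
    (fun W => by
      obtain ⟨row, col, O, val, hO, h⟩ := hone W
      refine ⟨⟨row, col, ⟨O, hO⟩, val⟩, ?_⟩
      refine Nat.le_of_mul_le_mul_left (h.trans ?_) (Nat.mul_pos hm t.succ_pos)
      rw [← mul_assoc]
      exact Nat.mul_le_mul_right _ h4)
    (by rw [← Nat.card_eq_fintype_card]; exact hMN.trans_lt hN)
  have hQ : 256 * (t + 1) * g * (2 * lam) = 512 * (t + 1) * g * lam := by ring
  rw [hQ] at hτ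
  refine ⟨⟨512 * (t + 1) * g * lam, t + 1, 4 * lam * s, k, 8 * n, d, fun i => (τ i).1,
    fun i => (τ i).2.1, fun i => (τ i).2.2.1.1.filter (· < V), fun i v => (τ i).2.2.2 v⟩,
    ?_, by positivity, hV, ?_, ?_, t.succ_pos, by positivity, by simp only; omega, le_rfl, h6, h7⟩
  · intro x hx
    obtain ⟨i, hi, h⟩ := hτ ⟨x, hx⟩
    refine ⟨i, hi, t, t.lt_succ_self, ?_⟩
    rw [iterate_comp_succ (F (τ i)) v] at h
    set st := fun w => Tables.step (N := n * n) ⟨512 * (t + 1) * g * lam, t + 1, 4 * lam * s, k,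
      8 * n, d, fun i => (τ i).1, fun i => (τ i).2.1, fun i => (τ i).2.2.1.1.filter (· < V),
      fun i v => (τ i).2.2.2 v⟩ light i w with hst
    -- The overrides were filtered to buckets below V so that keys are unambiguous. Walks never
    -- leave these buckets, so the filter has no effect on them.
    have hstep : ∀ w < V, st w = F (τ i) w := by
      intro w hw
      simp only [hst, F, Tables.step, lightStep, Finset.mem_filter, hw, and_true]
      split_ifs <;> rfl
    have hiter : ∀ j, (fun w => bk (st w))^[j] (bk x) = (fun w => v (F (τ i) w))^[j] (bk x) ∧
        (fun w => bk (st w))^[j] (bk x) < V := by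
      intro j
      induction j with
      | zero => exact ⟨rfl, hbk x⟩
      | succ j ih =>
        rw [Function.iterate_succ_apply', Function.iterate_succ_apply', ← ih.1]
        refine ⟨?_, hbk _⟩
        simp only [v, hstep _ ih.2]
    have h' := congrArg Subtype.val h
    simp only [v] at h'
    change st ((fun w => bk (st w))^[t] (bk x)) = x
    rw [hstep _ (hiter t).2, (hiter t).1]
    exact h'
  · intro i w hw
    exact (Finset.mem_filter.1 hw).2
  · refine le_trans (Nat.mul_le_mul_left _ ?_) h5
    refine (Finset.sum_le_card_nsmul _ _ m fun i _ => ?_).trans_eq (by simp)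
    exact (Finset.card_filter_le _ _).trans (τ i).2.2.1.2

/-- Tables for positions with small buckets. -/
theorem exists_tables {n V g lam : ℕ} (hn : 0 < n) (hg : 0 < g)
    (hlam : 0 < lam) {light : Fin (n * n) → Prop} {bk : Fin (n * n) → ℕ} (hbk : ∀ x, bk x < V)
    (hle : ∀ v, Nat.card {x // light x ∧ bk x = v} ≤ g) (hN : n * n < 2 ^ (2 * lam))
    (hVg : V * g ≤ 2 * (n * n + g)) (hg3 : 256 * g ^ 3 ≤ n * n) (hgn : 4 * g + 4 ≤ n) :
    ∃ τ : Tables (n * n), τ.Good light bk V g lam := by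
  rcases lt_or_ge (Nat.card {x // light x} * g) (n * n) with h | h
  · exact exists_tables_of_few hn hg hlam hbk hle h
  · exact exists_tables_of_many hn hg hlam hbk hle hN hVg hg3 hgn h

/-! ### Pivots and sorted arrays -/

theorem sortedIndex_of_le {a : ℕ → ℕ} {B y : ℕ} (h0 : a 0 ≤ y) :
    a (sortedIndex a B y) ≤ y :=
  Nat.findGreatest_spec (P := fun i => a i ≤ y) (Nat.zero_le _) h0

theorem lt_of_sortedIndex_lt {a : ℕ → ℕ} {B y i : ℕ} (h : sortedIndex a B y < i)
    (hi : i < 2 ^ B) : y < a i :=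
  lt_of_not_ge (Nat.findGreatest_is_greatest (P := fun i => a i ≤ y) h (by omega))

theorem le_sortedIndex {a : ℕ → ℕ} {B y i : ℕ} (h : a i ≤ y) (hi : i < 2 ^ B) :
    i ≤ sortedIndex a B y :=
  Nat.le_findGreatest (P := fun i => a i ≤ y) (by omega) h

theorem pow_clog_le (a : ℕ) : 2 ^ Nat.clog 2 (a + 1) ≤ 2 * (a + 1) := by
  rcases Nat.eq_zero_or_pos a with rfl | ha
  · simp
  · have h := Nat.pow_pred_clog_lt_self (b := 2) (x := a + 1) one_lt_two (by omega)
    have h2 : 0 < Nat.clog 2 (a + 1) := Nat.clog_pos one_lt_two (by omega)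
    obtain ⟨c, hc⟩ := Nat.exists_eq_succ_of_ne_zero h2.ne'
    rw [hc] at h ⊢
    rw [Nat.pred_succ] at h
    rw [pow_succ]
    omega

/-- Every `g`-th value of a function, in increasing order, as pivots. -/
theorem exists_pivots {N : ℕ} (hN : 0 < N) (f : Fin N → ℕ) {g : ℕ} (hg : 0 < g) :
    ∃ (B : ℕ) (p : ℕ → ℕ), Monotone p ∧ (∀ i, ∃ x, p i = f x) ∧ 2 ^ B * g ≤ 2 * (N + g) ∧
      ∀ v, Nat.card {x // p (sortedIndex p B (f x)) ≠ f x ∧ sortedIndex p B (f x) = v} ≤ g - 1 := by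
  classical
  -- Ranks beyond the end are capped, because the array is padded to a power of two.
  let e : ℕ → Fin N := fun i => ⟨min (i * g) (N - 1), by omega⟩
  have he : Monotone e := fun i j hij => by
    simp only [e, Fin.mk_le_mk]
    have := Nat.mul_le_mul_right g hij
    omega
  have hmono := Tuple.monotone_sort f
  set σ := Tuple.sort f with hσ
  let p : ℕ → ℕ := fun i => f (σ (e i))
  have hp : Monotone p := fun i j hij => hmono (he hij)
  set B := Nat.clog 2 (N / g + 1) with hB
  have hV : N < 2 ^ B * g := by
    have h1 : N / g + 1 ≤ 2 ^ B := Nat.le_pow_clog one_lt_two _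
    exact (Nat.lt_mul_div_succ N hg).trans_le (by rw [mul_comm]; exact Nat.mul_le_mul_right _ h1)
  refine ⟨B, p, hp, fun i => ⟨_, rfl⟩, ?_, fun v => ?_⟩
  · have h1 : 2 ^ B ≤ 2 * (N / g + 1) := pow_clog_le _
    have h2 : N / g * g ≤ N := Nat.div_mul_le_self _ _
    calc 2 ^ B * g ≤ 2 * (N / g + 1) * g := Nat.mul_le_mul_right _ h1
      _ = 2 * (N / g * g + g) := by ring
      _ ≤ _ := by omega
  · rw [Nat.subtype_card (Finset.univ.filter fun x =>
      p (sortedIndex p B (f x)) ≠ f x ∧ sortedIndex p B (f x) = v) (by simp)]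
    -- A light position of bucket v has sorted rank strictly between vg and (v + 1)g: its value lies
    -- above pivot v and below the next one.
    have hcard : (Finset.Ioo (v * g) (v * g + g)).card = g - 1 := by
      rw [Nat.card_Ioo]; omega
    rw [← hcard]
    refine Finset.card_le_card_of_injOn (fun x => ((σ.symm x : Fin N) : ℕ)) ?_ ?_
    · intro x hx
      obtain ⟨hne, rfl⟩ := (Finset.mem_filter.1 hx).2
      obtain ⟨s, rfl⟩ := σ.surjective x
      set v := sortedIndex p B (f (σ s)) with hv
      have h0 : p 0 ≤ f (σ s) := by
        refine hmono ?_
        simp [e, Fin.le_def]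
      have h1 : p v < f (σ s) := lt_of_le_of_ne (sortedIndex_of_le h0) hne
      have h2 : e v < s := lt_of_not_ge fun h => (hmono h).not_gt h1
      have h2' : min (v * g) (N - 1) < (s : ℕ) := h2
      have hs := s.2
      simp only [Equiv.symm_apply_apply, Finset.coe_Ioo, Set.mem_Ioo]
      refine ⟨by omega, ?_⟩
      by_cases hvV : v + 1 < 2 ^ B
      · have h3 : f (σ s) < p (v + 1) := lt_of_sortedIndex_lt (by rw [← hv]; exact v.lt_succ_self) hvV
        have h4 : s < e (v + 1) := lt_of_not_ge fun h => (hmono h).not_gt h3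
        have h4' : (s : ℕ) < min ((v + 1) * g) (N - 1) := h4
        rw [add_mul, one_mul] at h4'
        omega
      -- The last bucket has no next pivot, but 2^B·g exceeds N and thus every rank.
      · have h3 := sortedIndex_lt p B (f (σ s))
        have h4 : v + 1 = 2 ^ B := by omega
        rw [← h4, add_mul, one_mul] at hV
        omega
    · intro x _ y _ hxy
      exact σ.symm.injective (Fin.ext hxy)

/-- A finite set as a padded increasing sequence. -/
theorem exists_sorted (S : Finset ℕ) {pad : ℕ} (hS : ∀ κ ∈ S, κ < pad) :
    ∃ (B : ℕ) (a : ℕ → ℕ), Monotone a ∧ (∀ j, a j ≤ pad) ∧ 2 ^ B ≤ 2 * (S.card + 1) ∧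
      ∀ κ < pad, (a (sortedIndex a B κ) = κ ↔ κ ∈ S) := by
  -- The padding exceeds every key and every key that is asked for, so a search cannot mistake it
  -- for a hit.
  let a : ℕ → ℕ := fun j => if h : j < S.card then S.orderEmbOfFin rfl ⟨j, h⟩ else pad
  have ha : ∀ j, a j ∈ S ∨ a j = pad := fun j => by
    simp only [a]
    split
    · exact Or.inl (Finset.orderEmbOfFin_mem _ _ _)
    · exact Or.inr rfl
  have hle : ∀ j, a j ≤ pad := fun j => (ha j).elim (fun h => (hS _ h).le) fun h => h.le
  have hmono : Monotone a := by
    intro i j hij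
    by_cases hj : j < S.card
    · have hi : i < S.card := by omega
      simp only [a, hi, hj, dif_pos]
      exact (S.orderEmbOfFin rfl).monotone hij
    · have : a j = pad := dif_neg hj
      rw [this]
      exact hle i
  refine ⟨Nat.clog 2 (S.card + 1), a, hmono, hle, pow_clog_le _, fun κ hκ => ⟨fun h => ?_, fun h => ?_⟩⟩
  · rcases ha (sortedIndex a (Nat.clog 2 (S.card + 1)) κ) with h' | h'
    · rwa [h] at h'
    · omega
  · obtain ⟨j, hj⟩ : κ ∈ Set.range (S.orderEmbOfFin rfl) := by
      rw [Finset.range_orderEmbOfFin]; exact h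
    have hj' : a j = κ := by simp only [a, j.2, dif_pos]; exact hj
    have hjB : (j : ℕ) < 2 ^ Nat.clog 2 (S.card + 1) :=
      (j.2.trans (Nat.lt_succ_self _)).trans_le (Nat.le_pow_clog one_lt_two _)
    refine le_antisymm (sortedIndex_of_le ((hmono (Nat.zero_le j)).trans hj'.le)) ?_
    conv_lhs => rw [← hj']
    exact hmono (le_sortedIndex hj'.le hjB)

/-! ### From tables to memory contents -/

namespace Tables

variable {n : ℕ}

/-- The memory contents for given tables, bucket bits, lists, pivots and sorted keys. -/
def layout (τ : Tables (n * n)) (B B' : ℕ) (fst snd piv keys : ℕ → ℕ) : Layout :=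
  let D : Layout :=
    { n := n, B := B, B' := B', tables := τ.tables, walk := τ.walk, tries := τ.tries, k := τ.k
      r := τ.r, dflt := τ.dflt, size := n + 2 ^ B + 2 ^ B' + τ.tables * τ.r * τ.tries + 16
      arr := fun _ _ => 0 }
  { D with
    arr := fun
      | 0 => D.header
      | 1 => fst
      | 2 => snd
      | 3 => piv
      | 4 => keys
      | 5 => fun j => τ.target (keys j / 2 ^ B) (keys j % 2 ^ B)
      | 6 => fun j => τ.row (j / τ.tries / τ.r) (j / τ.tries % τ.r) (j % τ.tries)
      | 7 => fun j => τ.col (j / τ.tries / τ.r) (j / τ.tries % τ.r) (j % τ.tries)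
      | _ => fun _ => 0 }

variable {τ : Tables (n * n)} {B B' : ℕ} {fst snd piv keys : ℕ → ℕ} {m : RomMachine}

theorem decode_index {i h u r U : ℕ} (hh : h < r) (hu : u < U) :
    ((i * r + h) * U + u) / U / r = i ∧ ((i * r + h) * U + u) / U % r = h ∧
      ((i * r + h) * U + u) % U = u := by
  have hU : 0 < U := by omega
  have hr : 0 < r := by omega
  have h1 : ((i * r + h) * U + u) / U = i * r + h := by
    rw [mul_comm, Nat.mul_add_div hU, Nat.div_eq_of_lt hu, add_zero]
  have h2 : (i * r + h) / r = i := by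
    rw [mul_comm, Nat.mul_add_div hr, Nat.div_eq_of_lt hh, add_zero]
  refine ⟨by rw [h1, h2], ?_, ?_⟩
  · rw [h1, mul_comm i, Nat.mul_add_mod, Nat.mod_eq_of_lt hh]
  · rw [mul_comm _ U, Nat.mul_add_mod, Nat.mod_eq_of_lt hu]

/-- The step computed from the arrays is the abstract step of the table. Addition in `Fin (n * n)`
is the reduction modulo n² in `cand`, and `scan` and `lastWith` have the same recursion. -/
theorem layout_next [NeZero (n * n)] (light : Fin (n * n) → Prop)
    (hlight : ∀ x : Fin (n * n), light x ↔
      (τ.layout B B' fst snd piv keys).Light ((τ.layout B B' fst snd piv keys).val m x))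
    (hle : 2 ^ B ≤ τ.k * τ.r) (hr : 0 < τ.r)
    (hkeys : ∀ i < τ.tables, ∀ v < 2 ^ B,
      (keys (sortedIndex keys B' (i * 2 ^ B + v)) = i * 2 ^ B + v ↔ v ∈ τ.keys i))
    {i v : ℕ} (hi : i < τ.tables) (hv : v < 2 ^ B) :
    (τ.layout B B' fst snd piv keys).next m i v = τ.step light i v := by
  set D := τ.layout B B' fst snd piv keys with hD
  have hslot : D.slot i v = sortedIndex keys B' (i * 2 ^ B + v) := rfl
  have hcand : ∀ u < τ.tries, D.cand i v u =
      (τ.row i (v / τ.k) u + τ.col i (v % τ.r) u : Fin (n * n)) := by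
    intro u hu
    obtain ⟨a1, a2, a3⟩ := decode_index (i := i)
      (Nat.div_lt_of_lt_mul (hv.trans_le hle)) hu
    obtain ⟨b1, b2, b3⟩ := decode_index (i := i) (Nat.mod_lt v hr) hu
    have e : D.cand i v u = ((τ.row (((i * τ.r + v / τ.k) * τ.tries + u) / τ.tries / τ.r)
      (((i * τ.r + v / τ.k) * τ.tries + u) / τ.tries % τ.r)
      (((i * τ.r + v / τ.k) * τ.tries + u) % τ.tries) : ℕ) +
      (τ.col (((i * τ.r + v % τ.r) * τ.tries + u) / τ.tries / τ.r)
      (((i * τ.r + v % τ.r) * τ.tries + u) / τ.tries % τ.r)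
      (((i * τ.r + v % τ.r) * τ.tries + u) % τ.tries) : ℕ)) % (n * n) := rfl
    rw [e, a1, a2, a3, b1, b2, b3, Fin.val_add]
  have hscan : ∀ u ≤ τ.tries, D.scan m i v u =
      lastWith light τ.dflt u fun u => τ.row i (v / τ.k) u + τ.col i (v % τ.r) u := by
    intro u
    induction u with
    | zero => exact fun _ => rfl
    | succ u ih =>
      intro hu
      rw [Layout.scan, lastWith]
      have hl : light (τ.row i (v / τ.k) u + τ.col i (v % τ.r) u) ↔
          D.Light (D.val m (D.cand i v u)) := by rw [hlight, hcand u hu]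
      simp only [Fin.val_last]
      by_cases h1 : D.Light (D.val m (D.cand i v u))
      · rw [if_pos h1, if_pos (hl.2 h1), hcand u hu]
      · rw [if_neg h1, if_neg (fun h => h1 (hl.1 h)), ih (by omega)]
        rfl
  rw [Layout.next, step]
  have hkey : D.key i v = i * 2 ^ B + v := rfl
  have harr : ∀ j, D.arr 4 j = keys j := fun _ => rfl
  have h5 : ∀ j, D.arr 5 j = τ.target (keys j / 2 ^ B) (keys j % 2 ^ B) := fun _ => rfl
  rw [hslot, hkey, harr, h5]
  by_cases h : v ∈ τ.keys i
  · have h' := (hkeys i hi v hv).2 h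
    rw [if_pos h, if_pos h', h', mul_comm i, Nat.mul_add_div (by positivity), Nat.div_eq_of_lt hv,
      add_zero, Nat.mul_add_mod, Nat.mod_eq_of_lt hv]
  · rw [if_neg h, if_neg (fun h' => h ((hkeys i hi v hv).1 h'))]
    exact hscan _ le_rfl

end Tables

/-- Bounds that hold for words of sufficient length. -/
theorem lt_two_pow_of_le {lam w x : ℕ} (hlam : 0 < lam) (hw : 64 * lam ≤ w)
    (hx : x ≤ 2 ^ 20 * (2 ^ lam) ^ 7) : x < 2 ^ w := by
  refine hx.trans_lt ?_
  rw [← pow_mul, ← pow_add]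
  exact Nat.pow_lt_pow_right one_lt_two (by omega)

/-- The pair of a table and a bucket is determined by its key. -/
theorem mem_keySet {τ : ℕ → Finset ℕ} {ℓ V i v : ℕ} (hτ : ∀ i, ∀ v ∈ τ i, v < V) (hi : i < ℓ)
    (hv : v < V) : i * V + v ∈ (Finset.range ℓ).biUnion (fun i => (τ i).image (i * V + ·)) ↔
      v ∈ τ i := by
  simp only [Finset.mem_biUnion, Finset.mem_range, Finset.mem_image]
  refine ⟨?_, fun h => ⟨i, hi, v, h, rfl⟩⟩
  rintro ⟨i', -, v', hv', h⟩
  have h1 := hτ _ _ hv'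
  have hV : 0 < V := by omega
  have e1 := congrArg (· / V) h
  have e2 := congrArg (· % V) h
  simp only [mul_comm _ V, Nat.mul_add_div hV, Nat.mul_add_mod, Nat.div_eq_of_lt h1,
    Nat.div_eq_of_lt hv, Nat.mod_eq_of_lt h1, Nat.mod_eq_of_lt hv, add_zero] at e1 e2
  subst e1 e2
  exact hv'

/-- The machine whose memory contains a layout. -/
def Layout.machine (D : Layout) {w : ℕ} (plus : BitVec w → BitVec w → BitVec w)
    (h : 8 * D.size ≤ 2 ^ w) : RomMachine where
  w := w
  M := 8 * D.size
  plus := plus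
  mem a := D.arr (a % 8) (a / 8)
  le_pow := h

theorem Layout.fits_machine {D : Layout} {w : ℕ} {plus : BitVec w → BitVec w → BitVec w}
    {h : 8 * D.size ≤ 2 ^ w} (hw : 0 < w) (hs : 16 ≤ D.size) (hh : ∀ i, D.arr 0 i = D.header i)
    (hlt : ∀ i, D.header i < 2 ^ w) : D.Fits (D.machine plus h) where
  size_eq := rfl
  mem_eq i j hj := by
    have h1 : (i * 8 + j) % 8 = j := by omega
    have h2 : (i * 8 + j) / 8 = i := by omega
    simp only [Layout.machine, h1, h2]
  header_eq i _ := hh i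
  le_size := hs
  w_pos := hw
  header_lt := hlt

theorem Layout.answers {D : Layout} {w n : ℕ} {U : Type} [Add U] {enc : U → BitVec w}
    {plus : BitVec w → BitVec w → BitVec w} {A B : Fin n → U} {h : 8 * D.size ≤ 2 ^ w}
    (hF : D.Fits (D.machine plus h)) (hV : 0 < D.n → D.Valid w)
    (hiff : ∀ c, (0 < D.n ∧ D.Finds (D.machine plus h) (enc c).toNat) ↔ ∃ i j, A i + B j = c)
    {t : ℕ} (ht : ((11 * D.B' + (11 * D.B + 41) * D.tries + 11 * D.B + 62) * D.walk + 7) * D.tables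
        + 11 * D.B + 54 ≤ t) :
    AnswersThreeSumQueries enc plus A B queryProgram (8 * D.size) t := by
  classical
  -- The program never stores, so a single memory content is invariant.
  refine ⟨{(D.machine plus h).words}, Set.singleton_nonempty _, ?_⟩
  rintro σ rfl c
  refine ⟨_, _, ramRun_mono ht
    (RomMachine.run_queryProgram (m := D.machine plus h) hF hV rfl (enc c)),
    rfl, ?_⟩
  rw [decide_eq_true_iff]
  exact hiff c

theorem Layout.header_lt_of {D : Layout} {w : ℕ} (h1 : D.n < 2 ^ w) (h2 : D.n * D.n < 2 ^ w)
    (h3 : 2 ^ D.B < 2 ^ w) (h4 : 2 ^ D.B' < 2 ^ w) (h5 : D.tables < 2 ^ w) (h6 : D.walk < 2 ^ w)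
    (h7 : D.tries < 2 ^ w) (h8 : D.k < 2 ^ w) (h9 : D.r < 2 ^ w) (h10 : D.dflt < 2 ^ w)
    (h11 : 8 < 2 ^ w) (i : ℕ) : D.header i < 2 ^ w := by
  unfold Layout.header
  split
  any_goals omega
  · exact Nat.lt_two_pow_self.trans h3
  · exact Nat.lt_two_pow_self.trans h4

theorem answers_of_empty {w : ℕ} (hw : 64 ≤ w) {U : Type} [Add U] {enc : U → BitVec w}
    {plus : BitVec w → BitVec w → BitVec w} (A B : Fin 0 → U) {t : ℕ} (ht : 54 ≤ t) :
    AnswersThreeSumQueries enc plus A B queryProgram 128 t := by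
  have hpow : 2 ^ 64 ≤ 2 ^ w := Nat.pow_le_pow_right two_pos hw
  let E : Layout :=
    { n := 0, B := 0, B' := 0, tables := 0, walk := 0, tries := 0, k := 0, r := 0, dflt := 0
      size := 16, arr := fun _ _ => 0 }
  let D : Layout := { E with arr := fun _ => E.header }
  have h : 8 * D.size ≤ 2 ^ w := le_trans (by norm_num [D, E]) hpow
  refine Layout.answers (D := D) (h := h) (Layout.fits_machine (by omega) le_rfl (fun _ => rfl) ?_)
    (fun h => absurd h (lt_irrefl _)) (fun c => ?_) (by simpa [D, E] using ht)
  · exact Layout.header_lt_of (by positivity) (by positivity) (by simp [D, E]; omega)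
      (by simp [D, E]; omega) (by positivity) (by positivity) (by positivity) (by positivity)
      (by positivity) (by positivity) (by omega)
  · exact ⟨fun h => absurd h.1 (lt_irrefl _), fun ⟨i, _⟩ => i.elim0⟩

/-- Bounds for the sizes of the components of a memory. -/
theorem size_bounds {n g lam L b b' s : ℕ} (hn : 0 < n) (hg : 0 < g) (hgn : g ≤ n) (hlam : 0 < lam)
    (hnL : n ≤ L) (hlamL : lam ≤ L) (hb : b * g ≤ 2 * (n * n + g)) (hb' : g * b' ≤ 16 * lam * (n * n) + 2 * g)
    (hs : s ≤ 65536 * n * g ^ 2 * lam ^ 2) :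
    b ≤ 4 * L ^ 2 ∧ b' ≤ 18 * L ^ 3 ∧ s ≤ 65536 * L ^ 5 ∧
      g * (8 * (n + b + b' + s + 16)) ≤ 600000 * (lam * n ^ 2 + n * g ^ 3 * lam ^ 2) := by
  have hgL : g ≤ L := hgn.trans hnL
  have hL : 0 < L := hn.trans_le hnL
  have h1 : g ≤ n * n := hgn.trans (Nat.le_mul_of_pos_left _ hn)
  have h2 : n * n ≤ lam * n ^ 2 := by rw [sq]; exact Nat.le_mul_of_pos_left _ hlam
  have h3 : g * n ≤ n * n := Nat.mul_le_mul_right _ hgn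
  refine ⟨?_, ?_, hs.trans ?_, ?_⟩
  · calc b ≤ b * g := Nat.le_mul_of_pos_right _ hg
      _ ≤ 4 * (n * n) := by omega
      _ ≤ 4 * (L * L) := by gcongr
      _ = _ := by ring
  · calc b' ≤ g * b' := Nat.le_mul_of_pos_left _ hg
      _ ≤ 16 * (lam * n ^ 2) + 2 * (lam * n ^ 2) := by nlinarith
      _ = 18 * (lam * n ^ 2) := by ring
      _ ≤ 18 * (L * L ^ 2) := by gcongr
      _ = _ := by ring
  · calc _ ≤ 65536 * L * L ^ 2 * L ^ 2 := by gcongr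
      _ = _ := by ring
  · have h4 : g * s ≤ 65536 * (n * g ^ 3 * lam ^ 2) := by
      calc g * s ≤ g * (65536 * n * g ^ 2 * lam ^ 2) := Nat.mul_le_mul_left _ hs
        _ = _ := by ring
    have e : g * (8 * (n + b + b' + s + 16)) =
        8 * (g * n + b * g + g * b' + g * s + 16 * g) := by ring
    have e2 : 16 * lam * (n * n) = 16 * (lam * n ^ 2) := by ring
    rw [e, mul_add 600000]
    rw [e2] at hb'
    omega

theorem time_bound {g lam B B' ℓ T U : ℕ} (hlam : 0 < lam) (hℓ : 0 < ℓ) (hT : 0 < T)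
    (hB : B ≤ 8 * lam) (hB' : B' ≤ 8 * lam) (h : ℓ * T * (U + 1) ≤ 20480 * g ^ 3 * lam ^ 2) :
    ((11 * B' + (11 * B + 41) * U + 11 * B + 62) * T + 7) * ℓ + 11 * B + 54 ≤
      10000000 * g ^ 3 * lam ^ 3 := by
  have h1 : 11 * B' + (11 * B + 41) * U + 11 * B + 62 ≤ 250 * lam * (U + 1) := by
    have : (11 * B + 41) * U ≤ (129 * lam) * U := Nat.mul_le_mul_right _ (by omega)
    nlinarith
  have h2 : 1 ≤ ℓ * T * (U + 1) := Nat.mul_pos (Nat.mul_pos hℓ hT) U.succ_pos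
  have h3 : ℓ ≤ ℓ * T * (U + 1) := by rw [mul_assoc]; exact Nat.le_mul_of_pos_right _ (by positivity)
  calc _ ≤ ((250 * lam * (U + 1)) * T + 7) * ℓ + 11 * B + 54 := by gcongr
    _ = 250 * lam * (ℓ * T * (U + 1)) + 7 * ℓ + 11 * B + 54 := by ring
    _ ≤ 250 * lam * (ℓ * T * (U + 1)) + 7 * lam * (ℓ * T * (U + 1)) + 142 * lam * (ℓ * T * (U + 1)) := by
      have h4 : 7 * ℓ ≤ 7 * lam * (ℓ * T * (U + 1)) := by
        calc 7 * ℓ = 7 * 1 * ℓ := by ring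
          _ ≤ _ := by gcongr; exact hlam
      have h5 : 142 * lam * 1 ≤ 142 * lam * (ℓ * T * (U + 1)) := Nat.mul_le_mul_left _ h2
      omega
    _ = 399 * lam * (ℓ * T * (U + 1)) := by ring
    _ ≤ 399 * lam * (20480 * g ^ 3 * lam ^ 2) := by gcongr
    _ = 8171520 * (g ^ 3 * lam ^ 3) := by ring
    _ ≤ 10000000 * (g ^ 3 * lam ^ 3) := by gcongr; norm_num
    _ = _ := by ring

/-! ### Solutions for a given parameter -/

/-- The three sum indexing problem is solved with parameter `g`. -/
theorem exists_answers {n g w : ℕ} (hn : 0 < n) (hw : 64 * (Nat.log 2 n + 1) ≤ w) (hg : 0 < g)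
    (hgc : g = 1 ∨ 256 * g ^ 3 ≤ n * n ∧ 4 * g + 4 ≤ n) {U : Type} [Add U] (enc : U ↪ BitVec w)
    {plus : BitVec w → BitVec w → BitVec w} (hplus : ∀ x y : U, plus (enc x) (enc y) = enc (x + y))
    (A B : Fin n → U) : ∃ M t : ℕ,
      g * M ≤ 600000 * ((Nat.log 2 n + 1) * n ^ 2 + n * g ^ 3 * (Nat.log 2 n + 1) ^ 2) ∧
      t ≤ 10000000 * g ^ 3 * (Nat.log 2 n + 1) ^ 3 ∧
      AnswersThreeSumQueries enc plus A B queryProgram M t := by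
  obtain ⟨lam, hlam⟩ : ∃ lam, lam = Nat.log 2 n + 1 := ⟨_, rfl⟩
  rw [← hlam] at hw ⊢
  have hlam0 : 0 < lam := by omega
  have hnL : n < 2 ^ lam := hlam ▸ Nat.lt_pow_succ_log_self one_lt_two n
  have hlamL : lam < 2 ^ lam := Nat.lt_two_pow_self
  have hgn : g ≤ n := by omega
  have : NeZero (n * n) := ⟨by positivity⟩
  have hnn : 0 < n * n := by positivity
  have hdiv : ∀ x : Fin (n * n), (x : ℕ) / n < n := fun x => Nat.div_lt_of_lt_mul x.2
  have hmod : ∀ x : ℕ, x % n < n := fun x => Nat.mod_lt _ hn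
  let f : Fin (n * n) → ℕ := fun x => (enc (A ⟨x / n, hdiv x⟩ + B ⟨x % n, hmod x⟩)).toNat
  have hf : ∀ x, f x < 2 ^ w := fun x => BitVec.isLt _
  obtain ⟨b, piv, hpiv, hpivf, hb, hbcard⟩ := exists_pivots hnn f hg
  let bk : Fin (n * n) → ℕ := fun x => sortedIndex piv b (f x)
  let light : Fin (n * n) → Prop := fun x => piv (bk x) ≠ f x
  have hle : ∀ v, Nat.card {x // light x ∧ bk x = v} ≤ g :=
    fun v => (hbcard v).trans (Nat.sub_le _ _)
  have hbk : ∀ x, bk x < 2 ^ b := fun x => sortedIndex_lt _ _ _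
  obtain ⟨τ, hτ⟩ : ∃ τ : Tables (n * n), τ.Good light bk (2 ^ b) g lam := by
    rcases hgc with rfl | ⟨h1, h2⟩
    -- For g = 1 a bucket has at most g - 1 = 0 light positions: every sum is a pivot. This settles
    -- those n for which the size conditions fail.
    · refine exists_tables_of_few hn one_pos hlam0 hbk hle ?_
      have : IsEmpty {x // light x} := ⟨fun x => by
        have h := hbcard (bk x)
        rw [Nat.sub_self, Nat.le_zero, Nat.card_eq_zero] at h
        rcases h with h | h
        · exact h.elim ⟨x.1, x.2, rfl⟩
        · exact h.not_finite inferInstance⟩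
      rw [Nat.card_of_isEmpty, zero_mul]
      exact hnn
    · refine exists_tables hn hg hlam0 hbk hle ?_ hb h1 h2
      calc n * n < 2 ^ lam * 2 ^ lam := Nat.mul_self_lt_mul_self hnL
        _ = _ := by rw [← pow_add, two_mul]
  obtain ⟨b', keys, hkmono, hkle, hb', hkeys⟩ := exists_sorted
    ((Finset.range τ.tables).biUnion fun i => (τ.keys i).image (i * 2 ^ b + ·))
    (pad := τ.tables * 2 ^ b) (by
      intro κ hκ
      simp only [Finset.mem_biUnion, Finset.mem_range, Finset.mem_image] at hκ
      obtain ⟨i, hi, v, hv, rfl⟩ := hκ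
      have h1 := hτ.keys_lt i v hv
      calc i * 2 ^ b + v < (i + 1) * 2 ^ b := by rw [add_mul, one_mul]; omega
        _ ≤ _ := Nat.mul_le_mul_right _ hi)
  have hcard : ((Finset.range τ.tables).biUnion fun i => (τ.keys i).image (i * 2 ^ b + ·)).card ≤
      ∑ i ∈ Finset.range τ.tables, (τ.keys i).card :=
    Finset.card_biUnion_le.trans (Finset.sum_le_sum fun i _ => Finset.card_image_le)
  have hgb' : g * 2 ^ b' ≤ 16 * lam * (n * n) + 2 * g := by
    have h1 := hτ.sum_keys
    have h2 := Nat.mul_le_mul_left g (hb'.trans (Nat.mul_le_mul_left 2 (Nat.succ_le_succ hcard)))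
    refine h2.trans ?_
    rw [Nat.mul_succ 2, mul_add]
    linarith
  obtain ⟨c1, c2, c3, c4⟩ := size_bounds hn hg hgn hlam0 hnL.le hlamL.le hb hgb' hτ.shifts_le
  have hbound : ∀ {x}, x ≤ 2 ^ 20 * (2 ^ lam) ^ 7 → x < 2 ^ w := lt_two_pow_of_le hlam0 hw
  obtain ⟨L, hL⟩ : ∃ L, L = 2 ^ lam := ⟨_, rfl⟩
  rw [← hL] at hnL hlamL c1 c2 c3 hbound
  -- All quantities are bounded by a constant below 2^20 times a power of L = 2^lam with exponent at
  -- most 7, so words of 64·lam bits can hold them.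
  have hL0 : 0 < L := by rw [hL]; positivity
  have hpow : ∀ i ≤ 7, L ^ i ≤ L ^ 7 := fun i hi => Nat.pow_le_pow_right hL0 hi
  have p0 := hpow 0 (by norm_num)
  have p1 := hpow 1 (by norm_num)
  have p2 := hpow 2 (by norm_num)
  have p3 := hpow 3 (by norm_num)
  have p5 := hpow 5 (by norm_num)
  rw [pow_zero] at p0
  rw [pow_one] at p1
  have htime : τ.tables * τ.walk * (τ.tries + 1) ≤ 20480 * L ^ 5 := by
    calc _ ≤ 20480 * g ^ 3 * lam ^ 2 := hτ.time_le
      _ ≤ 20480 * L ^ 3 * L ^ 2 := by gcongr; exact hgn.trans hnL.le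
      _ = _ := by ring
  have ht1 : τ.tables ≤ 20480 * L ^ 5 := by
    refine le_trans ?_ htime
    rw [mul_assoc]
    exact Nat.le_mul_of_pos_right _ (Nat.mul_pos hτ.walk_pos (Nat.succ_pos _))
  have ht2 : τ.walk ≤ 20480 * L ^ 5 := by
    refine le_trans ?_ htime
    rw [mul_comm τ.tables, mul_assoc]
    exact Nat.le_mul_of_pos_right _ (Nat.mul_pos hτ.tables_pos (Nat.succ_pos _))
  have ht3 : τ.tries ≤ 20480 * L ^ 5 := by
    refine le_trans (Nat.le_succ _) (le_trans ?_ htime)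
    exact Nat.le_mul_of_pos_left _ (Nat.mul_pos hτ.tables_pos hτ.walk_pos)
  have hnn2 : n * n ≤ L ^ 2 := by rw [sq]; exact Nat.mul_le_mul hnL.le hnL.le
  let fst : ℕ → ℕ := fun i => if h : i < n then (enc (A ⟨i, h⟩)).toNat else 0
  let snd : ℕ → ℕ := fun i => if h : i < n then (enc (B ⟨i, h⟩)).toNat else 0
  set D := τ.layout b b' fst snd piv keys with hD
  have hsize : D.size = n + 2 ^ b + 2 ^ b' + τ.tables * τ.r * τ.tries + 16 := rfl
  have hle : 8 * D.size ≤ 2 ^ w := (hbound (by rw [hsize]; omega)).le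
  have hkr := hτ.k_le
  have hrr := hτ.r_le
  have hF : D.Fits (D.machine plus hle) := by
    refine Layout.fits_machine (by omega) (Nat.le_add_left _ _) (fun _ => rfl) ?_
    exact Layout.header_lt_of (hbound (by change n ≤ _; omega)) (hbound (by change n * n ≤ _; omega))
      (hbound (by change 2 ^ b ≤ _; omega)) (hbound (by change 2 ^ b' ≤ _; omega))
      (hbound (by change τ.tables ≤ _; omega)) (hbound (by change τ.walk ≤ _; omega))
      (hbound (by change τ.tries ≤ _; omega)) (hbound (by change τ.k ≤ _; omega))
      (hbound (by change τ.r ≤ _; omega))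
      (hbound (by change (τ.dflt : ℕ) ≤ _; have := τ.dflt.2; omega)) (hbound (by omega))
  have haux : ∀ a b c d e : ℕ, a ≤ a + b + c + d + e ∧ b ≤ a + b + c + d + e ∧
      c ≤ a + b + c + d + e ∧ d ≤ a + b + c + d + e := fun a b c d e => by omega
  have hvalid : D.Valid w :=
    { n_pos := hn
      n_le := (haux _ _ _ _ _).1
      pow_le := (haux _ _ _ _ _).2.1
      pow_le' := (haux _ _ _ _ _).2.2.1
      shifts_le := (haux _ _ _ _ _).2.2.2
      r_pos := hτ.r_pos
      buckets_le := hτ.le_mul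
      dflt_lt := τ.dflt.2
      pivots_lt := fun i => by
        obtain ⟨x, hx⟩ := hpivf i
        change piv i < _
        rw [hx]; exact hf x
      pivots_mono := fun i j hij _ => hpiv hij
      keys_lt := fun i => hbound ((hkle i).trans (by
        calc τ.tables * 2 ^ b ≤ (20480 * L ^ 5) * (4 * L ^ 2) := Nat.mul_le_mul ht1 c1
          _ = 81920 * L ^ 7 := by ring
          _ ≤ _ := by omega))
      keys_mono := fun i j hij _ => hkmono hij
      values_lt := fun i => (τ.target _ _).2
      rows_lt := fun i => (τ.row _ _ _).2
      cols_lt := fun i => (τ.col _ _ _).2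
      sum_lt := hbound (by change 2 * (n * n) ≤ _; omega)
      key_lt := hbound (by
        calc τ.tables * 2 ^ b ≤ (20480 * L ^ 5) * (4 * L ^ 2) := Nat.mul_le_mul ht1 c1
          _ = 81920 * L ^ 7 := by ring
          _ ≤ _ := by omega) }
  have hval : ∀ x : Fin (n * n), D.val (D.machine plus hle) x = f x := by
    intro x
    change (plus (BitVec.ofNat w (fst (x / n))) (BitVec.ofNat w (snd (x % n)))).toNat = _
    simp only [fst, snd, hdiv x, hmod x, dif_pos, BitVec.ofNat_toNat, BitVec.setWidth_eq, hplus, f]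
  have hlight : ∀ x : Fin (n * n), light x ↔ D.Light (D.val (D.machine plus hle) x) := by
    intro x
    rw [hval]
    rfl
  have hnext : ∀ i < τ.tables, ∀ v < 2 ^ b, D.next (D.machine plus hle) i v = τ.step light i v :=
    fun i hi v hv => Tables.layout_next light hlight hτ.le_mul hτ.r_pos
      (fun i hi v hv => by
        rw [hkeys _ ?_, mem_keySet hτ.keys_lt hi hv]
        calc i * 2 ^ b + v < (i + 1) * 2 ^ b := by rw [add_mul, one_mul]; omega
          _ ≤ _ := Nat.mul_le_mul_right _ hi) hi hv
  refine ⟨8 * D.size, 10000000 * g ^ 3 * lam ^ 3, c4, le_rfl, Layout.answers hF (fun _ => hvalid)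
    (fun c => ?_) ?_⟩
  -- Soundness: pivots are sums of pairs, and a walk succeeds only at a position with value c.
  -- Completeness: a sum is either a pivot or the value of a light position, and `covers` applies to
  -- the latter.
  · have hfc : ∀ x, f x = (enc c).toNat → ∃ i j, A i + B j = c := fun x hx =>
      ⟨_, _, enc.injective (BitVec.eq_of_toNat_eq hx)⟩
    constructor
    · rintro ⟨-, h | ⟨i, -, j, -, h⟩⟩
      · obtain ⟨x, hx⟩ := hpivf (D.bucket (enc c).toNat)
        refine hfc x (hx.symm.trans ?_)
        by_contra h'
        exact h h'
      · have hlt := Layout.Valid.next_lt (m := D.machine plus hle) hvalid i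
          (D.walkFrom (D.machine plus hle) i (D.bucket (enc c).toNat) j)
        exact hfc ⟨_, hlt⟩ ((hval _).symm.trans h)
    · rintro ⟨i, j, rfl⟩
      refine ⟨hn, ?_⟩
      have hx : (i : ℕ) * n + j < n * n := by
        calc (i : ℕ) * n + j < (i + 1) * n := by rw [add_mul, one_mul]; omega
          _ ≤ _ := Nat.mul_le_mul_right _ i.2
      have hfx : f ⟨i * n + j, hx⟩ = (enc (A i + B j)).toNat := by
        simp only [f]
        congr 4
        · refine Fin.ext ?_
          simp only
          rw [mul_comm, Nat.mul_add_div hn, Nat.div_eq_of_lt j.2, add_zero]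
        · refine Fin.ext ?_
          simp only
          rw [mul_comm, Nat.mul_add_mod, Nat.mod_eq_of_lt j.2]
      generalize (⟨i * n + j, hx⟩ : Fin (n * n)) = x at hfx
      rw [← hfx]
      by_cases hl : light x
      · refine Or.inr ?_
        obtain ⟨i, hi, j, hj, h⟩ := hτ.covers x hl
        have hwalk : ∀ j, D.walkFrom (D.machine plus hle) i (D.bucket (f x)) j =
            (fun v => bk (τ.step light i v))^[j] (bk x) ∧
            (fun v => bk (τ.step light i v))^[j] (bk x) < 2 ^ b := by
          intro j
          induction j with
          | zero => exact ⟨rfl, hbk x⟩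
          | succ j ih =>
            rw [Layout.walkFrom, Function.iterate_succ_apply', Function.iterate_succ_apply',
              ← Layout.walkFrom, ih.1, hnext i hi _ ih.2, hval]
            exact ⟨rfl, hbk _⟩
        refine ⟨i, hi, j, hj, ?_⟩
        rw [(hwalk j).1, hnext i hi _ (hwalk j).2, h, hval]
      · exact Or.inl hl
  · refine time_bound hlam0 hτ.tables_pos hτ.walk_pos ?_ ?_ hτ.time_le
    · refine (Nat.pow_le_pow_iff_right one_lt_two).1 (c1.trans ?_)
      rw [hL, ← pow_mul, show 4 = 2 ^ 2 by norm_num, ← pow_add]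
      exact Nat.pow_le_pow_right two_pos (by omega)
    · refine (Nat.pow_le_pow_iff_right one_lt_two).1 (c2.trans ?_)
      calc 18 * L ^ 3 ≤ 2 ^ 5 * L ^ 3 := by omega
        _ = 2 ^ (5 + lam * 3) := by rw [hL, ← pow_mul, ← pow_add]
        _ ≤ _ := Nat.pow_le_pow_right two_pos (by omega)

theorem threeSumIndexingSolvable_of {g : ℕ → ℕ}
    (hg : ∀ n, 0 < g n ∧ (g n = 1 ∨ 256 * g n ^ 3 ≤ n * n ∧ 4 * g n + 4 ≤ n)) :
    ThreeSumIndexingSolvable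
      (fun n => 128 + 600000 * (((Nat.log 2 n : ℝ) + 1) * n ^ 2 / g n +
        n * (g n : ℝ) ^ 2 * ((Nat.log 2 n : ℝ) + 1) ^ 2))
      (fun n => 54 + 10000000 * (g n : ℝ) ^ 3 * ((Nat.log 2 n : ℝ) + 1) ^ 3) := by
  refine ⟨queryProgram, 64, fun n w hw U _ enc plus hplus A B => ?_⟩
  rcases Nat.eq_zero_or_pos n with rfl | hn
  · refine ⟨128, 54, ?_, ?_, answers_of_empty (by simpa using hw) A B le_rfl⟩
    · simp
    · push_cast
      have : (0 : ℝ) ≤ 10000000 * (g 0 : ℝ) ^ 3 * ((Nat.log 2 0 : ℝ) + 1) ^ 3 := by positivity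
      linarith
  · obtain ⟨M, t, hM, ht, h⟩ := exists_answers hn hw (hg n).1 (hg n).2 enc hplus A B
    refine ⟨M, t, ?_, ?_, h⟩
    · have hg0 : (0 : ℝ) < g n := by exact_mod_cast (hg n).1
      have hM' : (g n : ℝ) * M ≤ 600000 * (((Nat.log 2 n : ℝ) + 1) * n ^ 2 +
          n * (g n : ℝ) ^ 3 * ((Nat.log 2 n : ℝ) + 1) ^ 2) := by exact_mod_cast hM
      have e : 600000 * (((Nat.log 2 n : ℝ) + 1) * n ^ 2 / g n +
          n * (g n : ℝ) ^ 2 * ((Nat.log 2 n : ℝ) + 1) ^ 2) =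
          600000 * (((Nat.log 2 n : ℝ) + 1) * n ^ 2 +
          n * (g n : ℝ) ^ 3 * ((Nat.log 2 n : ℝ) + 1) ^ 2) / g n := by
        field_simp
      have h1 : (M : ℝ) ≤ 600000 * (((Nat.log 2 n : ℝ) + 1) * n ^ 2 / g n +
          n * (g n : ℝ) ^ 2 * ((Nat.log 2 n : ℝ) + 1) ^ 2) := by
        rw [e, le_div_iff₀ hg0, mul_comm]
        exact hM'
      linarith
    · have h1 : (t : ℝ) ≤ 10000000 * (g n : ℝ) ^ 3 * ((Nat.log 2 n : ℝ) + 1) ^ 3 := by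
        exact_mod_cast ht
      linarith

/-! ### Asymptotics and choice of the parameter -/

theorem isBigO_natLog : (fun n : ℕ => (Nat.log 2 n : ℝ) + 1) =O[atTop]
    fun n : ℕ => Real.log n := by
  refine IsBigO.of_bound 4 ?_
  filter_upwards [eventually_ge_atTop 3] with n hn
  have h3 : (3 : ℝ) ≤ n := by exact_mod_cast hn
  have h1 : (1 : ℝ) ≤ Real.log n := by
    rw [Real.le_log_iff_exp_le (by linarith)]
    linarith [Real.exp_one_lt_d9]
  have h2 : (Nat.log 2 n : ℝ) * Real.log 2 ≤ Real.log n := by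
    rw [← Real.log_pow]
    refine Real.log_le_log (by positivity) ?_
    exact_mod_cast Nat.pow_log_le_self 2 (by omega)
  have h4 := Real.log_two_gt_d9
  rw [Real.norm_of_nonneg (by positivity), Real.norm_of_nonneg (by linarith)]
  have h5 : (Nat.log 2 n : ℝ) * (1 / 2) ≤ (Nat.log 2 n : ℝ) * Real.log 2 := by
    gcongr
    linarith
  linarith

theorem isLittleO_log_pow (k : ℕ) {r : ℝ} (hr : 0 < r) :
    (fun n : ℕ => Real.log n ^ k) =o[atTop] fun n : ℕ => (n : ℝ) ^ r := by
  have h := (isLittleO_log_rpow_rpow_atTop (k : ℝ) hr).comp_tendsto tendsto_natCast_atTop_atTop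
  simpa only [Function.comp_def, Real.rpow_natCast] using h

theorem isLittleO_natLog_pow (k : ℕ) {r : ℝ} (hr : 0 < r) :
    (fun n : ℕ => ((Nat.log 2 n : ℝ) + 1) ^ k) =o[atTop] fun n : ℕ => (n : ℝ) ^ r :=
  (isBigO_natLog.pow k).trans_isLittleO (isLittleO_log_pow k hr)

theorem isBigO_rpow_of_le {a b : ℝ} (h : a ≤ b) :
    (fun n : ℕ => (n : ℝ) ^ a) =O[atTop] fun n : ℕ => (n : ℝ) ^ b := by
  refine IsBigO.of_bound 1 ?_
  filter_upwards [eventually_ge_atTop 1] with n hn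
  have h1 : (1 : ℝ) ≤ n := by exact_mod_cast hn
  rw [Real.norm_of_nonneg (by positivity), Real.norm_of_nonneg (by positivity), one_mul]
  exact Real.rpow_le_rpow_of_exponent_le h1 h

/-- Integral parameters close to given real ones. -/
theorem exists_parameter {δ : ℝ} (hδ1 : δ < 1) {h : ℕ → ℝ}
    (h1 : ∀ᶠ n in atTop, 1 ≤ h n)
    (hle : ∀ᶠ n in atTop, h n ≤ (n : ℝ) ^ (δ / 3) * ((Nat.log 2 n : ℝ) + 1)) :
    ∃ g : ℕ → ℕ, (∀ n, 0 < g n ∧ (g n = 1 ∨ 256 * g n ^ 3 ≤ n * n ∧ 4 * g n + 4 ≤ n)) ∧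
      ∀ᶠ n in atTop, h n ≤ g n ∧ (g n : ℝ) ≤ 2 * h n := by
  classical
  -- The value 1 is a fallback for the finitely many n at which rounding up violates the size
  -- conditions.
  refine ⟨fun n => if 0 < ⌈h n⌉₊ ∧ (256 * ⌈h n⌉₊ ^ 3 ≤ n * n ∧ 4 * ⌈h n⌉₊ + 4 ≤ n)
    then ⌈h n⌉₊ else 1, fun n => ?_, ?_⟩
  · dsimp only
    split_ifs with hc
    · exact ⟨hc.1, Or.inr hc.2⟩
    · exact ⟨one_pos, Or.inl rfl⟩
  · have hs := (isLittleO_natLog_pow 1 (r := 1 / 3) (by norm_num)).bound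
      (c := 1 / 24) (by norm_num)
    filter_upwards [h1, hle, hs, eventually_ge_atTop 24] with n h1 hle hs hn
    have hn1 : (24 : ℝ) ≤ n := by exact_mod_cast hn
    have hn0 : (0 : ℝ) < n := by linarith
    rw [pow_one, Real.norm_of_nonneg (by positivity), Real.norm_of_nonneg (by positivity)] at hs
    have hg2 : (⌈h n⌉₊ : ℝ) ≤ 2 * h n := by
      have := Nat.ceil_lt_add_one (a := h n) (by linarith)
      linarith
    have hr : (n : ℝ) ^ (δ / 3) ≤ (n : ℝ) ^ (1 / 3 : ℝ) :=
      Real.rpow_le_rpow_of_exponent_le (by linarith) (by linarith)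
    set z : ℝ := (n : ℝ) ^ (1 / 3 : ℝ) with hz
    have hz0 : 0 ≤ z := by positivity
    have hz3 : z ^ 3 = n := by
      rw [hz, ← Real.rpow_natCast, ← Real.rpow_mul hn0.le]
      norm_num
    -- With z = n^(1/3), δ < 1 gives n^(δ/3) ≤ z, and the logarithmic factor is eventually at most
    -- z/24.
    have hg : (⌈h n⌉₊ : ℝ) ≤ 1 / 12 * z ^ 2 := by
      calc (⌈h n⌉₊ : ℝ) ≤ 2 * h n := hg2
        _ ≤ 2 * ((n : ℝ) ^ (δ / 3) * ((Nat.log 2 n : ℝ) + 1)) := by gcongr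
        _ ≤ 2 * (z * (1 / 24 * z)) := by gcongr
        _ = _ := by ring
    have hc : 0 < ⌈h n⌉₊ ∧ (256 * ⌈h n⌉₊ ^ 3 ≤ n * n ∧ 4 * ⌈h n⌉₊ + 4 ≤ n) := by
      refine ⟨Nat.ceil_pos.2 (by linarith), ?_, ?_⟩
      · have : (256 : ℝ) * (⌈h n⌉₊ : ℝ) ^ 3 ≤ n * n := by
          calc (256 : ℝ) * (⌈h n⌉₊ : ℝ) ^ 3 ≤ 256 * (1 / 12 * z ^ 2) ^ 3 := by gcongr
            _ = 256 / 1728 * (z ^ 3 * z ^ 3) := by ring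
            _ = 256 / 1728 * (n * n : ℝ) := by rw [hz3]
            _ ≤ n * n := by nlinarith
        exact_mod_cast this
      · have hz1 : 1 ≤ z := Real.one_le_rpow (by linarith) (by norm_num)
        have : (4 : ℝ) * (⌈h n⌉₊ : ℝ) + 4 ≤ n := by
          have h2 : z ^ 2 ≤ n := by
            rw [← hz3]
            exact pow_le_pow_right₀ hz1 (by norm_num)
          linarith
        exact_mod_cast this
    simp only [if_pos hc]
    exact ⟨Nat.le_ceil _, hg2⟩

theorem exists_solution {δ : ℝ} (hδ1 : δ < 1) {h : ℕ → ℝ} (h1 : ∀ᶠ n in atTop, 1 ≤ h n)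
    (hle : ∀ᶠ n in atTop, h n ≤ (n : ℝ) ^ (δ / 3) * ((Nat.log 2 n : ℝ) + 1)) :
    ∃ space time : ℕ → ℝ, ThreeSumIndexingSolvable space time ∧
      space =O[atTop] (fun n : ℕ => ((Nat.log 2 n : ℝ) + 1) * n ^ 2 / h n +
        n * h n ^ 2 * ((Nat.log 2 n : ℝ) + 1) ^ 2) ∧
      time =O[atTop] (fun n : ℕ => h n ^ 3 * ((Nat.log 2 n : ℝ) + 1) ^ 3) := by
  obtain ⟨g, hg, hgh⟩ := exists_parameter hδ1 h1 hle
  refine ⟨_, _, threeSumIndexingSolvable_of hg, IsBigO.of_bound (128 + 600000 * 4) ?_,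
    IsBigO.of_bound (54 + 10000000 * 8) ?_⟩
  · filter_upwards [h1, hgh, eventually_ge_atTop 1] with n h1 hgh hn
    have hn1 : (1 : ℝ) ≤ n := by exact_mod_cast hn
    have hh0 : 0 < h n := by linarith
    have hg0 : (0 : ℝ) < g n := by linarith
    have hl : (1 : ℝ) ≤ (Nat.log 2 n : ℝ) + 1 := by linarith [Nat.cast_nonneg (α := ℝ) (Nat.log 2 n)]
    generalize (Nat.log 2 n : ℝ) + 1 = l at *
    rw [Real.norm_of_nonneg (by positivity), Real.norm_of_nonneg (by positivity)]
    have a1 : l * n ^ 2 / g n ≤ l * n ^ 2 / h n := by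
      gcongr
      exact hgh.1
    have a2 : n * (g n : ℝ) ^ 2 * l ^ 2 ≤ 4 * (n * h n ^ 2 * l ^ 2) := by
      calc n * (g n : ℝ) ^ 2 * l ^ 2 ≤ n * (2 * h n) ^ 2 * l ^ 2 := by
            gcongr
            exact hgh.2
        _ = _ := by ring
    have a3 : 1 ≤ n * h n ^ 2 * l ^ 2 := by
      have := one_le_pow₀ h1 (n := 2)
      have := one_le_pow₀ hl (n := 2)
      exact one_le_mul_of_one_le_of_one_le (one_le_mul_of_one_le_of_one_le hn1 (by assumption))
        (by assumption)
    have a4 : 0 ≤ l * n ^ 2 / h n := by positivity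
    linarith
  · filter_upwards [h1, hgh, eventually_ge_atTop 1] with n h1 hgh hn
    have hh0 : 0 < h n := by linarith
    have hg0 : (0 : ℝ) < g n := by linarith
    have hl : (1 : ℝ) ≤ (Nat.log 2 n : ℝ) + 1 := by linarith [Nat.cast_nonneg (α := ℝ) (Nat.log 2 n)]
    generalize (Nat.log 2 n : ℝ) + 1 = l at *
    rw [Real.norm_of_nonneg (by positivity), Real.norm_of_nonneg (by positivity)]
    have a2 : (g n : ℝ) ^ 3 * l ^ 3 ≤ 8 * (h n ^ 3 * l ^ 3) := by
      calc (g n : ℝ) ^ 3 * l ^ 3 ≤ (2 * h n) ^ 3 * l ^ 3 := by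
            gcongr
            exact hgh.2
        _ = _ := by ring
    have a3 : 1 ≤ h n ^ 3 * l ^ 3 :=
      one_le_mul_of_one_le_of_one_le (one_le_pow₀ h1) (one_le_pow₀ hl)
    linarith

theorem one_le_natLog_add_one (n : ℕ) : (1 : ℝ) ≤ (Nat.log 2 n : ℝ) + 1 := by
  linarith [Nat.cast_nonneg (α := ℝ) (Nat.log 2 n)]

/-- Powers of the number of elements, in terms of the exponent of the query time. -/
theorem rpow_identities {n : ℕ} (hn : 1 ≤ n) (δ : ℝ) :
    (n : ℝ) ^ 2 / (n : ℝ) ^ (δ / 3) = (n : ℝ) ^ (2 - δ / 3) ∧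
      n * ((n : ℝ) ^ (δ / 3)) ^ 2 = (n : ℝ) ^ (1 + 2 * δ / 3) ∧
      ((n : ℝ) ^ (δ / 3)) ^ 3 = (n : ℝ) ^ δ := by
  have hn0 : (0 : ℝ) < n := by exact_mod_cast hn
  refine ⟨?_, ?_, ?_⟩
  · rw [Real.rpow_sub hn0, Real.rpow_two]
  · rw [Real.rpow_add hn0, Real.rpow_one, ← Real.rpow_natCast, ← Real.rpow_mul hn0.le]
    congr 2
    push_cast
    ring
  · rw [← Real.rpow_natCast, ← Real.rpow_mul hn0.le]
    congr 1
    push_cast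
    ring

/-- Enlarging g by a logarithmic factor cancels the logarithm in n²/g; the time receives six
logarithms. In the other space term, n^(1 + 2δ/3) with four logarithms, these are absorbed by the
gap 1 - δ between the exponents. -/
theorem exists_solution_space {δ : ℝ} (hδ : 0 < δ) (hδ1 : δ < 1) :
    ∃ (k : ℕ) (space time : ℕ → ℝ), ThreeSumIndexingSolvable space time ∧
      space =O[atTop] (fun n : ℕ => (n : ℝ) ^ (2 - δ / 3)) ∧
      time =O[atTop] (fun n : ℕ => (n : ℝ) ^ δ * Real.log n ^ k) := by
  obtain ⟨space, time, h, hs, ht⟩ := exists_solution hδ1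
    (h := fun n => (n : ℝ) ^ (δ / 3) * ((Nat.log 2 n : ℝ) + 1))
    (by
      filter_upwards [eventually_ge_atTop 1] with n hn
      exact one_le_mul_of_one_le_of_one_le
        (Real.one_le_rpow (by exact_mod_cast hn) (by positivity)) (one_le_natLog_add_one n))
    (Eventually.of_forall fun n => le_rfl)
  refine ⟨6, space, time, h, hs.trans ?_, ht.trans ?_⟩
  · have e : (fun n : ℕ => (n : ℝ) ^ (2 - δ / 3) +
        (n : ℝ) ^ (1 + 2 * δ / 3) * ((Nat.log 2 n : ℝ) + 1) ^ 4) =O[atTop]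
        fun n : ℕ => (n : ℝ) ^ (2 - δ / 3) := by
      refine (isBigO_refl _ _).add ?_
      have h1 := (isBigO_refl (fun n : ℕ => (n : ℝ) ^ (1 + 2 * δ / 3)) atTop).mul
        (isLittleO_natLog_pow 4 (sub_pos.2 hδ1)).isBigO
      refine h1.trans (EventuallyEq.isBigO ?_)
      filter_upwards [eventually_ge_atTop 1] with n hn
      rw [← Real.rpow_add (by exact_mod_cast hn)]
      congr 1
      ring
    refine (EventuallyEq.isBigO ?_).trans e
    filter_upwards [eventually_ge_atTop 1] with n hn
    obtain ⟨e1, e2, -⟩ := rpow_identities hn δ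
    have hl := one_le_natLog_add_one n
    rw [← e1, ← e2]
    field_simp
  · have h1 := (isBigO_refl (fun n : ℕ => (n : ℝ) ^ δ) atTop).mul (isBigO_natLog.pow 6)
    refine (EventuallyEq.isBigO ?_).trans h1
    filter_upwards [eventually_ge_atTop 1] with n hn
    obtain ⟨-, -, e3⟩ := rpow_identities hn δ
    rw [← e3]
    ring

/-- Dividing g by a logarithmic factor cancels the three logarithms in the time, and n²/g then
carries two. -/
theorem exists_solution_time {δ : ℝ} (hδ : 0 < δ) (hδ1 : δ < 1) :
    ∃ (k : ℕ) (space time : ℕ → ℝ), ThreeSumIndexingSolvable space time ∧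
      space =O[atTop] (fun n : ℕ => (n : ℝ) ^ (2 - δ / 3) * Real.log n ^ k) ∧
      time =O[atTop] (fun n : ℕ => (n : ℝ) ^ δ) := by
  obtain ⟨space, time, h, hs, ht⟩ := exists_solution hδ1
    (h := fun n => (n : ℝ) ^ (δ / 3) / ((Nat.log 2 n : ℝ) + 1))
    (by
      filter_upwards [(isLittleO_natLog_pow 1 (r := δ / 3) (by positivity)).bound one_pos] with n hn
      have hl := one_le_natLog_add_one n
      rw [pow_one, Real.norm_of_nonneg (by positivity), Real.norm_of_nonneg (by positivity),
        one_mul] at hn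
      rwa [one_le_div (by linarith)])
    (Eventually.of_forall fun n => by
      have hl := one_le_natLog_add_one n
      have h0 : (0 : ℝ) ≤ (n : ℝ) ^ (δ / 3) := by positivity
      exact (div_le_self h0 hl).trans (le_mul_of_one_le_right h0 hl))
  refine ⟨2, space, time, h, hs.trans ?_, ht.trans ?_⟩
  · have h1 := (isBigO_refl (fun n : ℕ => (n : ℝ) ^ (2 - δ / 3)) atTop).mul (isBigO_natLog.pow 2)
    refine IsBigO.trans (IsBigO.of_bound 2 ?_) h1
    filter_upwards [eventually_ge_atTop 1] with n hn
    obtain ⟨e1, e2, -⟩ := rpow_identities hn δ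
    have hl := one_le_natLog_add_one n
    have hn1 : (1 : ℝ) ≤ n := by exact_mod_cast hn
    rw [Real.norm_of_nonneg (by positivity), Real.norm_of_nonneg (by positivity)]
    have h2 : (n : ℝ) ^ (1 + 2 * δ / 3) ≤ (n : ℝ) ^ (2 - δ / 3) :=
      Real.rpow_le_rpow_of_exponent_le hn1 (by linarith)
    have h3 : (n : ℝ) ^ (2 - δ / 3) * 1 ≤ (n : ℝ) ^ (2 - δ / 3) * ((Nat.log 2 n : ℝ) + 1) ^ 2 := by
      gcongr
      exact one_le_pow₀ hl
    have e : ((Nat.log 2 n : ℝ) + 1) * n ^ 2 / ((n : ℝ) ^ (δ / 3) / ((Nat.log 2 n : ℝ) + 1)) +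
        n * ((n : ℝ) ^ (δ / 3) / ((Nat.log 2 n : ℝ) + 1)) ^ 2 * ((Nat.log 2 n : ℝ) + 1) ^ 2 =
        (n : ℝ) ^ (2 - δ / 3) * ((Nat.log 2 n : ℝ) + 1) ^ 2 + (n : ℝ) ^ (1 + 2 * δ / 3) := by
      rw [← e1, ← e2]
      field_simp
    rw [e]
    linarith
  · refine EventuallyEq.isBigO ?_
    filter_upwards [eventually_ge_atTop 1] with n hn
    obtain ⟨-, -, e3⟩ := rpow_identities hn δ
    have hl := one_le_natLog_add_one n
    rw [← e3]
    field_simp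

theorem theorem1 :
    (∀ δ : ℝ, 0 < δ → δ < 1 →
      (∃ (k : ℕ) (space time : ℕ → ℝ), ThreeSumIndexingSolvable space time ∧
        space =O[atTop] (fun n : ℕ => (n : ℝ) ^ (2 - δ / 3)) ∧
        time =O[atTop] (fun n : ℕ => (n : ℝ) ^ δ * Real.log n ^ k)) ∧
      (∃ (k : ℕ) (space time : ℕ → ℝ), ThreeSumIndexingSolvable space time ∧
        space =O[atTop] (fun n : ℕ => (n : ℝ) ^ (2 - δ / 3) * Real.log n ^ k) ∧
        time =O[atTop] (fun n : ℕ => (n : ℝ) ^ δ))) ∧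
    ¬ StrongThreeSumIndexingConjecture := by
  refine ⟨fun δ hδ hδ1 => ⟨exists_solution_space hδ hδ1, exists_solution_time hδ hδ1⟩, ?_⟩
  obtain ⟨k, space, time, h, hs, ht⟩ := exists_solution_time (δ := 3 / 4) (by norm_num) (by norm_num)
  -- For δ = 3/4 the space exponent is 7/4. Absorbing the logarithms into n^(1/20) gives 9/5 = 2 -
  -- 1/5, while 3/4 ≤ 4/5 = 1 - 1/5 for the time.
  refine not_not_intro ⟨1 / 5, by norm_num, space, time, h, hs.trans ?_, ht.trans ?_⟩
  · have h1 := (isBigO_refl (fun n : ℕ => (n : ℝ) ^ (2 - 3 / 4 / 3 : ℝ)) atTop).mul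
      (isLittleO_log_pow k (r := 1 / 20) (by norm_num)).isBigO
    refine h1.trans (EventuallyEq.isBigO ?_)
    filter_upwards [eventually_ge_atTop 1] with n hn
    rw [← Real.rpow_add (by exact_mod_cast hn)]
    norm_num
  · exact isBigO_rpow_of_le (by norm_num)
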